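/- All manifolds, maps and forms are smooth; manifolds are without boundary, Hausdorff and second countable. A \emph{cocontact manifold} $(M,\theta,\eta)$ is a $(2n+2)$-dimensional manifold $M$ with a closed $1$-form $\theta$ and a $1$-form $\eta$ such that $\theta\wedge\eta\wedge(d\eta)^n$ is a volume form (vanishes nowhere). Then $$\flat\colon TM\to T^*M,\qquad \flat(v)=\theta(v)\,\theta+i_v d\eta+\eta(v)\,\eta$$ is an isomorphism; put $\sharp=\flat^{-1}$, let $\mathcal R_t=\sharp(\theta)$ and $\mathcal R_z=\sharp(\eta)$ be the Reeb vector fields, and let $\Lambda(\alpha,\beta)=-d\eta(\sharp\alpha,\sharp\beta)$ and $\sharp_\Lambda(\alpha)=i_\alpha\Lambda$. For a subspace $\Delta\subseteq T_xM$ with annihilator $\Delta^0\subseteq T_x^*M$ let $\Delta^{\perp_\Lambda}=\sharp_\Lambda(\Delta^0)$. \textbf{Theorem ($tz$-vertical coisotropic reduction).} Let $(M,\theta,\eta)$ be a cocontact manifold of dimension $2n+2$ and let $i\colon N\hookrightarrow M$ be a nonempty (injectively immersed, e.g. embedded) submanifold of dimension $k+2$ that is coisotropic, i.e. $(T_qN)^{\perp_\Lambda}\subseteq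 T_qN$ for all $q\in N$, and $tz$-vertical, i.e. $\mathcal R_t(q),\mathcal R_z(q)\in T_qN$ for all $q\in N$. Let $\mathcal F$ be the foliation of $N$ tangent to the distribution $(TN)^{\perp_\Lambda}$; two points are on the same leaf if and only if they are joined by a piecewise $C^1$ curve in $N$ tangent to $(TN)^{\perp_\Lambda}$. Suppose that the space of leaves $N/\mathcal F$ carries a manifold structure for which the canonical projection $\pi\colon N\to N/\mathcal F$ is a submersion. Then there are unique $1$-forms $\theta_N$ and $\eta_N$ on $N/\mathcal F$ with $$i^*\theta=\pi^*\theta_N,\qquad i^*\eta=\pi^*\eta_N .$$ Moreover $k\ge n$, $\dim N/\mathcal F=2(k-n)+2$, and $(N/\mathcal F,\theta_N,\eta_N)$ is a cocontact manifold; that is, $\theta_N$ is closed and $\theta_N\wedge\eta_N\wedge(d\eta_N)^{k-n}$ is a volume form. -/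

import Mathlib

open Set Manifold
open scoped Manifold ContDiff

noncomputable section

namespace CocontactGeometry

/-! ### Linear algebra on a single tangent space

`V` plays the role of a tangent space, `θ`, `η` are covectors and `Ω` is the value of `dη`. -/

section Linear

/-- The map `♭ : v ↦ θ(v) θ + i_v Ω + η(v) η`. -/
def flat {V : Type*} [AddCommGroup V] [Module ℝ V]
    (θ η : Module.Dual ℝ V) (Ω : V →ₗ[ℝ] V →ₗ[ℝ] ℝ) : V →ₗ[ℝ] Module.Dual ℝ V :=
  θ.smulRight θ + Ω + η.smulRight η

open Classical in
/-- The inverse `♯` of `♭`. On a cocontact manifold `♭` is always bijective, so that the value `0`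
chosen in the other case is never used there. -/
def sharp {V : Type*} [AddCommGroup V] [Module ℝ V]
    (θ η : Module.Dual ℝ V) (Ω : V →ₗ[ℝ] V →ₗ[ℝ] ℝ) : Module.Dual ℝ V →ₗ[ℝ] V :=
  if h : Function.Bijective (flat θ η Ω) then
    ((LinearEquiv.ofBijective (flat θ η Ω) h).symm : Module.Dual ℝ V →ₗ[ℝ] V)
  else 0

/-- The Jacobi tensor `Λ(α, β) = - Ω(♯ α, ♯ β)`. -/
def jacobiTensor {V : Type*} [AddCommGroup V] [Module ℝ V]
    (θ η : Module.Dual ℝ V) (Ω : V →ₗ[ℝ] V →ₗ[ℝ] ℝ) :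
    Module.Dual ℝ V →ₗ[ℝ] Module.Dual ℝ V →ₗ[ℝ] ℝ :=
  -(Ω.compl₁₂ (sharp θ η Ω) (sharp θ η Ω))

/-- The map `♯_Λ : α ↦ i_α Λ`: the vector `♯_Λ α` is determined by `β (♯_Λ α) = Λ(α, β)`. -/
def sharpLambda {V : Type*} [AddCommGroup V] [Module ℝ V] [Module.Finite ℝ V]
    (θ η : Module.Dual ℝ V) (Ω : V →ₗ[ℝ] V →ₗ[ℝ] ℝ) : Module.Dual ℝ V →ₗ[ℝ] V :=
  ((Module.evalEquiv ℝ V).symm : Module.Dual ℝ (Module.Dual ℝ V) →ₗ[ℝ] V) ∘ₗ jacobiTensor θ η Ω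

/-- The `Λ`-orthogonal `Δ^{⊥Λ} = ♯_Λ(Δ⁰)`, with `Δ⁰` the annihilator of `Δ`. -/
def lambdaOrthogonal {V : Type*} [AddCommGroup V] [Module ℝ V] [Module.Finite ℝ V]
    (θ η : Module.Dual ℝ V) (Ω : V →ₗ[ℝ] V →ₗ[ℝ] ℝ) (Δ : Submodule ℝ V) : Submodule ℝ V :=
  Δ.dualAnnihilator.map (sharpLambda θ η Ω)

/-- The alternating form `θ ∧ η ∧ Ω^m` of degree `2m + 2`, evaluated on `v 0, …, v (2m + 1)`, for
`Ω` an alternating bilinear form. -/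
def wedgePow {V : Type*} [AddCommGroup V] [Module ℝ V] (m : ℕ)
    (θ η : Module.Dual ℝ V) (Ω : V →ₗ[ℝ] V →ₗ[ℝ] ℝ) (v : Fin (2 * m + 2) → V) : ℝ :=
  (1 / 2 ^ m : ℝ) * ∑ σ : Equiv.Perm (Fin (2 * m + 2)), ((Equiv.Perm.sign σ : ℤ) : ℝ) *
    (θ (v (σ 0)) * η (v (σ 1)) *
      ∏ j : Fin m, Ω (v (σ ⟨2 * j + 2, by omega⟩)) (v (σ ⟨2 * j + 3, by omega⟩)))

end Linear

/-! ### One-forms on manifolds -/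

section Forms

/-- The model space `ℝ^d`. -/
abbrev Model (d : ℕ) : Type := EuclideanSpace ℝ (Fin d)

instance instFiniteTangentSpace {d : ℕ} {M : Type*} [TopologicalSpace M] [ChartedSpace (Model d) M]
    (x : M) : Module.Finite ℝ (TangentSpace (𝓡 d) x) :=
  inferInstanceAs (Module.Finite ℝ (EuclideanSpace ℝ (Fin d)))

/-- Smooth one-forms on a `d`-dimensional manifold: smooth sections of the cotangent bundle. -/
abbrev OneForm (d : ℕ) (M : Type*) [TopologicalSpace M] [ChartedSpace (Model d) M]
    [IsManifold (𝓡 d) ∞ M] : Type _ :=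
  ContMDiffSection (𝓡 d) (Model d →L[ℝ] ℝ) ∞
    (fun x : M ↦ TangentSpace (𝓡 d) x →L[ℝ] Bundle.Trivial M ℝ x)

variable {d : ℕ} {M : Type*} [TopologicalSpace M] [ChartedSpace (Model d) M]
  [IsManifold (𝓡 d) ∞ M]

/-- The value of a one-form at a point, as a covector. -/
def OneForm.covec (α : OneForm d M) (x : M) : Module.Dual ℝ (TangentSpace (𝓡 d) x) :=
  ((α x : TangentSpace (𝓡 d) x →L[ℝ] ℝ) : TangentSpace (𝓡 d) x →ₗ[ℝ] ℝ)

/-- The expression of a one-form in the preferred chart `φ` at `x`: the pullback `(φ⁻¹)^* α`, a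
one-form on the target of `φ`. -/
def OneForm.inChart (α : OneForm d M) (x : M) (y : Model d) : Model d →L[ℝ] ℝ :=
  (α ((extChartAt (𝓡 d) x).symm y) :
      TangentSpace (𝓡 d) ((extChartAt (𝓡 d) x).symm y) →L[ℝ] ℝ).comp
    (mfderiv 𝓘(ℝ, Model d) (𝓡 d) (extChartAt (𝓡 d) x).symm y)

/-- The exterior derivative of a one-form `α` at `x`, computed in the preferred chart `φ` at `x`
(whose differential at `x` is the identification of the tangent space at `x` with `ℝ^d`):
`dα (u, v) = D_u a (v) - D_v a (u)` at `φ x`, where `a = (φ⁻¹)^* α`. -/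
def OneForm.extDeriv (α : OneForm d M) (x : M) :
    TangentSpace (𝓡 d) x →ₗ[ℝ] TangentSpace (𝓡 d) x →ₗ[ℝ] ℝ :=
  letI A : Model d →L[ℝ] Model d →L[ℝ] ℝ :=
    fderiv ℝ (α.inChart x) (extChartAt (𝓡 d) x x)
  ((A - A.flip).toLinearMap₁₂ : Model d →ₗ[ℝ] Model d →ₗ[ℝ] ℝ)

/-- The pullback `f^* α` of a one-form along a smooth map, evaluated at the point `q`. -/
def OneForm.pullback (e : ℕ) {N : Type*} [TopologicalSpace N] [ChartedSpace (Model e) N]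
    (α : OneForm d M) (f : N → M) (q : N) :
    Module.Dual ℝ (TangentSpace (𝓡 e) q) :=
  (α.covec (f q)).comp (mfderiv (𝓡 e) (𝓡 d) f q : TangentSpace (𝓡 e) q →ₗ[ℝ] _)

end Forms

/-! ### Cocontact manifolds and their submanifolds -/

section Cocontact

variable {d : ℕ} {M : Type*} [TopologicalSpace M] [ChartedSpace (Model d) M]
  [IsManifold (𝓡 d) ∞ M]

/-- `(M, θ, η)` is a cocontact manifold of dimension `2m + 2`: `θ` is closed and
`θ ∧ η ∧ (dη)^m` is a volume form, i.e. a top-degree form that vanishes nowhere. -/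
structure IsCocontact (m : ℕ) (θ η : OneForm d M) : Prop where
  dim_eq : d = 2 * m + 2
  closed : ∀ x, θ.extDeriv x = 0
  volume : ∀ x, ∃ v : Fin (2 * m + 2) → TangentSpace (𝓡 d) x,
    wedgePow m (θ.covec x) (η.covec x) (η.extDeriv x) v ≠ 0

/-- The Reeb vector field `R_t = ♯ θ`. -/
def reebT (θ η : OneForm d M) (x : M) : TangentSpace (𝓡 d) x :=
  sharp (θ.covec x) (η.covec x) (η.extDeriv x) (θ.covec x)

/-- The Reeb vector field `R_z = ♯ η`. -/
def reebZ (θ η : OneForm d M) (x : M) : TangentSpace (𝓡 d) x :=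
  sharp (θ.covec x) (η.covec x) (η.extDeriv x) (η.covec x)

/-- The tangent space `T_qN`, as a subspace of the tangent space of `M` at `i q`. -/
def tangentRange {d : ℕ} {M : Type*} [TopologicalSpace M] [ChartedSpace (Model d) M]
    (e : ℕ) {N : Type*} [TopologicalSpace N] [ChartedSpace (Model e) N] (i : N → M) (q : N) : Submodule ℝ (TangentSpace (𝓡 d) (i q)) :=
  LinearMap.range (mfderiv (𝓡 e) (𝓡 d) i q : TangentSpace (𝓡 e) q →ₗ[ℝ] _)

/-- The `Λ`-orthogonal `(T_qN)^{⊥Λ}`, as a subspace of the tangent space of `M` at `i q`. -/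
def tangentOrthogonal (e : ℕ) {N : Type*} [TopologicalSpace N] [ChartedSpace (Model e) N]
    (θ η : OneForm d M) (i : N → M) (q : N) :
    Submodule ℝ (TangentSpace (𝓡 d) (i q)) :=
  lambdaOrthogonal (θ.covec (i q)) (η.covec (i q)) (η.extDeriv (i q)) (tangentRange e i q)

/-- `i : N → M` is coisotropic: `(TN)^{⊥Λ} ⊆ TN`. -/
def IsCoisotropic (e : ℕ) {N : Type*} [TopologicalSpace N] [ChartedSpace (Model e) N]
    (θ η : OneForm d M) (i : N → M) : Prop :=
  ∀ q, tangentOrthogonal e θ η i q ≤ tangentRange e i q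

/-- `i : N → M` is `tz`-vertical: both Reeb vector fields are tangent to `N`. -/
def IsTZVertical (e : ℕ) {N : Type*} [TopologicalSpace N] [ChartedSpace (Model e) N]
    (θ η : OneForm d M) (i : N → M) : Prop :=
  ∀ q, reebT θ η (i q) ∈ tangentRange e i q ∧ reebZ θ η (i q) ∈ tangentRange e i q

/-- `(TN)^{⊥Λ}` as a distribution on `N`: the vectors tangent to `N` whose image under the
differential of `i` lies in `(TN)^{⊥Λ}`. -/
def characteristicDistribution (e : ℕ) {N : Type*} [TopologicalSpace N] [ChartedSpace (Model e) N]
    (θ η : OneForm d M) (i : N → M) (q : N) : Submodule ℝ (TangentSpace (𝓡 e) q) :=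
  (tangentOrthogonal e θ η i q).comap
    (mfderiv (𝓡 e) (𝓡 d) i q : TangentSpace (𝓡 e) q →ₗ[ℝ] _)

end Cocontact

/-! ### Leaves -/

section Leaves

variable {e : ℕ} {N : Type*} [TopologicalSpace N] [ChartedSpace (Model e) N]

/-- `q` and `q'` are joined by a `C¹` curve in `N` that is everywhere tangent to `D`. -/
def JoinedByTangentCurve (D : ∀ q : N, Submodule ℝ (TangentSpace (𝓡 e) q)) (q q' : N) : Prop :=
  ∃ γ : ℝ → N, γ 0 = q ∧ γ 1 = q' ∧ ContMDiffOn 𝓘(ℝ, ℝ) (𝓡 e) 1 γ (Icc 0 1) ∧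
    ∀ t ∈ Icc (0 : ℝ) 1,
      (mfderivWithin 𝓘(ℝ, ℝ) (𝓡 e) γ (Icc 0 1) t : ℝ →L[ℝ] TangentSpace (𝓡 e) (γ t)) 1 ∈ D (γ t)

/-- Two points are on the same leaf of the foliation tangent to `D` if they are joined by a
piecewise `C¹` curve tangent to `D`. For an involutive distribution `D` of constant rank, the
equivalence classes are the maximal connected integral submanifolds of `D`. -/
def leafSetoid (D : ∀ q : N, Submodule ℝ (TangentSpace (𝓡 e) q)) : Setoid N :=
  ⟨Relation.EqvGen (JoinedByTangentCurve D), Relation.EqvGen.is_equivalence _⟩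

/-- The space of leaves `N / F` of the foliation `F` tangent to `D`. It carries no topology by
itself, so that a manifold structure on it can be given in the theorem. -/
def LeafSpace (D : ∀ q : N, Submodule ℝ (TangentSpace (𝓡 e) q)) : Type _ :=
  Quotient (leafSetoid D)

/-- The canonical projection `π : N → N / F`. -/
def leafProj (D : ∀ q : N, Submodule ℝ (TangentSpace (𝓡 e) q)) (q : N) : LeafSpace D :=
  Quotient.mk (leafSetoid D) q

end Leaves

/-! ### The reduced space -/

section Reduced

variable {d : ℕ} {M : Type*} [TopologicalSpace M] [ChartedSpace (Model d) M]
  [IsManifold (𝓡 d) ∞ M]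

/-- The space `N / F` of leaves of the foliation `F` of `N` tangent to `(TN)^{⊥Λ}`. -/
abbrev ReducedSpace (e : ℕ) {N : Type*} [TopologicalSpace N] [ChartedSpace (Model e) N]
    (θ η : OneForm d M) (i : N → M) : Type _ :=
  LeafSpace (characteristicDistribution e θ η i)

/-- The canonical projection `π : N → N / F`. -/
abbrev reducedProj (e : ℕ) {N : Type*} [TopologicalSpace N] [ChartedSpace (Model e) N]
    (θ η : OneForm d M) (i : N → M) : N → ReducedSpace e θ η i :=
  leafProj (characteristicDistribution e θ η i)

end Reduced

end CocontactGeometry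

end

/-! At a point, the volume condition says that `θ` and `η` are independent and that `Ω = dη` is
nondegenerate on `ker θ ∩ ker η` (`exists_wedgePow_ne_zero_iff_coNondegenerate`). If `TN` contains
both Reeb vectors, then `♯_Λ` agrees with `♯` on the annihilator of `TN`, so `(TN)^{⊥Λ}` consists of
the vectors of `ker θ ∩ ker η` that are `Ω`-orthogonal to `TN`, and its dimension is the codimension
of `TN`. Inside `N` the characteristic distribution `D` is therefore the common kernel of `i^*θ`,
`i^*η` and `i^*dη`. Coisotropy makes its rank constant, and since `dθ = 0` it is involutive.

The geometric core is `ker dπ = D`. A local Frobenius theorem (`exists_plaqueMap`), obtained from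
flows of commuting fields, gives maps whose level sets are the plaques of `D`. Curves tangent to `D`
stay in a leaf, so `D ⊆ ker dπ`. Conversely, a vector of `ker dπ` is the velocity of a curve in a
fibre, that is, in a leaf. By second countability a leaf meets each plaque chart in countably many
plaques, so a plaque map is constant along the curve and the velocity lies in `D`.

Since `ker dπ = D`, both `i^*θ` and `i^*η` are annihilated, together with their exterior
derivatives, by vertical vectors. Such a form is locally constant along a fibre, and the fibres are
path connected, so it descends (`exists_oneForm_pullback_eq`). Uniqueness holds because `π` and `dπ`
are surjective. Naturality of `d` gives closedness, and `CoNondegenerate.reduction` gives pointwise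
nondegeneracy: the radical of `Ω` on `TN ∩ ker θ ∩ ker η` is exactly what is divided out.

With `r` the rank of `D`, the relations `d + r = k + 2` and `k + 2 + r = 2 n + 2` give the
dimension; independence of the reduced forms forces `d ≥ 2`, hence `n ≤ k`. -/

namespace CocontactGeometry

/-! ### The top-degree form as an antisymmetrized product over pairs. -/

section LinearAlgebra

open Equiv in
/-- A permutation of `k` pairs that maps pairs to pairs has as its sign the number of pairs whose
order it reverses. -/
lemma sign_eq_prod_of_preserves_pairs {k : ℕ} (σ : Perm (Fin k × Fin 2))
    (h : ∀ j, (σ (j, 0)).1 = (σ (j, 1)).1) :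
    ((Perm.sign σ : ℤ) : ℝ) = ∏ j, (if (σ (j, 0)).2 = 0 then (1 : ℝ) else -1) := by
  have hsurj : Function.Surjective (fun j ↦ (σ (j, 0)).1) := by
    intro i
    obtain ⟨⟨j, c⟩, hj⟩ := σ.surjective (i, 0)
    refine ⟨j, ?_⟩
    have : (σ (j, c)).1 = i := by rw [hj]
    fin_cases c
    · exact this
    · exact (h j).trans this
  let τ : Perm (Fin k) := Equiv.ofBijective _ (Finite.surjective_iff_bijective.1 hsurj)
  let ρ : Fin k → Perm (Fin 2) := fun j ↦ if (σ (j, 0)).2 = 0 then 1 else swap 0 1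
  have hσ : σ = Equiv.prodCongrLeft (fun _ ↦ τ) * Equiv.prodCongrRight ρ := by
    ext1 ⟨j, c⟩
    have hne : (σ (j, 0)).2 ≠ (σ (j, 1)).2 := fun hc ↦ by
      have := σ.injective (Prod.ext (h j) hc)
      simp at this
    have h1 : (σ (j, c)).1 = τ j := by
      fin_cases c
      · rfl
      · exact (h j).symm
    refine Prod.ext (by simpa using h1) ?_
    simp only [Perm.coe_mul, Function.comp_apply, prodCongrRight_apply, prodCongrLeft_apply, ρ]
    split_ifs with h0
    · fin_cases c
      · simpa using h0
      · simp only [Fin.mk_one, Perm.coe_one, id_eq]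
        generalize (σ (j, 1)).2 = x at *
        rw [h0] at hne
        fin_cases x
        · exact absurd rfl hne
        · rfl
    · generalize h0' : (σ (j, 0)).2 = x at *
      have hx : x = 1 := by fin_cases x; exact absurd rfl h0; rfl
      subst hx
      fin_cases c
      · simpa using h0'
      · simp only [Fin.mk_one, swap_apply_right]
        generalize (σ (j, 1)).2 = y at *
        fin_cases y
        · rfl
        · exact absurd rfl hne
  -- The permutation `τ` of the pairs acts once on each of the two slots, so its sign enters
  -- squared.
  have hs : Perm.sign σ = ∏ j, Perm.sign (ρ j) := by
    conv_lhs => rw [hσ]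
    rw [Perm.sign_mul, Perm.sign_prodCongrLeft, Perm.sign_prodCongrRight]
    simp
  rw [hs]
  push_cast
  refine Finset.prod_congr rfl fun j _ ↦ ?_
  simp only [ρ]
  split_ifs <;> simp

variable {V : Type*} [AddCommGroup V] [Module ℝ V]

lemma prod_update_pair {k : ℕ} [DecidableEq (Fin k × Fin 2)] (B : Fin k → V →ₗ[ℝ] V →ₗ[ℝ] ℝ)
    (v : Fin k × Fin 2 → V) (i : Fin k) (c : Fin 2) (z : V) :
    ∏ j, B j (Function.update v (i, c) z (j, 0)) (Function.update v (i, c) z (j, 1))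
      = B i (Function.update v (i, c) z (i, 0)) (Function.update v (i, c) z (i, 1)) *
        ∏ j ∈ Finset.univ.erase i, B j (v (j, 0)) (v (j, 1)) := by
  rw [← Finset.mul_prod_erase _ _ (Finset.mem_univ i)]
  congr 1
  refine Finset.prod_congr rfl fun j hj ↦ ?_
  have hj : j ≠ i := Finset.ne_of_mem_erase hj
  rw [Function.update_of_ne (by simp [hj]), Function.update_of_ne (by simp [hj])]

/-- The multilinear map `v ↦ ∏ j, B j (v (j, 0)) (v (j, 1))`. -/
noncomputable def pairMul {k : ℕ} (B : Fin k → V →ₗ[ℝ] V →ₗ[ℝ] ℝ) :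
    MultilinearMap ℝ (fun _ : Fin k × Fin 2 ↦ V) ℝ where
  toFun v := ∏ j, B j (v (j, 0)) (v (j, 1))
  map_update_add' := by
    intro _ v ⟨i, c⟩ x y
    refine (prod_update_pair B v i c _).trans (Eq.trans ?_ (congrArg₂ (· + ·)
      (prod_update_pair B v i c x) (prod_update_pair B v i c y)).symm)
    rw [← add_mul]
    congr 1
    fin_cases c <;> simp
  map_update_smul' := by
    intro _ v ⟨i, c⟩ a x
    refine (prod_update_pair B v i c _).trans (Eq.trans ?_ (congrArg (a • ·)
      (prod_update_pair B v i c x)).symm)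
    rw [smul_eq_mul, ← mul_assoc]
    congr 1
    fin_cases c <;> simp

/-- The antisymmetrization of `v ↦ ∏ j, B j (v (j, 0)) (v (j, 1))`. -/
noncomputable def pairForm {k : ℕ} (B : Fin k → V →ₗ[ℝ] V →ₗ[ℝ] ℝ) : V [⋀^Fin k × Fin 2]→ₗ[ℝ] ℝ :=
  MultilinearMap.alternatization (pairMul B)

lemma pairForm_apply {k : ℕ} (B : Fin k → V →ₗ[ℝ] V →ₗ[ℝ] ℝ) (v : Fin k × Fin 2 → V) :
    pairForm B v = ∑ σ : Equiv.Perm (Fin k × Fin 2), ((Equiv.Perm.sign σ : ℤ) : ℝ) *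
      ∏ j, B j (v (σ (j, 0))) (v (σ (j, 1))) := by
  rw [pairForm, MultilinearMap.alternatization_apply]
  refine Finset.sum_congr rfl fun σ _ ↦ ?_
  rw [MultilinearMap.domDomCongr_apply, Units.smul_def, zsmul_eq_mul]
  rfl

/-- The bilinear forms whose product antisymmetrizes to `θ ∧ η ∧ Ω^m`. -/
noncomputable def wedgeFactors (m : ℕ) (θ η : Module.Dual ℝ V) (Ω : V →ₗ[ℝ] V →ₗ[ℝ] ℝ) :
    Fin (m + 1) → V →ₗ[ℝ] V →ₗ[ℝ] ℝ :=
  Fin.cons (θ.smulRight η) (fun _ ↦ Ω)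

lemma prod_wedgeFactors (m : ℕ) (θ η : Module.Dual ℝ V) (Ω : V →ₗ[ℝ] V →ₗ[ℝ] ℝ)
    (v : Fin (m + 1) × Fin 2 → V) :
    ∏ j, wedgeFactors m θ η Ω j (v (j, 0)) (v (j, 1)) =
      θ (v (0, 0)) * η (v (0, 1)) * ∏ j : Fin m, Ω (v (j.succ, 0)) (v (j.succ, 1)) := by
  rw [Fin.prod_univ_succ]
  simp [wedgeFactors]

/-- The pairs `(2 j, 2 j + 1)` of indices. -/
def pairEquiv (m : ℕ) : Fin (m + 1) × Fin 2 ≃ Fin (2 * m + 2) :=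
  finProdFinEquiv.trans (finCongr (by ring))

/-- Grouping the indices as pairs `(2 j, 2 j + 1)` exhibits the form as a multiple of an honest
alternating map, which can then be tested on bases. -/
lemma wedgePow_eq_pairForm (m : ℕ) (θ η : Module.Dual ℝ V) (Ω : V →ₗ[ℝ] V →ₗ[ℝ] ℝ)
    (v : Fin (2 * m + 2) → V) :
    wedgePow m θ η Ω v = (1 / 2 ^ m : ℝ) * pairForm (wedgeFactors m θ η Ω) (v ∘ pairEquiv m) := by
  rw [wedgePow, pairForm_apply]
  congr 1
  refine Fintype.sum_equiv (pairEquiv m).symm.permCongr _ _ fun σ ↦ ?_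
  rw [Equiv.Perm.sign_permCongr]
  congr 1
  have := prod_wedgeFactors m θ η Ω (fun p ↦ v (σ (pairEquiv m p)))
  have h0 : pairEquiv m (0, 0) = 0 := by ext; simp [pairEquiv]
  have h1 : pairEquiv m (0, 1) = 1 := by ext; simp [pairEquiv]
  have h2 : ∀ j : Fin m, pairEquiv m (j.succ, 0) = ⟨2 * j + 2, by omega⟩ := by
    intro j; ext; simp [pairEquiv]; ring
  have h3 : ∀ j : Fin m, pairEquiv m (j.succ, 1) = ⟨2 * j + 3, by omega⟩ := by
    intro j; ext; simp [pairEquiv]; ring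
  simp only [h0, h1, h2, h3] at this
  rw [← this]
  simp [Equiv.permCongr_apply]

lemma exists_wedgePow_ne_zero_iff (m : ℕ) (θ η : Module.Dual ℝ V) (Ω : V →ₗ[ℝ] V →ₗ[ℝ] ℝ) :
    (∃ v, wedgePow m θ η Ω v ≠ 0) ↔ pairForm (wedgeFactors m θ η Ω) ≠ 0 := by
  constructor
  · rintro ⟨v, hv⟩ h
    rw [wedgePow_eq_pairForm, h] at hv
    simp at hv
  · intro h
    obtain ⟨u, hu⟩ : ∃ u, pairForm (wedgeFactors m θ η Ω) u ≠ 0 := by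
      by_contra! hc
      exact h (AlternatingMap.ext hc)
    refine ⟨u ∘ (pairEquiv m).symm, ?_⟩
    rw [wedgePow_eq_pairForm]
    have : (u ∘ (pairEquiv m).symm) ∘ pairEquiv m = u := by ext; simp
    rw [this]
    positivity

end LinearAlgebra


/-! ### Nonvanishing of the top-degree form as pointwise nondegeneracy. -/

section LinearAlgebra

variable {V : Type*} [AddCommGroup V] [Module ℝ V]

/-- Pointwise form of the cocontact condition: `θ` and `η` are linearly independent and `Ω` is
nondegenerate on `ker θ ∩ ker η`. -/
structure CoNondegenerate (θ η : Module.Dual ℝ V) (Ω : V →ₗ[ℝ] V →ₗ[ℝ] ℝ) : Prop where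
  exists_fst : ∃ e, θ e = 1 ∧ η e = 0
  exists_snd : ∃ e, θ e = 0 ∧ η e = 1
  nondegenerate : ∀ w, θ w = 0 → η w = 0 → (∀ h, θ h = 0 → η h = 0 → Ω w h = 0) → w = 0

/-- Composing each permutation with the transposition of the first pair preserves every product and
reverses every sign, so the sum equals its own negative. -/
lemma pairForm_eq_zero_of_symm {m : ℕ} (θ η : Module.Dual ℝ V) (Ω : V →ₗ[ℝ] V →ₗ[ℝ] ℝ)
    (h : ∀ x y, θ x * η y = θ y * η x) : pairForm (wedgeFactors m θ η Ω) = 0 := by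
  ext v
  rw [AlternatingMap.zero_apply]
  have key : pairForm (wedgeFactors m θ η Ω) v = -pairForm (wedgeFactors m θ η Ω) v := by
    conv_lhs => rw [pairForm_apply]
    rw [pairForm_apply, ← Finset.sum_neg_distrib]
    refine Fintype.sum_equiv (Equiv.mulRight (Equiv.swap ((0 : Fin (m + 1)), (0 : Fin 2)) (0, 1)))
      _ _ fun σ ↦ ?_
    have e1 := prod_wedgeFactors m θ η Ω (fun p ↦ v (σ p))
    have e2 := prod_wedgeFactors m θ η Ω (fun p ↦ v ((σ * Equiv.swap ((0 : Fin (m + 1)), (0 : Fin 2)) (0, 1) :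
      Equiv.Perm (Fin (m + 1) × Fin 2)) p))
    rw [Equiv.coe_mulRight, e1, e2, Equiv.Perm.sign_mul, Equiv.Perm.sign_swap (by simp)]
    have e3 : ∀ (j : Fin m) (c : Fin 2),
        Equiv.swap ((0 : Fin (m + 1)), (0 : Fin 2)) (0, 1) (j.succ, c) = (j.succ, c) := fun j c ↦
      Equiv.swap_apply_of_ne_of_ne (by simp [Fin.succ_ne_zero]) (by simp [Fin.succ_ne_zero])
    simp only [Equiv.Perm.coe_mul, Function.comp_apply, Equiv.swap_apply_left,
      Equiv.swap_apply_right, e3, h (v (σ (0, 1)))]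
    push_cast
    ring
  linarith

/-- If `θ` and `η` are linearly independent, then `V` is the sum of `ℝ²` and `ker θ ∩ ker η`. -/
noncomputable def splitEquiv {θ η : Module.Dual ℝ V} {e f : V} (he : θ e = 1 ∧ η e = 0)
    (hf : θ f = 0 ∧ η f = 1) :
    V ≃ₗ[ℝ] (ℝ × ℝ) × (LinearMap.ker θ ⊓ LinearMap.ker η : Submodule ℝ V) where
  toFun v := ((θ v, η v), ⟨v - θ v • e - η v • f, by simp [he, hf]⟩)
  map_add' x y := by
    ext <;> simp
    module
  map_smul' a x := by
    ext <;> simp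
    module
  invFun p := p.1.1 • e + p.1.2 • f + p.2
  left_inv v := by simp
  right_inv p := by
    obtain ⟨⟨a, b⟩, ⟨h, hh⟩⟩ := p
    have h1 : θ h = 0 := hh.1
    have h2 : η h = 0 := hh.2
    refine Prod.ext (by simp [he, hf, h1, h2]) (Subtype.ext ?_)
    simp [he, hf, h1, h2]
    module

lemma finrank_ker_inf_ker [Module.Finite ℝ V] {θ η : Module.Dual ℝ V} {e f : V}
    (he : θ e = 1 ∧ η e = 0) (hf : θ f = 0 ∧ η f = 1) :
    Module.finrank ℝ V = 2 + Module.finrank ℝ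
      (LinearMap.ker θ ⊓ LinearMap.ker η : Submodule ℝ V) := by
  rw [(splitEquiv he hf).finrank_eq]
  simp

/-- Otherwise a nonzero functional on `ℝ²` kills the image of `(θ, η)`. This is a linear relation
between `θ` and `η`, which makes `θ ⊗ η` symmetric. -/
lemma exists_dual_pair {θ η : Module.Dual ℝ V} {m : ℕ} {Ω : V →ₗ[ℝ] V →ₗ[ℝ] ℝ}
    (h : pairForm (wedgeFactors m θ η Ω) ≠ 0) : Function.Surjective (θ.prod η) := by
  rw [← LinearMap.range_eq_top]
  by_contra hr
  obtain ⟨f, hf0, hf⟩ := Submodule.exists_le_ker_of_lt_top _ (lt_top_iff_ne_top.2 hr)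
  have hf' : ∀ x y : ℝ, f (x, y) = x * f (1, 0) + y * f (0, 1) := by
    intro x y
    have : ((x, y) : ℝ × ℝ) = x • (1, 0) + y • (0, 1) := by simp
    rw [this, map_add, map_smul, map_smul, smul_eq_mul, smul_eq_mul]
  have hz : ∀ v, θ v * f (1, 0) + η v * f (0, 1) = 0 := fun v ↦ by
    rw [← hf']
    exact hf ⟨v, rfl⟩
  refine h (pairForm_eq_zero_of_symm θ η Ω fun x y ↦ ?_)
  by_cases h0 : f (1, 0) = 0
  · have h1 : f (0, 1) ≠ 0 := fun h1 ↦ hf0 (LinearMap.ext fun p ↦ by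
      obtain ⟨a, b⟩ := p
      rw [hf', h0, h1]; simp)
    have hη : ∀ v, η v = 0 := fun v ↦ by simpa [h0, h1] using hz v
    simp [hη]
  · apply mul_right_cancel₀ h0
    linear_combination η y * hz x - η x * hz y

/-- By contraposition: a nonzero `w` in the radical of `Ω` on `ker θ ∩ ker η` is completed to a
basis consisting of a pair dual to `θ, η` and a basis of the kernel. In each term, either the factor
`θ ⊗ η` vanishes or `w` sits in an `Ω` factor next to a vector of the kernel. -/
lemma CoNondegenerate.of_pairForm_ne_zero [Module.Finite ℝ V] {m : ℕ}
    (hV : Module.finrank ℝ V = 2 * m + 2) {θ η : Module.Dual ℝ V} {Ω : V →ₗ[ℝ] V →ₗ[ℝ] ℝ}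
    (hΩ : Ω.IsAlt) (h : pairForm (wedgeFactors m θ η Ω) ≠ 0) : CoNondegenerate θ η Ω := by
  obtain ⟨e, he⟩ := exists_dual_pair h (1, 0)
  obtain ⟨f, hf⟩ := exists_dual_pair h (0, 1)
  have he : θ e = 1 ∧ η e = 0 := by simpa using he
  have hf : θ f = 0 ∧ η f = 1 := by simpa using hf
  refine ⟨⟨e, he⟩, ⟨f, hf⟩, fun w h1 h2 hw ↦ ?_⟩
  by_contra hw0
  apply h
  let H : Submodule ℝ V := LinearMap.ker θ ⊓ LinearMap.ker η
  let w' : H := ⟨w, h1, h2⟩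
  have hs : LinearIndepOn ℝ id ({w'} : Set H) :=
    LinearIndepOn.singleton (by simpa [w', Subtype.ext_iff] using hw0)
  let bH := Module.Basis.extend hs
  let b := ((Module.Basis.finTwoProd ℝ).prod bH).map (splitEquiv he hf).symm
  have := Module.Finite.finite_basis bH
  have := Fintype.ofFinite (hs.extend (subset_univ _))
  have hcard : Fintype.card (Fin (m + 1) × Fin 2) =
      Fintype.card (Fin 2 ⊕ hs.extend (subset_univ _)) := by
    rw [← Module.finrank_eq_card_basis b, hV]
    simp
    ring
  have hbl : b (Sum.inl 0) = e ∧ b (Sum.inl 1) = f := by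
    simp [b, splitEquiv]
  have hbr : ∀ i, θ (b (Sum.inr i)) = 0 ∧ η (b (Sum.inr i)) = 0 := by
    intro i
    have h1 : b (Sum.inr i) = (bH i : V) := by
      simp [b, splitEquiv]
    rw [h1]
    exact (bH i).2
  obtain ⟨i₀, hi₀⟩ : ∃ i, b (Sum.inr i) = w := by
    have hmem : w' ∈ hs.extend (subset_univ _) := hs.subset_extend _ rfl
    refine ⟨⟨w', hmem⟩, ?_⟩
    have : bH ⟨w', hmem⟩ = w' := by simp [bH]
    simp [b, splitEquiv, this, w']
  -- An alternating map is determined on injective families of basis vectors. By cardinality these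
  -- are bijective, so `w` occurs in each of them.
  refine b.ext_alternating fun v hv ↦ ?_
  rw [AlternatingMap.zero_apply, pairForm_apply]
  refine Finset.sum_eq_zero fun σ _ ↦ ?_
  rw [prod_wedgeFactors m θ η Ω (fun p ↦ b (v (σ p)))]
  have hbij : Function.Bijective (fun p ↦ v (σ p)) :=
    (Fintype.bijective_iff_injective_and_card _).2 ⟨hv.comp σ.injective, hcard⟩
  by_contra hne
  obtain ⟨-, hne⟩ := mul_ne_zero_iff.1 hne
  obtain ⟨hne, hprod⟩ := mul_ne_zero_iff.1 hne
  obtain ⟨hθ, hη⟩ := mul_ne_zero_iff.1 hne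
  rw [Finset.prod_ne_zero_iff] at hprod
  have hv0 : v (σ (0, 0)) = Sum.inl 0 := by
    rcases hx : v (σ (0, 0)) with x | x
    · fin_cases x
      · rfl
      · exact absurd (by simp [hx, hbl, hf]) hθ
    · exact absurd (by rw [hx]; exact (hbr x).1) hθ
  have hv1 : v (σ (0, 1)) = Sum.inl 1 := by
    rcases hx : v (σ (0, 1)) with x | x
    · fin_cases x
      · exact absurd (by simp [hx, hbl, he]) hη
      · rfl
    · exact absurd (by rw [hx]; exact (hbr x).2) hη
  have hker : ∀ (j : Fin m) c, θ (b (v (σ (j.succ, c)))) = 0 ∧ η (b (v (σ (j.succ, c)))) = 0 := by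
    intro j c
    rcases hx : v (σ (j.succ, c)) with x | x
    · exfalso
      fin_cases x
      · have := hbij.1 (hx.trans hv0.symm)
        simp [Fin.succ_ne_zero] at this
      · have := hbij.1 (hx.trans hv1.symm)
        simp [Fin.succ_ne_zero] at this
    · exact hbr x
  obtain ⟨⟨j, c⟩, hj⟩ := hbij.2 (Sum.inr i₀)
  simp only at hj
  induction j using Fin.cases with
  | zero =>
    fin_cases c
    · simp [hv0] at hj
    · simp [hv1] at hj
  | succ j =>
    apply hprod j (Finset.mem_univ j)
    fin_cases c
    · have hj : v (σ (j.succ, 0)) = Sum.inr i₀ := hj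
      rw [hj, hi₀]
      exact hw _ (hker j 1).1 (hker j 1).2
    · have hj : v (σ (j.succ, 1)) = Sum.inr i₀ := hj
      rw [hj, hi₀, ← hΩ.neg, hw _ (hker j 0).1 (hker j 0).2, neg_zero]

/-- Every nondegenerate alternating form has a symplectic basis. -/
lemma exists_symplectic_family [Module.Finite ℝ V] {Ω : V →ₗ[ℝ] V →ₗ[ℝ] ℝ} (hΩ : Ω.IsAlt) (m : ℕ) :
    ∀ H : Submodule ℝ V, Module.finrank ℝ H = 2 * m →
      (∀ w ∈ H, (∀ h ∈ H, Ω w h = 0) → w = 0) →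
      ∃ u : Fin m × Fin 2 → V, (∀ p, u p ∈ H) ∧
        ∀ p q, Ω (u p) (u q) = if p.1 = q.1 then ((q.2 : ℕ) : ℝ) - ((p.2 : ℕ) : ℝ) else 0 := by
  induction m with
  | zero => exact fun H _ _ ↦ ⟨fun p ↦ p.1.elim0, fun p ↦ p.1.elim0, fun p ↦ p.1.elim0⟩
  | succ m ih =>
    intro H hH hnd
    obtain ⟨e, heH, he0⟩ : ∃ e ∈ H, e ≠ 0 := by
      by_contra! hc
      have : H = ⊥ := (Submodule.eq_bot_iff _).2 hc
      rw [this] at hH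
      simp at hH
    obtain ⟨f, hfH, hef⟩ : ∃ f ∈ H, Ω e f = 1 := by
      have : ¬ ∀ h ∈ H, Ω e h = 0 := fun h ↦ he0 (hnd e heH h)
      push Not at this
      obtain ⟨f, hf, hf0⟩ := this
      exact ⟨(Ω e f)⁻¹ • f, H.smul_mem _ hf, by simp [hf0]⟩
    have hfe : Ω f e = -1 := by rw [← hΩ.neg, hef]
    have hee : Ω e e = 0 := hΩ e
    have hff : Ω f f = 0 := hΩ f
    let θ : Module.Dual ℝ H := (-(Ω f)) ∘ₗ H.subtype
    let η : Module.Dual ℝ H := (Ω e) ∘ₗ H.subtype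
    have h1 : θ ⟨e, heH⟩ = 1 ∧ η ⟨e, heH⟩ = 0 := by simp [θ, η, hfe, hee]
    have h2 : θ ⟨f, hfH⟩ = 0 ∧ η ⟨f, hfH⟩ = 1 := by simp [θ, η, hff, hef]
    -- The symplectic complement of the plane spanned by `e, f`. The functionals `-Ω f` and `Ω e`
    -- are dual to `e, f`, so its dimension drops by two.
    let K : Submodule ℝ H := LinearMap.ker θ ⊓ LinearMap.ker η
    have hK : Module.finrank ℝ (K.map H.subtype) = 2 * m := by
      rw [Submodule.finrank_map_subtype_eq]
      have := finrank_ker_inf_ker h1 h2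
      change _ = 2 + Module.finrank ℝ K at this
      omega
    have hmem : ∀ w, w ∈ K.map H.subtype ↔ w ∈ H ∧ Ω f w = 0 ∧ Ω e w = 0 := by
      intro w
      simp [K, θ, η]
      tauto
    obtain ⟨u, huK, hu⟩ := ih (K.map H.subtype) hK (by
      intro w hw hw0
      obtain ⟨hwH, hwf, hwe⟩ := (hmem w).1 hw
      refine hnd w hwH fun x hx ↦ ?_
      have hwf' : Ω w f = 0 := by rw [← hΩ.neg, hwf, neg_zero]
      have hwe' : Ω w e = 0 := by rw [← hΩ.neg, hwe, neg_zero]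
      -- The projection of `x` to the complement along the plane. Since `w` is orthogonal to `e` and
      -- `f`, pairing with `w` does not see the correction.
      have := hw0 (x + Ω f x • e - Ω e x • f) ((hmem _).2
        ⟨H.sub_mem (H.add_mem hx (H.smul_mem _ heH)) (H.smul_mem _ hfH),
          by simp [hfe, hff], by simp [hee, hef]⟩)
      simpa [hwf', hwe'] using this)
    have huH := fun p ↦ (hmem _).1 (huK p)
    have huf : ∀ p, Ω (u p) f = 0 := fun p ↦ by rw [← hΩ.neg, (huH p).2.1, neg_zero]
    have hue : ∀ p, Ω (u p) e = 0 := fun p ↦ by rw [← hΩ.neg, (huH p).2.2, neg_zero]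
    refine ⟨fun p ↦ Fin.cases (![e, f] p.2) (fun j ↦ u (j, p.2)) p.1, ?_, ?_⟩
    · rintro ⟨j, c⟩
      induction j using Fin.cases with
      | zero => fin_cases c <;> simp [heH, hfH]
      | succ j => simpa using (huH _).1
    · rintro ⟨j, c⟩ ⟨j', c'⟩
      induction j using Fin.cases with
      | zero =>
        induction j' using Fin.cases with
        | zero => fin_cases c <;> fin_cases c' <;> simp [hef, hfe, hee, hff]
        | succ j' =>
          fin_cases c <;> simp [(huH _).2, (Fin.succ_ne_zero _).symm]
      | succ j =>
        induction j' using Fin.cases with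
        | zero => fin_cases c' <;> simp [huf, hue, Fin.succ_ne_zero]
        | succ j' => simp [hu]

/-- The form is evaluated on a pair dual to `θ, η` followed by a symplectic basis of the common
kernel. Every permutation contributes `0` or `1` and the identity contributes `1`, so nothing
cancels. -/
lemma CoNondegenerate.pairForm_ne_zero [Module.Finite ℝ V] {m : ℕ}
    (hV : Module.finrank ℝ V = 2 * m + 2) {θ η : Module.Dual ℝ V} {Ω : V →ₗ[ℝ] V →ₗ[ℝ] ℝ}
    (hΩ : Ω.IsAlt) (h : CoNondegenerate θ η Ω) : pairForm (wedgeFactors m θ η Ω) ≠ 0 := by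
  obtain ⟨e, he⟩ := h.exists_fst
  obtain ⟨f, hf⟩ := h.exists_snd
  have hH := finrank_ker_inf_ker he hf
  obtain ⟨u, huH, hu⟩ := exists_symplectic_family hΩ m (LinearMap.ker θ ⊓ LinearMap.ker η)
    (by omega) (fun w hw hw0 ↦ h.nondegenerate w hw.1 hw.2 fun x h1 h2 ↦ hw0 x ⟨h1, h2⟩)
  have huθ : ∀ p, θ (u p) = 0 := fun p ↦ (huH p).1
  have huη : ∀ p, η (u p) = 0 := fun p ↦ (huH p).2
  let v : Fin (m + 1) × Fin 2 → V := fun p ↦ Fin.cases (![e, f] p.2) (fun j ↦ u (j, p.2)) p.1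
  have hvs : ∀ j c, v (Fin.succ j, c) = u (j, c) := fun j c ↦ rfl
  have hv0 : v (0, 0) = e := rfl
  have hv1 : v (0, 1) = f := rfl
  intro hzero
  have hz : pairForm (wedgeFactors m θ η Ω) v = 0 := by rw [hzero]; rfl
  rw [pairForm_apply] at hz
  have hval : ∀ σ : Equiv.Perm (Fin (m + 1) × Fin 2), ((Equiv.Perm.sign σ : ℤ) : ℝ) *
      ∏ j, wedgeFactors m θ η Ω j (v (σ (j, 0))) (v (σ (j, 1))) = 0 ∨
      ((Equiv.Perm.sign σ : ℤ) : ℝ) *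
      ∏ j, wedgeFactors m θ η Ω j (v (σ (j, 0))) (v (σ (j, 1))) = 1 := by
    intro σ
    rw [or_iff_not_imp_left]
    intro hne
    rw [prod_wedgeFactors m θ η Ω (fun p ↦ v (σ p))] at hne ⊢
    obtain ⟨-, hne⟩ := mul_ne_zero_iff.1 hne
    obtain ⟨hne, hprod⟩ := mul_ne_zero_iff.1 hne
    obtain ⟨hθ, hη⟩ := mul_ne_zero_iff.1 hne
    rw [Finset.prod_ne_zero_iff] at hprod
    have hσ0 : σ (0, 0) = (0, 0) := by
      rcases hx : σ (0, 0) with ⟨j, c⟩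
      rw [hx] at hθ
      induction j using Fin.cases with
      | zero =>
        fin_cases c
        · rfl
        · exact absurd hf.1 hθ
      | succ j => exact absurd (huθ _) hθ
    have hσ1 : σ (0, 1) = (0, 1) := by
      rcases hx : σ (0, 1) with ⟨j, c⟩
      rw [hx] at hη
      induction j using Fin.cases with
      | zero =>
        fin_cases c
        · exact absurd he.2 hη
        · rfl
      | succ j => exact absurd (huη _) hη
    have hσs : ∀ (j : Fin m) c, ∃ i, (σ (j.succ, c)).1 = Fin.succ i := by
      intro j c
      refine Fin.exists_succ_eq.2 ?_ |>.imp fun _ h ↦ h.symm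
      intro h0
      rcases hx : σ (j.succ, c) with ⟨i, d⟩
      have hi : i = 0 := by rw [hx] at h0; exact h0
      subst hi
      fin_cases d
      · have := σ.injective (hx.trans hσ0.symm)
        simp [Fin.succ_ne_zero] at this
      · have := σ.injective (hx.trans hσ1.symm)
        simp [Fin.succ_ne_zero] at this
    have hΩv : ∀ p q : Fin (m + 1) × Fin 2, (∃ i, p.1 = Fin.succ i) → (∃ i, q.1 = Fin.succ i) →
        Ω (v p) (v q) = if p.1 = q.1 then ((q.2 : ℕ) : ℝ) - ((p.2 : ℕ) : ℝ) else 0 := by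
      rintro ⟨j, c⟩ ⟨j', c'⟩ ⟨i, hi⟩ ⟨i', hi'⟩
      simp only at hi hi'
      subst hi hi'
      rw [hvs, hvs, hu]
      simp
    have hblock : ∀ j, (σ (j, 0)).1 = (σ (j, 1)).1 := by
      intro j
      induction j using Fin.cases with
      | zero => rw [hσ0, hσ1]
      | succ j =>
        have := hprod j (Finset.mem_univ j)
        rw [hΩv _ _ (hσs j 0) (hσs j 1)] at this
        by_contra hc
        rw [if_neg hc] at this
        exact this rfl
    -- Each reversed pair gives `-1` in the sign and `-1` in its `Ω` factor, and these cancel.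
    rw [sign_eq_prod_of_preserves_pairs σ hblock, Fin.prod_univ_succ, hσ0, hσ1, hv0, hv1, he.1, hf.2,
      if_pos rfl, one_mul, one_mul, one_mul, ← Finset.prod_mul_distrib]
    refine Finset.prod_eq_one fun j _ ↦ ?_
    rw [hΩv _ _ (hσs j 0) (hσs j 1), if_pos (hblock _)]
    have hne : (σ (j.succ, 0)).2 ≠ (σ (j.succ, 1)).2 := fun hc ↦ by
      have := σ.injective (Prod.ext (hblock _) hc)
      simp at this
    generalize (σ (j.succ, 0)).2 = x at *
    generalize (σ (j.succ, 1)).2 = y at *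
    fin_cases x <;> fin_cases y <;> simp at hne ⊢
  have hnonneg := fun σ (_ : σ ∈ Finset.univ) ↦ show 0 ≤ ((Equiv.Perm.sign σ : ℤ) : ℝ) *
      ∏ j, wedgeFactors m θ η Ω j (v (σ (j, 0))) (v (σ (j, 1))) by
    rcases hval σ with h | h <;> rw [h]
    exact zero_le_one
  have h1 := (Finset.sum_eq_zero_iff_of_nonneg hnonneg).1 hz 1 (Finset.mem_univ _)
  rw [prod_wedgeFactors m θ η Ω (fun p ↦ v ((1 : Equiv.Perm (Fin (m + 1) × Fin 2)) p))] at h1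
  simp [hv0, hv1, he, hf, hvs, hu] at h1

lemma exists_wedgePow_ne_zero_iff_coNondegenerate [Module.Finite ℝ V] {m : ℕ}
    (hV : Module.finrank ℝ V = 2 * m + 2) {θ η : Module.Dual ℝ V} {Ω : V →ₗ[ℝ] V →ₗ[ℝ] ℝ}
    (hΩ : Ω.IsAlt) : (∃ v, wedgePow m θ η Ω v ≠ 0) ↔ CoNondegenerate θ η Ω :=
  (exists_wedgePow_ne_zero_iff m θ η Ω).trans
    ⟨CoNondegenerate.of_pairForm_ne_zero hV hΩ, fun h ↦ h.pairForm_ne_zero hV hΩ⟩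

end LinearAlgebra


/-! ### The `Λ`-orthogonal and reduction on a single tangent space. -/

section LinearAlgebra

variable {V : Type*} [AddCommGroup V] [Module ℝ V]
  {θ η : Module.Dual ℝ V} {Ω : V →ₗ[ℝ] V →ₗ[ℝ] ℝ}

lemma flat_apply (v w : V) : flat θ η Ω v w = θ v * θ w + Ω v w + η v * η w := by
  simp [flat]

/-- `♭ v = 0` if and only if `v` is in the kernels of `θ`, `η` and `Ω`. -/
lemma flat_eq_zero_iff (hΩ : Ω.IsAlt) (v : V) :
    flat θ η Ω v = 0 ↔ θ v = 0 ∧ η v = 0 ∧ ∀ w, Ω v w = 0 := by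
  constructor
  · intro h
    -- Evaluating `♭ v` on `v` itself removes the `Ω` term and leaves `θ(v)² + η(v)²`.
    have h1 := LinearMap.congr_fun h v
    rw [flat_apply, hΩ, LinearMap.zero_apply] at h1
    have h2 : θ v = 0 := by nlinarith [mul_self_nonneg (θ v), mul_self_nonneg (η v)]
    have h3 : η v = 0 := by nlinarith [mul_self_nonneg (θ v), mul_self_nonneg (η v)]
    refine ⟨h2, h3, fun w ↦ ?_⟩
    have := LinearMap.congr_fun h w
    rw [flat_apply, h2, h3] at this
    simpa using this
  · rintro ⟨h1, h2, h3⟩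
    ext w
    simp [flat_apply, h1, h2, h3]

namespace CoNondegenerate

lemma flat_bijective [Module.Finite ℝ V] (h : CoNondegenerate θ η Ω) (hΩ : Ω.IsAlt) :
    Function.Bijective (flat θ η Ω) := by
  have hinj : Function.Injective (flat θ η Ω) := by
    rw [injective_iff_map_eq_zero]
    intro v hv
    obtain ⟨h1, h2, h3⟩ := (flat_eq_zero_iff hΩ v).1 hv
    exact h.nondegenerate v h1 h2 fun w _ _ ↦ h3 w
  exact ⟨hinj, (LinearMap.injective_iff_surjective_of_finrank_eq_finrank
    Subspace.dual_finrank_eq.symm).1 hinj⟩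

lemma flat_sharp [Module.Finite ℝ V] (h : CoNondegenerate θ η Ω) (hΩ : Ω.IsAlt)
    (α : Module.Dual ℝ V) : flat θ η Ω (sharp θ η Ω α) = α := by
  rw [sharp, dif_pos (h.flat_bijective hΩ)]
  exact (LinearEquiv.ofBijective (flat θ η Ω) (h.flat_bijective hΩ)).apply_symm_apply α

lemma sharp_eq_iff [Module.Finite ℝ V] (h : CoNondegenerate θ η Ω) (hΩ : Ω.IsAlt)
    (α : Module.Dual ℝ V) (v : V) : sharp θ η Ω α = v ↔ flat θ η Ω v = α := by
  constructor
  · rintro rfl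
    exact h.flat_sharp hΩ α
  · rintro rfl
    exact (h.flat_bijective hΩ).1 (h.flat_sharp hΩ _)

/-- On the common kernel both rank-one terms of `♭` disappear. This orthogonality serves in place of
the full identity `i_R Ω = 0` for Reeb vectors. -/
lemma apply_sharp_fst [Module.Finite ℝ V] (h : CoNondegenerate θ η Ω) (hΩ : Ω.IsAlt) {w : V}
    (h1 : θ w = 0) (h2 : η w = 0) : Ω (sharp θ η Ω θ) w = 0 := by
  have := LinearMap.congr_fun (h.flat_sharp hΩ θ) w
  rw [flat_apply, h1, h2] at this
  simpa using this

lemma apply_sharp_snd [Module.Finite ℝ V] (h : CoNondegenerate θ η Ω) (hΩ : Ω.IsAlt) {w : V}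
    (h1 : θ w = 0) (h2 : η w = 0) : Ω (sharp θ η Ω η) w = 0 := by
  have := LinearMap.congr_fun (h.flat_sharp hΩ η) w
  rw [flat_apply, h1, h2] at this
  simpa using this

/-- The vectors `♯ θ` and `♯ η` span a complement of `ker θ ∩ ker η`. -/
lemma exists_combination [Module.Finite ℝ V] (h : CoNondegenerate θ η Ω) (hΩ : Ω.IsAlt) (x y : ℝ) :
    ∃ a b : ℝ, θ (a • sharp θ η Ω θ + b • sharp θ η Ω η) = x ∧
      η (a • sharp θ η Ω θ + b • sharp θ η Ω η) = y := by
  let p : ℝ × ℝ →ₗ[ℝ] V := (LinearMap.id.smulRight (sharp θ η Ω θ)).coprod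
    (LinearMap.id.smulRight (sharp θ η Ω η))
  have hp : ∀ a b, p (a, b) = a • sharp θ η Ω θ + b • sharp θ η Ω η := fun a b ↦ by simp [p]
  have hinj : Function.Injective ((θ.prod η) ∘ₗ p) := by
    rw [injective_iff_map_eq_zero]
    rintro ⟨a, b⟩ hab
    rw [LinearMap.comp_apply, hp, LinearMap.prod_apply, Function.prod_apply, Prod.mk_eq_zero] at hab
    obtain ⟨hθ, hη⟩ := hab
    have h0 := h.nondegenerate _ hθ hη fun w h1 h2 ↦ by
      simp [h.apply_sharp_fst hΩ h1 h2, h.apply_sharp_snd hΩ h1 h2]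
    have h3 : a • θ + b • η = 0 := by
      rw [← h.flat_sharp hΩ (a • θ + b • η), map_add, map_smul, map_smul, h0, map_zero]
    obtain ⟨e, he⟩ := h.exists_fst
    obtain ⟨f, hf⟩ := h.exists_snd
    have h4 := LinearMap.congr_fun h3 e
    have h5 := LinearMap.congr_fun h3 f
    simp [he] at h4
    simp [hf] at h5
    simp [h4, h5]
  obtain ⟨⟨a, b⟩, hab⟩ := LinearMap.injective_iff_surjective.1 hinj (x, y)
  rw [LinearMap.comp_apply, hp, LinearMap.prod_apply, Function.prod_apply, Prod.mk.injEq] at hab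
  exact ⟨a, b, hab.1, hab.2⟩

variable [Module.Finite ℝ V] {T : Submodule ℝ V}

/-- Let `a = ♯ α`, and let `p` be the combination of the Reeb vectors with the same `θ` and `η`
values as `a`. Then `p ∈ T` and `Ω(a, p) = 0`, so `0 = α(p) = θ(a)² + η(a)²`. Now `β(a) = (♭ ♯
β)(a)` reduces to `Ω(♯ β, a) = Λ(α, β)`, which says that `♯_Λ α = a`. -/
lemma sharpLambda_of_mem_dualAnnihilator (h : CoNondegenerate θ η Ω) (hΩ : Ω.IsAlt)
    (hθ : sharp θ η Ω θ ∈ T) (hη : sharp θ η Ω η ∈ T) {α : Module.Dual ℝ V}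
    (hα : α ∈ T.dualAnnihilator) :
    sharpLambda θ η Ω α = sharp θ η Ω α ∧
      θ (sharp θ η Ω α) = 0 ∧ η (sharp θ η Ω α) = 0 := by
  rw [Submodule.mem_dualAnnihilator] at hα
  set a := sharp θ η Ω α with ha
  have hfa : flat θ η Ω a = α := h.flat_sharp hΩ α
  obtain ⟨x, y, hx, hy⟩ := h.exists_combination hΩ (θ a) (η a)
  set p := x • sharp θ η Ω θ + y • sharp θ η Ω η with hp
  have hpT : p ∈ T := T.add_mem (T.smul_mem _ hθ) (T.smul_mem _ hη)
  have hΩp : Ω a p = 0 := by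
    have h1 : θ (a - p) = 0 := by rw [map_sub, hx, sub_self]
    have h2 : η (a - p) = 0 := by rw [map_sub, hy, sub_self]
    have h3 : Ω p (a - p) = 0 := by
      rw [hp]
      simp only [map_add, map_smul, LinearMap.add_apply, LinearMap.smul_apply]
      rw [← hp, h.apply_sharp_fst hΩ h1 h2, h.apply_sharp_snd hΩ h1 h2]
      simp
    rw [map_sub, hΩ, sub_zero] at h3
    rw [← hΩ.neg, h3, neg_zero]
  have h1 := LinearMap.congr_fun hfa p
  rw [hα p hpT, flat_apply, hx, hy, hΩp] at h1
  have hθa : θ a = 0 := by nlinarith [mul_self_nonneg (θ a), mul_self_nonneg (η a)]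
  have hηa : η a = 0 := by nlinarith [mul_self_nonneg (θ a), mul_self_nonneg (η a)]
  refine ⟨?_, hθa, hηa⟩
  rw [sharpLambda, LinearMap.comp_apply, LinearEquiv.coe_coe, LinearEquiv.symm_apply_eq]
  ext β
  rw [Module.evalEquiv_apply, Module.Dual.eval_apply, jacobiTensor, LinearMap.neg_apply,
    LinearMap.neg_apply, LinearMap.compl₁₂_apply, ← ha, hΩ.neg]
  have h2 := LinearMap.congr_fun (h.flat_sharp hΩ β) a
  rw [flat_apply, hθa, hηa] at h2
  simpa using h2

/-- For a subspace `T` that contains `♯ θ` and `♯ η`, the `Λ`-orthogonal of `T` consists of the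
vectors of `ker θ ∩ ker η` that are `Ω`-orthogonal to `T`. -/
lemma mem_lambdaOrthogonal_iff (h : CoNondegenerate θ η Ω) (hΩ : Ω.IsAlt)
    (hθ : sharp θ η Ω θ ∈ T) (hη : sharp θ η Ω η ∈ T) (v : V) :
    v ∈ lambdaOrthogonal θ η Ω T ↔ θ v = 0 ∧ η v = 0 ∧ ∀ w ∈ T, Ω v w = 0 := by
  rw [lambdaOrthogonal, Submodule.mem_map]
  constructor
  · rintro ⟨α, hα, rfl⟩
    obtain ⟨h1, h2, h3⟩ := h.sharpLambda_of_mem_dualAnnihilator hΩ hθ hη hα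
    rw [h1]
    refine ⟨h2, h3, fun w hw ↦ ?_⟩
    have h4 := LinearMap.congr_fun (h.flat_sharp hΩ α) w
    rw [flat_apply, h2, h3, (Submodule.mem_dualAnnihilator _).1 hα w hw] at h4
    simpa using h4
  · rintro ⟨h1, h2, h3⟩
    have hα : flat θ η Ω v ∈ T.dualAnnihilator := by
      rw [Submodule.mem_dualAnnihilator]
      intro w hw
      rw [flat_apply, h1, h2, h3 w hw]
      simp
    refine ⟨_, hα, ?_⟩
    rw [(h.sharpLambda_of_mem_dualAnnihilator hΩ hθ hη hα).1, h.sharp_eq_iff hΩ]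

/-- On the annihilator of `T` the map `♯_Λ` coincides with the injective map `♯`, so the orthogonal
has the dimension of the annihilator. -/
lemma finrank_lambdaOrthogonal (h : CoNondegenerate θ η Ω) (hΩ : Ω.IsAlt)
    (hθ : sharp θ η Ω θ ∈ T) (hη : sharp θ η Ω η ∈ T) :
    Module.finrank ℝ T + Module.finrank ℝ (lambdaOrthogonal θ η Ω T) = Module.finrank ℝ V := by
  have : lambdaOrthogonal θ η Ω T = T.dualAnnihilator.map (sharp θ η Ω) := by
    ext v
    simp only [lambdaOrthogonal, Submodule.mem_map]
    exact exists_congr fun α ↦ and_congr_right fun hα ↦ by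
      rw [(h.sharpLambda_of_mem_dualAnnihilator hΩ hθ hη hα).1]
  have hinj : Function.Injective (sharp θ η Ω) :=
    Function.LeftInverse.injective (h.flat_sharp hΩ)
  rw [this, ← (Submodule.equivMapOfInjective _ hinj _).finrank_eq]
  exact Subspace.finrank_add_finrank_dualAnnihilator_eq T

end CoNondegenerate

/-- Pointwise form of coisotropic reduction. -/
lemma CoNondegenerate.reduction [Module.Finite ℝ V] (h : CoNondegenerate θ η Ω) (hΩ : Ω.IsAlt)
    {T Q : Type*} [AddCommGroup T] [Module ℝ T] [AddCommGroup Q] [Module ℝ Q]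
    {i : T →ₗ[ℝ] V} {π : T →ₗ[ℝ] Q} (hπ : Function.Surjective π)
    (hθ : sharp θ η Ω θ ∈ LinearMap.range i) (hη : sharp θ η Ω η ∈ LinearMap.range i)
    (hker : (lambdaOrthogonal θ η Ω (LinearMap.range i)).comap i ≤ LinearMap.ker π)
    {θ' η' : Module.Dual ℝ Q} {Ω' : Q →ₗ[ℝ] Q →ₗ[ℝ] ℝ} (hθ' : ∀ t, θ' (π t) = θ (i t))
    (hη' : ∀ t, η' (π t) = η (i t)) (hΩ' : ∀ s t, Ω' (π s) (π t) = Ω (i s) (i t)) :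
    CoNondegenerate θ' η' Ω' := by
  have key : ∀ x y, ∃ t, θ (i t) = x ∧ η (i t) = y ∧
      ∀ w, θ w = 0 → η w = 0 → Ω (i t) w = 0 := by
    intro x y
    obtain ⟨a, b, hx, hy⟩ := h.exists_combination hΩ x y
    obtain ⟨t, ht⟩ := (LinearMap.range i).add_mem ((LinearMap.range i).smul_mem a hθ)
      ((LinearMap.range i).smul_mem b hη)
    refine ⟨t, by rw [ht, hx], by rw [ht, hy], fun w h1 h2 ↦ ?_⟩
    rw [ht]
    simp [h.apply_sharp_fst hΩ h1 h2, h.apply_sharp_snd hΩ h1 h2]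
  refine ⟨?_, ?_, fun w h1 h2 hw ↦ ?_⟩
  · obtain ⟨t, h1, h2, -⟩ := key 1 0
    exact ⟨π t, by rw [hθ', h1], by rw [hη', h2]⟩
  · obtain ⟨t, h1, h2, -⟩ := key 0 1
    exact ⟨π t, by rw [hθ', h1], by rw [hη', h2]⟩
  · obtain ⟨t, rfl⟩ := hπ w
    rw [hθ'] at h1
    rw [hη'] at h2
    refine hker (Submodule.mem_comap.2 ((h.mem_lambdaOrthogonal_iff hΩ hθ hη _).2 ⟨h1, h2, ?_⟩))
    rintro _ ⟨s, rfl⟩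
    -- The hypothesis `hw` only tests against `ker θ' ∩ ker η'`. Subtracting the Reeb part `r` moves
    -- `s` there without changing its pairing with `i t`.
    obtain ⟨r, hr1, hr2, hr3⟩ := key (θ (i s)) (η (i s))
    have h3 : Ω (i t) (i r) = 0 := by rw [← hΩ.neg, hr3 _ h1 h2, neg_zero]
    have h4 := hw (π (s - r)) (by rw [hθ', map_sub, map_sub, hr1, sub_self])
      (by rw [hη', map_sub, map_sub, hr2, sub_self])
    rw [hΩ', map_sub, map_sub, h3, sub_zero] at h4
    exact h4

lemma CoNondegenerate.two_le_finrank [Module.Finite ℝ V] (h : CoNondegenerate θ η Ω) :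
    2 ≤ Module.finrank ℝ V := by
  obtain ⟨e, he⟩ := h.exists_fst
  obtain ⟨f, hf⟩ := h.exists_snd
  rw [finrank_ker_inf_ker he hf]
  omega

end LinearAlgebra


/-! ### Flows of the fields `y ↦ L y x` and their estimates. -/

section Plaques

open Metric Filter Topology NNReal

variable {E : Type*} [NormedAddCommGroup E] [NormedSpace ℝ E]

/-- A family of projections `L y` with the same kernel, defined near `y₀`, such that the distribution
`y ↦ range (L y)` is involutive, together with bounds on a ball. -/
structure PlaqueField (L : E → E →L[ℝ] E) (L' : E → E →L[ℝ] E →L[ℝ] E) (y₀ : E) (R r : ℝ) (K : ℝ≥0) :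
    Prop where
  r_pos : 0 < r
  r_le : r ≤ R / 4
  -- The initial velocity `-(L y₀ (y - y₀))` has norm at most `K * r`, so the flow moves by at most
  -- `K * (K * r)`.
  mul_r_lt : K * (K * r) < R / 4
  mul_r_le : K * r ≤ 1
  hasFDerivAt : ∀ y ∈ closedBall y₀ R, HasFDerivAt L (L' y) y
  norm_le : ∀ y ∈ closedBall y₀ R, ‖L y‖ ≤ K
  norm_deriv_le : ∀ y ∈ closedBall y₀ R, ‖L' y‖ ≤ K
  deriv_lipschitz : ∀ y ∈ closedBall y₀ R, ∀ z ∈ closedBall y₀ R, ‖L' z - L' y‖ ≤ K * ‖z - y‖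
  proj_left : ∀ y ∈ closedBall y₀ R, ∀ v, L y₀ (L y v) = L y₀ v
  proj_right : ∀ y ∈ closedBall y₀ R, ∀ v, L y (L y₀ v) = L y v
  -- The vector fields `y ↦ L y u` and `y ↦ L y v` commute.
  symm : ∀ y ∈ closedBall y₀ R, ∀ u v, L' y (L y u) v = L' y (L y v) u

/-- `g` is an integral curve on `[0, 1]` of the vector field `y ↦ L y x`. -/
def IsRadialFlow (L : E → E →L[ℝ] E) (x : E) (g : ℝ → E) : Prop :=
  ∀ s ∈ Icc (0 : ℝ) 1, HasDerivWithinAt g (L (g s) x) (Icc 0 1) s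

namespace PlaqueField

variable {L : E → E →L[ℝ] E} {L' : E → E →L[ℝ] E →L[ℝ] E} {y₀ : E} {R r : ℝ} {K : ℝ≥0}

lemma R_pos (h : PlaqueField L L' y₀ R r K) : 0 < R := by
  linarith [h.r_pos, h.r_le]

lemma center_mem (h : PlaqueField L L' y₀ R r K) : y₀ ∈ closedBall y₀ R :=
  mem_closedBall_self h.R_pos.le

lemma norm_apply_le (h : PlaqueField L L' y₀ R r K) {y : E} (hy : y ∈ closedBall y₀ R) (x : E) :
    ‖L y x‖ ≤ K * ‖x‖ :=
  (L y).le_of_opNorm_le (h.norm_le y hy) x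

lemma lipschitz (h : PlaqueField L L' y₀ R r K) : LipschitzOnWith K L (closedBall y₀ R) :=
  (convex_closedBall y₀ R).lipschitzOnWith_of_nnnorm_hasFDerivWithin_le
    (fun y hy ↦ (h.hasFDerivAt y hy).hasFDerivWithinAt) (fun y hy ↦ h.norm_deriv_le y hy)

lemma norm_sub_le (h : PlaqueField L L' y₀ R r K) {y z : E} (hy : y ∈ closedBall y₀ R)
    (hz : z ∈ closedBall y₀ R) : ‖L z - L y‖ ≤ K * ‖z - y‖ :=
  h.lipschitz.norm_sub_le hz hy

lemma lipschitz_apply (h : PlaqueField L L' y₀ R r K) {x : E} (hx : ‖x‖ ≤ 1) :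
    LipschitzOnWith K (fun y ↦ L y x) (closedBall y₀ R) := by
  refine LipschitzOnWith.of_dist_le_mul fun y hy z hz ↦ ?_
  rw [dist_eq_norm, dist_eq_norm, ← _root_.sub_apply]
  calc ‖(L y - L z) x‖ ≤ ‖L y - L z‖ * ‖x‖ := ContinuousLinearMap.le_opNorm _ _
    _ ≤ (K * ‖y - z‖) * 1 := by
        gcongr
        exact h.norm_sub_le hz hy
    _ = K * ‖y - z‖ := mul_one _

/-- The quadratic estimate of the error of the first-order expansion of `L`. -/
lemma norm_sub_sub_le (h : PlaqueField L L' y₀ R r K) {y w : E} (hy : y ∈ closedBall y₀ R)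
    (hw : y + w ∈ closedBall y₀ R) : ‖L (y + w) - L y - L' y w‖ ≤ K * ‖w‖ ^ 2 := by
  have hseg : segment ℝ y (y + w) ⊆ closedBall y₀ R :=
    (convex_closedBall y₀ R).segment_subset hy hw
  have := (convex_segment y (y + w)).norm_image_sub_le_of_norm_hasFDerivWithin_le'
    (f := L) (f' := L') (φ := L' y) (C := K * ‖w‖)
    (fun z hz ↦ (h.hasFDerivAt z (hseg hz)).hasFDerivWithinAt)
    (fun z hz ↦ (h.deriv_lipschitz y hy z (hseg hz)).trans (by
      gcongr
      have := norm_sub_le_of_mem_segment hz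
      simpa using this))
    (left_mem_segment ℝ _ _) (right_mem_segment ℝ _ _)
  simp only [add_sub_cancel_left] at this
  linarith [this]

/-- Integral curves with small data exist on `[0, 1]` and stay near their starting points. -/
lemma exists_radialFlow [CompleteSpace E] (h : PlaqueField L L' y₀ R r K) {x y : E}
    (hx : K * ‖x‖ < R / 4) (hy : y ∈ closedBall y₀ (R / 4)) :
    ∃ g, g 0 = y ∧ IsRadialFlow L x g ∧ ∀ s ∈ Icc (0 : ℝ) 1, ‖g s - y‖ ≤ K * ‖x‖ := by
  have hR := h.R_pos
  have hsub : closedBall y (R / 4) ⊆ closedBall y₀ R := by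
    refine closedBall_subset_closedBall' ?_
    have := mem_closedBall.1 hy
    linarith
  have hpl : IsPicardLindelof (fun _ z ↦ L z x) (⟨0, by simp⟩ : Icc (0 : ℝ) 1) y
      ⟨R / 4, by positivity⟩ 0 (K * ‖x‖₊) (K * ‖x‖₊) := by
    refine ⟨fun t _ ↦ ?_, fun z _ ↦ continuousOn_const, fun t _ z hz ↦ ?_, ?_⟩
    · refine LipschitzOnWith.of_dist_le_mul fun a ha b hb ↦ ?_
      rw [dist_eq_norm, dist_eq_norm, ← _root_.sub_apply]
      calc ‖(L a - L b) x‖ ≤ ‖L a - L b‖ * ‖x‖ := ContinuousLinearMap.le_opNorm _ _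
        _ ≤ (K * ‖a - b‖) * ‖x‖ := by
            gcongr
            exact h.norm_sub_le (hsub hb) (hsub ha)
        _ = _ := by push_cast; ring
    · exact h.norm_apply_le (hsub hz) x
    · simp
      exact hx.le
  obtain ⟨g, hg0, hg⟩ := hpl.exists_eq_forall_mem_Icc_hasDerivWithinAt₀
  simp only at hg0
  refine ⟨g, hg0, hg, ?_⟩
  have hcont : ContinuousOn g (Icc 0 1) := fun s hs ↦ (hg s hs).continuousWithinAt
  have hderiv : ∀ s ∈ Ico (0 : ℝ) 1, HasDerivWithinAt g (L (g s) x) (Ici s) s := fun s hs ↦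
    (hg s (Ico_subset_Icc_self hs)).mono_of_mem_nhdsWithin (Icc_mem_nhdsGE_of_mem hs)
  -- A fencing argument: wherever the bound is attained, the curve is still in the ball and has
  -- speed below `R / 4`, so it cannot cross. This keeps it where `‖L‖ ≤ K`, which gives the sharper
  -- bound below.
  have hmem : ∀ s ∈ Icc (0 : ℝ) 1, ‖g s - y‖ ≤ R / 4 * s := by
    refine image_norm_le_of_norm_deriv_right_lt_deriv_boundary' (f := fun s ↦ g s - y)
      (f' := fun s ↦ L (g s) x) (B' := fun _ ↦ R / 4)
      (hcont.sub continuousOn_const) (fun s hs ↦ (hderiv s hs).sub_const y)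
      (by simp [hg0]) (by fun_prop) (fun s _ ↦ ?_) (fun s hs hs' ↦ ?_)
    · simpa using ((hasDerivAt_id s).const_mul (R / 4)).hasDerivWithinAt
    · refine lt_of_le_of_lt (h.norm_apply_le (hsub ?_) x) hx
      rw [mem_closedBall, dist_eq_norm, hs']
      have := hs.2
      nlinarith
  intro s hs
  have key : ‖g s - g 0‖ ≤ K * ‖x‖ * (s - 0) := by
    refine norm_image_sub_le_of_norm_deriv_right_le_segment hcont hderiv (fun t ht ↦ ?_) s hs
    refine h.norm_apply_le (hsub ?_) x
    rw [mem_closedBall, dist_eq_norm]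
    refine (hmem t (Ico_subset_Icc_self ht)).trans ?_
    have := ht.2
    nlinarith
  rw [hg0, sub_zero] at key
  refine key.trans (mul_le_of_le_one_right (by positivity) hs.2)

/-- Stability of integral curves under approximation. -/
lemma norm_sub_le_of_approx (h : PlaqueField L L' y₀ R r K) {x : E} (hx : ‖x‖ ≤ 1) {g Z Z' : ℝ → E}
    (hg : IsRadialFlow L x g) (hgR : ∀ s ∈ Icc (0 : ℝ) 1, g s ∈ closedBall y₀ R)
    (hZ : ∀ s ∈ Icc (0 : ℝ) 1, HasDerivWithinAt Z (Z' s) (Icc 0 1) s)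
    (hZR : ∀ s ∈ Icc (0 : ℝ) 1, Z s ∈ closedBall y₀ R) {ε : ℝ} (h0 : ‖Z 0 - g 0‖ ≤ ε)
    (hε : ∀ s ∈ Icc (0 : ℝ) 1, ‖Z' s - L (Z s) x‖ ≤ ε) :
    ‖Z 1 - g 1‖ ≤ ε * gronwallBound 1 K 1 1 := by
  have := dist_le_of_approx_trajectories_ODE_of_mem (v := fun _ z ↦ L z x)
    (s := fun _ ↦ closedBall y₀ R) (K := K) (a := 0) (b := 1) (δ := ε) (εf := ε) (εg := 0)
    (f := Z) (g := g) (f' := Z') (g' := fun s ↦ L (g s) x)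
    (fun _ _ ↦ h.lipschitz_apply hx)
    (fun s hs ↦ (hZ s hs).continuousWithinAt)
    (fun s hs ↦ (hZ s (Ico_subset_Icc_self hs)).mono_of_mem_nhdsWithin (Icc_mem_nhdsGE_of_mem hs))
    (fun s hs ↦ by rw [dist_eq_norm]; exact hε s (Ico_subset_Icc_self hs))
    (fun s hs ↦ hZR s (Ico_subset_Icc_self hs))
    (fun s hs ↦ (hg s hs).continuousWithinAt)
    (fun s hs ↦ (hg s (Ico_subset_Icc_self hs)).mono_of_mem_nhdsWithin (Icc_mem_nhdsGE_of_mem hs))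
    (fun s hs ↦ by simp)
    (fun s hs ↦ hgR s (Ico_subset_Icc_self hs))
    (by rw [dist_eq_norm]; exact h0) 1 (by simp)
  rw [dist_eq_norm] at this
  refine this.trans (le_of_eq ?_)
  simp only [gronwallBound, add_zero, sub_zero, mul_one]
  split_ifs
  · ring
  · ring

/-- The endpoints at time `1` of integral curves depend injectively on the starting points. -/
lemma eq_of_radialFlow_eq (h : PlaqueField L L' y₀ R r K) {x : E} (hx : ‖x‖ ≤ 1) {g g' : ℝ → E}
    (hg : IsRadialFlow L x g) (hgR : ∀ s ∈ Icc (0 : ℝ) 1, g s ∈ closedBall y₀ R)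
    (hg' : IsRadialFlow L x g') (hgR' : ∀ s ∈ Icc (0 : ℝ) 1, g' s ∈ closedBall y₀ R)
    (h1 : g 1 = g' 1) : g 0 = g' 0 := by
  refine ODE_solution_unique_of_mem_Icc_left (v := fun _ z ↦ L z x)
    (s := fun _ ↦ closedBall y₀ R) (K := K) (fun _ _ ↦ h.lipschitz_apply hx)
    (fun s hs ↦ (hg s hs).continuousWithinAt)
    (fun s hs ↦ (hg s (Ioc_subset_Icc_self hs)).mono_of_mem_nhdsWithin (Icc_mem_nhdsLE_of_mem hs))
    (fun s hs ↦ hgR s (Ioc_subset_Icc_self hs))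
    (fun s hs ↦ (hg' s hs).continuousWithinAt)
    (fun s hs ↦ (hg' s (Ioc_subset_Icc_self hs)).mono_of_mem_nhdsWithin (Icc_mem_nhdsLE_of_mem hs))
    (fun s hs ↦ hgR' s (Ioc_subset_Icc_self hs)) h1 (by simp)

end PlaqueField

end Plaques


/-! ### The plaque map of an involutive distribution. -/

section Plaques

open Metric Filter Topology NNReal

variable {E : Type*} [NormedAddCommGroup E] [NormedSpace ℝ E]

/-- For `y` near `y₀`, `G y` is the integral curve that starts at `y` and ends on the transversal
`y₀ + ker (L y₀)`. -/
def IsPlaqueFlow (L : E → E →L[ℝ] E) (y₀ : E) (r : ℝ) (K : ℝ≥0) (G : E → ℝ → E) : Prop :=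
  ∀ y ∈ ball y₀ r, G y 0 = y ∧ IsRadialFlow L (-(L y₀ (y - y₀))) (G y) ∧
    ∀ s ∈ Icc (0 : ℝ) 1, ‖G y s - y‖ ≤ K * (K * ‖y - y₀‖)

namespace PlaqueField

variable {L : E → E →L[ℝ] E} {L' : E → E →L[ℝ] E →L[ℝ] E} {y₀ : E} {R r : ℝ} {K : ℝ≥0}

lemma norm_proj_le (h : PlaqueField L L' y₀ R r K) (x : E) : ‖L y₀ x‖ ≤ K * ‖x‖ :=
  h.norm_apply_le h.center_mem x

lemma exists_plaqueFlow [CompleteSpace E] (h : PlaqueField L L' y₀ R r K) :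
    ∃ G, IsPlaqueFlow L y₀ r K G := by
  have key : ∀ y, ∃ g : ℝ → E, y ∈ ball y₀ r → g 0 = y ∧ IsRadialFlow L (-(L y₀ (y - y₀))) g ∧
      ∀ s ∈ Icc (0 : ℝ) 1, ‖g s - y‖ ≤ K * (K * ‖y - y₀‖) := by
    intro y
    by_cases hy : y ∈ ball y₀ r
    · have hy' : ‖y - y₀‖ < r := by rwa [mem_ball, dist_eq_norm] at hy
      have hx : ‖-(L y₀ (y - y₀))‖ ≤ K * ‖y - y₀‖ := by
        rw [norm_neg]
        exact h.norm_proj_le _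
      obtain ⟨g, h0, h1, h2⟩ := h.exists_radialFlow (x := -(L y₀ (y - y₀))) (y := y)
        (lt_of_le_of_lt (by gcongr; exact hx.trans (by gcongr)) h.mul_r_lt)
        (mem_closedBall.2 ((mem_ball.1 hy).le.trans h.r_le))
      exact ⟨g, fun _ ↦ ⟨h0, h1, fun s hs ↦ (h2 s hs).trans (by gcongr)⟩⟩
    · exact ⟨0, fun hy' ↦ absurd hy' hy⟩
  choose G hG using key
  exact ⟨G, hG⟩

variable {G : E → ℝ → E}

lemma norm_initial_le (h : PlaqueField L L' y₀ R r K) {y : E} (hy : y ∈ ball y₀ r) :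
    ‖-(L y₀ (y - y₀))‖ ≤ 1 := by
  rw [norm_neg]
  rw [mem_ball, dist_eq_norm] at hy
  exact (h.norm_proj_le _).trans (le_trans (by gcongr) h.mul_r_le)

lemma plaqueFlow_mem_half (h : PlaqueField L L' y₀ R r K) (hG : IsPlaqueFlow L y₀ r K G) {y : E}
    (hy : y ∈ ball y₀ r) {s : ℝ} (hs : s ∈ Icc (0 : ℝ) 1) : G y s ∈ closedBall y₀ (R / 2) := by
  have h1 := (hG y hy).2.2 s hs
  rw [mem_ball, dist_eq_norm] at hy
  rw [mem_closedBall, dist_eq_norm]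
  have h2 : (K : ℝ) * (K * ‖y - y₀‖) ≤ K * (K * r) := by gcongr
  have h3 := norm_add_le (G y s - y) (y - y₀)
  rw [sub_add_sub_cancel] at h3
  linarith [h.mul_r_lt, h.r_le]

lemma plaqueFlow_mem (h : PlaqueField L L' y₀ R r K) (hG : IsPlaqueFlow L y₀ r K G) {y : E}
    (hy : y ∈ ball y₀ r) {s : ℝ} (hs : s ∈ Icc (0 : ℝ) 1) : G y s ∈ closedBall y₀ R :=
  closedBall_subset_closedBall (by linarith [h.R_pos]) (h.plaqueFlow_mem_half hG hy hs)

lemma ball_subset (h : PlaqueField L L' y₀ R r K) : ball y₀ r ⊆ closedBall y₀ R :=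
  ball_subset_closedBall.trans (closedBall_subset_closedBall (by linarith [h.r_le, h.R_pos]))

/-- The first-order behaviour of the plaque map `y ↦ G y 1`: its derivative vanishes along the
distribution. -/
lemma norm_plaqueMap_sub_le (h : PlaqueField L L' y₀ R r K) (hG : IsPlaqueFlow L y₀ r K G)
    {y z : E} (hy : y ∈ ball y₀ r) (hz : z ∈ ball y₀ r) :
    ‖G z 1 - G y 1‖ ≤ (‖L y (z - y) - (z - y)‖ + K ^ 4 * (K + 1) * ‖z - y‖ ^ 2) *
      gronwallBound 1 K 1 1 := by
  set δ := z - y with hδ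
  set u := L y₀ δ with hu
  set x := -(L y₀ (y - y₀)) with hx
  obtain ⟨hg0, hg, -⟩ := hG y hy
  rw [← hx] at hg
  set g := G y
  have hgR : ∀ s ∈ Icc (0 : ℝ) 1, g s ∈ closedBall y₀ R := fun s hs ↦ h.plaqueFlow_mem hG hy hs
  have hu_le : ‖u‖ ≤ K * ‖δ‖ := h.norm_proj_le δ
  have hδ_le : ‖δ‖ ≤ 2 * r := by
    rw [hδ, ← sub_sub_sub_cancel_right z y y₀]
    rw [mem_ball, dist_eq_norm] at hy hz
    linarith [_root_.norm_sub_le (z - y₀) (y - y₀)]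
  have hxz : -(L y₀ (z - y₀)) = x - u := by
    rw [hx, hu, hδ, ← sub_add_sub_cancel z y y₀, map_add]
    abel
  have hxu : ‖x - u‖ ≤ 1 := hxz ▸ h.norm_initial_le hz
  have hx1 : ‖x‖ ≤ 1 := h.norm_initial_le hy
  have hPu : L y₀ u = u := h.proj_left y₀ h.center_mem δ
  -- An approximate variation of the flow when the start moves by `δ` and the velocity accordingly
  -- by `-u`. It starts at `L y δ`, which is `δ` for tangent `δ`, and vanishes at time `1`, so `g +
  -- w` ends at `G y 1` while approximating `G z`.
  let w : ℝ → E := fun s ↦ (1 - s) • L (g s) u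
  let w' : ℝ → E := fun s ↦ (1 - s) • L' (g s) (L (g s) x) u - L (g s) u
  have hw : ∀ s ∈ Icc (0 : ℝ) 1, HasDerivWithinAt w (w' s) (Icc 0 1) s := by
    intro s hs
    have h1 : HasDerivWithinAt (fun t ↦ L (g t)) (L' (g s) (L (g s) x)) (Icc 0 1) s :=
      (h.hasFDerivAt _ (hgR s hs)).comp_hasDerivWithinAt s (hg s hs)
    have h2 : HasDerivWithinAt (fun t ↦ L (g t) u) (L' (g s) (L (g s) x) u) (Icc 0 1) s := by
      simpa using h1.clm_apply (hasDerivWithinAt_const s _ u)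
    have h3 : HasDerivWithinAt (fun t : ℝ ↦ 1 - t) (-1) (Icc 0 1) s :=
      (hasDerivWithinAt_id s _).const_sub 1
    refine (h3.smul h2).congr_deriv ?_
    rw [neg_one_smul, ← sub_eq_add_neg]
  have hw_le : ∀ s ∈ Icc (0 : ℝ) 1, ‖w s‖ ≤ K * ‖u‖ := by
    intro s hs
    have h1 : |1 - s| ≤ 1 := by rw [abs_le]; constructor <;> linarith [hs.1, hs.2]
    rw [norm_smul, Real.norm_eq_abs]
    exact (mul_le_of_le_one_left (norm_nonneg _) h1).trans (h.norm_apply_le (hgR s hs) u)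
  have hwR : ∀ s ∈ Icc (0 : ℝ) 1, g s + w s ∈ closedBall y₀ R := by
    intro s hs
    have h1 := h.plaqueFlow_mem_half hG hy hs
    rw [mem_closedBall, dist_eq_norm] at h1 ⊢
    have h2 := hw_le s hs
    have h3 : (K : ℝ) * ‖u‖ ≤ K * (K * (2 * r)) := by
      gcongr
      exact hu_le.trans (by gcongr)
    have h4 := norm_add_le (g s - y₀) (w s)
    rw [show g s - y₀ + w s = g s + w s - y₀ by abel] at h4
    linarith [h.mul_r_lt]
  have hend := h.norm_sub_le_of_approx hxu (g := G z) (Z := fun s ↦ g s + w s)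
    (Z' := fun s ↦ L (g s) x + w' s) (hxz ▸ (hG z hz).2.1)
    (fun s hs ↦ h.plaqueFlow_mem hG hz hs) (fun s hs ↦ (hg s hs).add (hw s hs)) hwR
    (ε := ‖L y δ - δ‖ + K ^ 4 * (K + 1) * ‖δ‖ ^ 2) ?_ ?_
  · rw [show g 1 + w 1 = G y 1 by simp [w, g]] at hend
    rw [norm_sub_rev]
    exact hend
  · have h1 : g 0 + w 0 - G z 0 = L y δ - δ := by
      simp only [w, sub_zero, one_smul]
      rw [hg0, (hG z hz).1, hu, h.proj_right y (h.ball_subset hy), hδ]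
      abel
    rw [h1]
    have : 0 ≤ (K : ℝ) ^ 4 * (K + 1) * ‖δ‖ ^ 2 := by positivity
    linarith
  · intro s hs
    have hgs := hgR s hs
    set rem := L (g s + w s) - L (g s) - L' (g s) (w s) with hrem
    have hrem_le : ‖rem‖ ≤ K * ‖w s‖ ^ 2 := h.norm_sub_sub_le hgs (hwR s hs)
    have hL : L (g s + w s) = rem + L (g s) + L' (g s) (w s) := by rw [hrem]; abel
    have hsymm := h.symm (g s) hgs x u
    -- Commutation of the fields identifies the derivative of `L` along `w` applied to `x` with the
    -- first term of `w'`. All first-order errors cancel and only quadratic ones remain.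
    have hid : L (g s) x + w' s - L (g s + w s) (x - u) =
        (1 - s) • L' (g s) (L (g s) u) u - rem (x - u) := by
      rw [hL]
      simp only [w, w', map_smul, _root_.add_apply, _root_.smul_apply, map_sub, hsymm]
      abel
    rw [hid]
    have h1s : |1 - s| ≤ 1 := by rw [abs_le]; constructor <;> linarith [hs.1, hs.2]
    have e1 : ‖(1 - s) • L' (g s) (L (g s) u) u‖ ≤ K * (K * ‖u‖) * ‖u‖ := by
      rw [norm_smul, Real.norm_eq_abs]
      refine (mul_le_of_le_one_left (norm_nonneg _) h1s).trans ?_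
      refine (ContinuousLinearMap.le_opNorm _ _).trans ?_
      gcongr
      refine (ContinuousLinearMap.le_opNorm _ _).trans ?_
      gcongr
      · exact h.norm_deriv_le _ hgs
      · exact h.norm_apply_le hgs u
    have e2 : ‖rem (x - u)‖ ≤ K * (K * ‖u‖) ^ 2 := by
      refine (ContinuousLinearMap.le_opNorm _ _).trans ?_
      refine (mul_le_of_le_one_right (norm_nonneg _) hxu).trans (hrem_le.trans ?_)
      gcongr
      exact hw_le s hs
    have e3 : K * (K * ‖u‖) * ‖u‖ + K * (K * ‖u‖) ^ 2 ≤
        (K : ℝ) ^ 4 * (K + 1) * ‖δ‖ ^ 2 := by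
      calc K * (K * ‖u‖) * ‖u‖ + K * (K * ‖u‖) ^ 2 = (K : ℝ) ^ 2 * (K + 1) * ‖u‖ ^ 2 := by ring
        _ ≤ (K : ℝ) ^ 2 * (K + 1) * (K * ‖δ‖) ^ 2 := by gcongr
        _ = _ := by ring
    have e4 := _root_.norm_sub_le ((1 - s) • L' (g s) (L (g s) u) u) (rem (x - u))
    have := norm_nonneg (L y δ - δ)
    linarith

lemma continuousAt_plaqueMap (h : PlaqueField L L' y₀ R r K) (hG : IsPlaqueFlow L y₀ r K G)
    {y : E} (hy : y ∈ ball y₀ r) : ContinuousAt (fun z ↦ G z 1) y := by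
  rw [ContinuousAt, tendsto_iff_norm_sub_tendsto_zero]
  refine squeeze_zero' (Eventually.of_forall fun _ ↦ norm_nonneg _)
    ((isOpen_ball.eventually_mem hy).mono fun z hz ↦ h.norm_plaqueMap_sub_le hG hy hz) ?_
  have : Continuous fun z ↦ (‖L y (z - y) - (z - y)‖ + K ^ 4 * (K + 1) * ‖z - y‖ ^ 2) *
      gronwallBound 1 K 1 1 := by fun_prop
  simpa using this.tendsto y

/-- The plaque map is constant along curves tangent to the distribution. -/
lemma plaqueMap_eq_of_tangent (h : PlaqueField L L' y₀ R r K) (hG : IsPlaqueFlow L y₀ r K G)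
    {a b : ℝ} (hab : a ≤ b) {γ γ' : ℝ → E}
    (hγ : ∀ t ∈ Icc a b, HasDerivWithinAt γ (γ' t) (Icc a b) t)
    (hmem : ∀ t ∈ Icc a b, γ t ∈ ball y₀ r) (htan : ∀ t ∈ Icc a b, L (γ t) (γ' t) = γ' t) :
    G (γ b) 1 = G (γ a) 1 := by
  refine constant_of_has_deriv_right_zero (f := fun t ↦ G (γ t) 1) (fun t ht ↦ ?_)
    (fun t ht ↦ ?_) b (right_mem_Icc.2 hab)
  · exact (h.continuousAt_plaqueMap hG (hmem t ht)).comp_continuousWithinAt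
      (hγ t ht).continuousWithinAt
  · have ht' := Ico_subset_Icc_self ht
    suffices HasDerivWithinAt (fun t ↦ G (γ t) 1) 0 (Icc a b) t from
      this.mono_of_mem_nhdsWithin (Icc_mem_nhdsGE_of_mem ht)
    have hd := hγ t ht'
    have hy := hmem t ht'
    set y := γ t
    -- Tangency, `L y (γ' t) = γ' t`, makes the linear part of the estimate negligible. The other
    -- part is quadratic, so the plaque map has derivative zero along `γ`.
    have h1 : (fun τ ↦ L y (γ τ - y) - (γ τ - y)) =o[𝓝[Icc a b] t] fun τ ↦ τ - t := by
      have h2 : HasDerivWithinAt (fun τ ↦ L y (γ τ) - γ τ) (L y (γ' t) - γ' t) (Icc a b) t :=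
        ((L y).hasFDerivAt.comp_hasDerivWithinAt t hd).sub hd
      rw [htan t ht', sub_self, hasDerivWithinAt_iff_isLittleO] at h2
      refine h2.congr_left fun τ ↦ ?_
      simp [y]
      abel
    have h2 : (fun τ ↦ ‖γ τ - y‖ ^ 2) =o[𝓝[Icc a b] t] fun τ ↦ τ - t := by
      have h3 : (fun τ ↦ γ τ - y) =O[𝓝[Icc a b] t] fun τ ↦ τ - t :=
        hd.hasFDerivWithinAt.isBigO_sub
      have h4 : (fun τ ↦ γ τ - y) =o[𝓝[Icc a b] t] fun _ ↦ (1 : ℝ) := by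
        rw [Asymptotics.isLittleO_one_iff]
        simpa [y] using (hd.continuousWithinAt.tendsto.sub_const y)
      simpa [pow_two] using h4.norm_left.mul_isBigO h3.norm_left
    rw [hasDerivWithinAt_iff_isLittleO]
    simp only [smul_zero, sub_zero]
    refine Asymptotics.IsBigO.trans_isLittleO (g := fun τ ↦
      (‖L y (γ τ - y) - (γ τ - y)‖ + K ^ 4 * (K + 1) * ‖γ τ - y‖ ^ 2) * gronwallBound 1 K 1 1) ?_ ?_
    · refine Asymptotics.IsBigO.of_bound' ?_
      filter_upwards [self_mem_nhdsWithin] with τ hτ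
      exact (h.norm_plaqueMap_sub_le hG hy (hmem τ hτ)).trans (le_abs_self _)
    · have := (h1.norm_left.add (h2.const_mul_left ((K : ℝ) ^ 4 * (K + 1)))).const_mul_left
        (gronwallBound 1 K 1 1)
      exact this.congr_left fun τ ↦ mul_comm _ _

/-- Two nearby points of a plaque are joined by a curve in the plaque. -/
lemma exists_curve_of_plaqueMap_eq [CompleteSpace E] (h : PlaqueField L L' y₀ R r K)
    (hG : IsPlaqueFlow L y₀ r K G) {y : E} (hy : y ∈ ball y₀ r) {W : Set E} (hW : W ∈ 𝓝 y) :
    ∀ᶠ z in 𝓝 y, G z 1 = G y 1 → ∃ (g : ℝ → E) (x : E), g 0 = y ∧ g 1 = z ∧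
      IsRadialFlow L x g ∧ ∀ s ∈ Icc (0 : ℝ) 1, g s ∈ W := by
  obtain ⟨ε, hε, hεW⟩ := Metric.mem_nhds_iff.1 (inter_mem hW (isOpen_ball.mem_nhds hy))
  have h1 : Tendsto (fun z ↦ (K : ℝ) * ‖L y₀ (z - y)‖) (𝓝 y) (𝓝 0) := by
    have : Continuous fun z ↦ (K : ℝ) * ‖L y₀ (z - y)‖ := by fun_prop
    simpa using this.tendsto y
  filter_upwards [h1.eventually_lt_const hε,
    h1.eventually_lt_const (show (0 : ℝ) < R / 4 by linarith [h.R_pos]),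
    isOpen_ball.eventually_mem hy] with z hz1 hz2 hz3 hzy
  -- The flow with this velocity reaches at time `1` a point with the same `L y₀` coordinate as `z`;
  -- being tangent, it also keeps the plaque value.
  obtain ⟨g, hg0, hg, hgy⟩ := h.exists_radialFlow (x := L y₀ (z - y)) hz2
    (mem_closedBall.2 ((mem_ball.1 hy).le.trans h.r_le))
  have hgW : ∀ s ∈ Icc (0 : ℝ) 1, g s ∈ W ∩ ball y₀ r := fun s hs ↦ hεW (by
    rw [mem_ball, dist_eq_norm]
    exact (hgy s hs).trans_lt hz1)
  have h1mem : (1 : ℝ) ∈ Icc (0 : ℝ) 1 := by simp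
  refine ⟨g, L y₀ (z - y), hg0, ?_, hg, fun s hs ↦ (hgW s hs).1⟩
  have hL : ∀ w ∈ closedBall y₀ R, ∀ v, L w (L w v) = L w v := fun w hw v ↦ by
    rw [← h.proj_right w hw (L w v), h.proj_left w hw, h.proj_right w hw]
  have hgz : G (g 1) 1 = G z 1 := by
    rw [hzy, ← hg0]
    exact h.plaqueMap_eq_of_tangent hG zero_le_one hg (fun s hs ↦ (hgW s hs).2)
      (fun s hs ↦ hL _ (h.ball_subset (hgW s hs).2) _)
  have hproj : L y₀ (g 1) = L y₀ z := by
    have hd : ∀ s ∈ Icc (0 : ℝ) 1, HasDerivWithinAt (fun s ↦ L y₀ (g s) - s • L y₀ (z - y)) 0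
        (Icc 0 1) s := by
      intro s hs
      have h2 := ((L y₀).hasFDerivAt.comp_hasDerivWithinAt s (hg s hs)).sub
        ((hasDerivWithinAt_id s (Icc (0 : ℝ) 1)).smul_const (L y₀ (z - y)))
      refine h2.congr_deriv ?_
      rw [h.proj_left _ (h.ball_subset (hgW s hs).2), h.proj_left _ h.center_mem, one_smul,
        sub_self]
    have := constant_of_has_deriv_right_zero (fun s hs ↦ (hd s hs).continuousWithinAt)
      (fun s hs ↦ (hd s (Ico_subset_Icc_self hs)).mono_of_mem_nhdsWithin
        (Icc_mem_nhdsGE_of_mem hs)) 1 h1mem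
    simp only [one_smul, zero_smul, sub_zero, hg0, map_sub] at this
    rw [sub_eq_iff_eq_add] at this
    rw [this]
    abel
  have hg1 := (hgW 1 h1mem).2
  have hx : -(L y₀ (g 1 - y₀)) = -(L y₀ (z - y₀)) := by rw [map_sub, map_sub, hproj]
  -- The points `g 1` and `z` are carried by the same field to the same point at time `1`, so
  -- backward uniqueness identifies them.
  have := h.eq_of_radialFlow_eq (h.norm_initial_le hz3) (hx ▸ (hG _ hg1).2.1)
    (fun s hs ↦ h.plaqueFlow_mem hG hg1 hs) (hG z hz3).2.1
    (fun s hs ↦ h.plaqueFlow_mem hG hz3 hs) hgz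
  rw [(hG _ hg1).1, (hG z hz3).1] at this
  exact this

/-- The velocity `x` is of first order in `y - y₀`, and replacing `L (G y s)` by `L y₀` costs a
quadratic error, so `G y 1` is `y + x` up to second order. The kernel of the derivative is thus the
distribution at `y₀`. -/
lemma hasFDerivAt_plaqueMap (h : PlaqueField L L' y₀ R r K) (hG : IsPlaqueFlow L y₀ r K G) :
    HasFDerivAt (fun z ↦ G z 1) (ContinuousLinearMap.id ℝ E - L y₀) y₀ := by
  have hy₀ : y₀ ∈ ball y₀ r := mem_ball_self h.r_pos
  have h0 : G y₀ 1 = y₀ := by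
    have := (hG y₀ hy₀).2.2 1 (by simp)
    simpa [sub_eq_zero] using this
  have key : ∀ y ∈ ball y₀ r, ‖G y 1 - G y₀ 1 - (ContinuousLinearMap.id ℝ E - L y₀) (y - y₀)‖ ≤
      (K * (K * K + 1) * K) * ‖y - y₀‖ ^ 2 := by
    intro y hy
    obtain ⟨hg0, hg, hgy⟩ := hG y hy
    set x := -(L y₀ (y - y₀)) with hx
    have hxy : ‖x‖ ≤ K * ‖y - y₀‖ := by rw [hx, norm_neg]; exact h.norm_proj_le _
    have hPx : L y₀ x = x := by rw [hx, map_neg, h.proj_left _ h.center_mem]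
    have h1 : ∀ s ∈ Icc (0 : ℝ) 1,
        HasDerivWithinAt (fun s ↦ G y s - s • x) (L (G y s) x - x) (Icc 0 1) s := fun s hs ↦ by
      refine ((hg s hs).sub ((hasDerivWithinAt_id s (Icc (0 : ℝ) 1)).smul_const x)).congr_deriv ?_
      rw [one_smul]
    have h2 : ‖(G y 1 - (1 : ℝ) • x) - (G y 0 - (0 : ℝ) • x)‖ ≤
        (K * (K * K + 1) * K) * ‖y - y₀‖ ^ 2 * (1 - 0) := by
      refine norm_image_sub_le_of_norm_deriv_right_le_segment (f := fun s ↦ G y s - s • x)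
        (fun s hs ↦ (h1 s hs).continuousWithinAt)
        (fun s hs ↦ (h1 s (Ico_subset_Icc_self hs)).mono_of_mem_nhdsWithin
          (Icc_mem_nhdsGE_of_mem hs)) (fun s hs ↦ ?_) 1 (by simp)
      have hs' := Ico_subset_Icc_self hs
      have h3 : L (G y s) x - x = (L (G y s) - L y₀) x := by
        rw [_root_.sub_apply, hPx]
      have h4 : ‖G y s - y₀‖ ≤ (K * K + 1) * ‖y - y₀‖ := by
        have := norm_add_le (G y s - y) (y - y₀)
        rw [sub_add_sub_cancel] at this
        linarith [hgy s hs']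
      rw [h3]
      calc ‖(L (G y s) - L y₀) x‖ ≤ ‖L (G y s) - L y₀‖ * ‖x‖ := ContinuousLinearMap.le_opNorm _ _
        _ ≤ (K * ((K * K + 1) * ‖y - y₀‖)) * (K * ‖y - y₀‖) := by
            gcongr
            exact (h.norm_sub_le h.center_mem (h.plaqueFlow_mem hG hy hs')).trans (by gcongr)
        _ = _ := by ring
    rw [sub_zero, mul_one] at h2
    refine (le_of_eq ?_).trans h2
    congr 1
    rw [h0, hg0, hx]
    simp
    abel
  rw [hasFDerivAt_iff_isLittleO]
  refine Asymptotics.IsBigO.trans_isLittleO (g := fun y ↦ ‖y - y₀‖ ^ 2) ?_ ?_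
  · refine Asymptotics.IsBigO.of_bound (K * (K * K + 1) * K : ℝ) ?_
    filter_upwards [isOpen_ball.eventually_mem hy₀] with y hy
    simpa using key y hy
  · have h4 : (fun y ↦ y - y₀) =o[𝓝 y₀] fun _ ↦ (1 : ℝ) := by
      rw [Asymptotics.isLittleO_one_iff]
      have : Continuous fun y ↦ y - y₀ := by fun_prop
      simpa using this.tendsto y₀
    have h5 := h4.norm_left.mul_isBigO
      (Asymptotics.isBigO_refl (fun y ↦ ‖y - y₀‖) (𝓝 y₀))
    simp only [one_mul, ← pow_two] at h5
    exact h5.of_norm_right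

end PlaqueField

end Plaques


/-! ### Kernels of constant rank and involutivity. -/

section ConstantRank

open Metric Filter Topology NNReal

variable {E F : Type*} [NormedAddCommGroup E] [NormedSpace ℝ E]
  [NormedAddCommGroup F] [NormedSpace ℝ F]

lemma two_le_infty : (2 : WithTop ℕ∞) ≤ ∞ :=
  show ((2 : ℕ∞) : WithTop ℕ∞) ≤ ((⊤ : ℕ∞) : WithTop ℕ∞) from WithTop.coe_le_coe.2 le_top

/-- A right inverse of `B` onto its range, extended linearly to all of `F`. -/
lemma exists_generalizedInverse [FiniteDimensional ℝ F] (B : E →L[ℝ] F) : ∃ T : F →L[ℝ] E, ∀ v, B (T (B v)) = B v := by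
  obtain ⟨s, hs⟩ := (B : E →ₗ[ℝ] F).rangeRestrict.exists_rightInverse_of_surjective
    (LinearMap.range_rangeRestrict _)
  obtain ⟨T, hT⟩ := LinearMap.exists_extend s
  refine ⟨LinearMap.toContinuousLinearMap T, fun v ↦ ?_⟩
  have h1 := LinearMap.congr_fun hT ((B : E →ₗ[ℝ] F).rangeRestrict v)
  have h2 := congrArg Subtype.val (LinearMap.congr_fun hs ((B : E →ₗ[ℝ] F).rangeRestrict v))
  have h3 : T (B v) = s ((B : E →ₗ[ℝ] F).rangeRestrict v) := h1
  rw [LinearMap.coe_toContinuousLinearMap', h3]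
  exact h2

/-- The kernels of a smooth family of linear maps of constant rank are locally the ranges of a smooth
family of projections with a common kernel. -/
lemma exists_projections_onto_ker [FiniteDimensional ℝ E] [FiniteDimensional ℝ F] {B : E → E →L[ℝ] F} {y₀ : E} {n : WithTop ℕ∞}
    (hB : ContDiffAt ℝ n B y₀) (hB0 : ContinuousAt B y₀)
    (hrank : ∀ᶠ y in 𝓝 y₀, Module.finrank ℝ (LinearMap.ker (B y : E →ₗ[ℝ] F)) =
      Module.finrank ℝ (LinearMap.ker (B y₀ : E →ₗ[ℝ] F))) :
    ∃ L : E → E →L[ℝ] E, ContDiffAt ℝ n L y₀ ∧ ∀ᶠ y in 𝓝 y₀,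
      (∀ v, B y (L y v) = 0) ∧ (∀ v, B y v = 0 → L y v = v) ∧
      (∀ v, L y₀ (L y v) = L y₀ v) ∧ ∀ v, L y (L y₀ v) = L y v := by
  obtain ⟨T, hT⟩ := exists_generalizedInverse (B y₀)
  let P : E →L[ℝ] E := ContinuousLinearMap.id ℝ E - T.comp (B y₀)
  have hP : ∀ v, P v = v - T (B y₀ v) := fun v ↦ rfl
  have hBP : ∀ v, B y₀ (P v) = 0 := fun v ↦ by rw [hP, map_sub, hT, sub_self]
  have hPker : ∀ v, B y₀ v = 0 → P v = v := fun v hv ↦ by rw [hP, hv, map_zero, sub_zero]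
  have hPP : ∀ v, P (P v) = P v := fun v ↦ hPker _ (hBP v)
  -- `S` is the identity at `y₀`, hence invertible nearby, and agrees with `P` on `ker (B y)`. So
  -- `S⁻¹ P` fixes that kernel.
  let S : E → E →L[ℝ] E := fun y ↦ P + T.comp (B y)
  have hS0 : S y₀ = 1 := by
    ext v
    simp [S, hP]
  have hS : ContDiffAt ℝ n S y₀ := contDiffAt_const.add (contDiffAt_const.clm_comp hB)
  let L : E → E →L[ℝ] E := fun y ↦ (Ring.inverse (S y)).comp P
  have hL0 : L y₀ = P := by
    simp only [L, hS0, Ring.inverse_one]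
    rfl
  have hunit : ∀ᶠ y in 𝓝 y₀, IsUnit (S y) := by
    have hc : ContinuousAt S y₀ := continuousAt_const.add (continuousAt_const.clm_comp hB0)
    exact hc.eventually (Units.isOpen.eventually_mem (by rw [hS0]; exact isUnit_one))
  refine ⟨L, ?_, ?_⟩
  · refine ContDiffAt.clm_comp ?_ contDiffAt_const
    have h1 : ContDiffAt ℝ n (Ring.inverse : (E →L[ℝ] E) → E →L[ℝ] E) (S y₀) := by
      rw [hS0]
      exact contDiffAt_ringInverse ℝ (1 : (E →L[ℝ] E)ˣ)
    exact h1.comp y₀ hS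
  · filter_upwards [hunit, hrank] with y hy hr
    have hinv : ∀ v, Ring.inverse (S y) (S y v) = v := fun v ↦ by
      have := Ring.inverse_mul_cancel (S y) hy
      exact DFunLike.congr_fun this v
    have hLker : ∀ v, B y v = 0 → L y v = v := fun v hv ↦ by
      have : S y v = P v := by simp [S, hv]
      change Ring.inverse (S y) (P v) = v
      rw [← this, hinv]
    have hinj : ∀ v, B y v = 0 → P v = 0 → v = 0 := fun v hv hv' ↦ by
      rw [← hLker v hv]
      change Ring.inverse (S y) (P v) = 0
      rw [hv', map_zero]
    let p : LinearMap.ker (B y : E →ₗ[ℝ] F) →ₗ[ℝ] LinearMap.ker (B y₀ : E →ₗ[ℝ] F) :=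
      ((P : E →ₗ[ℝ] E).comp (Submodule.subtype _)).codRestrict _ fun v ↦ hBP v
    -- Constant rank enters here: `P` is injective from `ker (B y)` to `ker (B y₀)`, and equal
    -- dimensions make it onto. Hence the range of `L y` is no larger than `ker (B y)`.
    have hp : Function.Surjective p := by
      rw [← LinearMap.injective_iff_surjective_of_finrank_eq_finrank hr,
        injective_iff_map_eq_zero]
      intro v hv
      exact Subtype.ext (hinj v v.2 (congrArg Subtype.val hv))
    have hex : ∀ v, ∃ u, B y u = 0 ∧ P u = P v ∧ L y v = u := fun v ↦ by
      obtain ⟨u, hu⟩ := hp ⟨P v, hBP v⟩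
      have hPu : P u = P v := congrArg Subtype.val hu
      refine ⟨u, u.2, hPu, ?_⟩
      rw [← hLker u u.2]
      change Ring.inverse (S y) (P v) = Ring.inverse (S y) (P u)
      rw [hPu]
    refine ⟨fun v ↦ ?_, hLker, fun v ↦ ?_, fun v ↦ ?_⟩
    · obtain ⟨u, h1, h2, h3⟩ := hex v
      rw [h3, h1]
    · obtain ⟨u, h1, h2, h3⟩ := hex v
      rw [h3, hL0, h2]
    · rw [hL0]
      change Ring.inverse (S y) (P (P v)) = Ring.inverse (S y) (P v)
      rw [hPP]

/-- Near `y₀`, a smooth family of projections with common kernel and involutive ranges satisfies the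
bounds that are required in `PlaqueField`. -/
lemma exists_plaqueField {L : E → E →L[ℝ] E} {y₀ : E} (hL : ContDiffAt ℝ ∞ L y₀) {U : Set E}
    (hU : U ∈ 𝓝 y₀) (h : ∀ᶠ y in 𝓝 y₀, (∀ v, L y₀ (L y v) = L y₀ v) ∧ (∀ v, L y (L y₀ v) = L y v) ∧
      ∀ u v, fderiv ℝ L y (L y u) v = fderiv ℝ L y (L y v) u) :
    ∃ R r K, PlaqueField L (fderiv ℝ L) y₀ R r K ∧ closedBall y₀ R ⊆ U := by
  have hL2 : ContDiffAt ℝ 2 L y₀ := hL.of_le two_le_infty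
  have hdiff : ∀ᶠ y in 𝓝 y₀, DifferentiableAt ℝ L y :=
    (hL2.eventually (by simp)).mono fun y hy ↦ hy.differentiableAt (by simp)
  have hL1 : ContDiffAt ℝ 1 (fderiv ℝ L) y₀ := hL2.fderiv_right (by norm_num)
  obtain ⟨K₁, t, ht, hK₁⟩ := hL1.exists_lipschitzOnWith
  have hb : ∀ᶠ y in 𝓝 y₀, ‖L y‖ < ‖L y₀‖ + 1 :=
    hL.continuousAt.tendsto.norm.eventually_lt_const (lt_add_one _)
  have hb' : ∀ᶠ y in 𝓝 y₀, ‖fderiv ℝ L y‖ < ‖fderiv ℝ L y₀‖ + 1 :=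
    (continuous_norm.tendsto (fderiv ℝ L y₀)).comp hL1.continuousAt.tendsto
      |>.eventually_lt_const (lt_add_one _)
  obtain ⟨R, hR, hRs⟩ := Metric.nhds_basis_closedBall.mem_iff.1
    (inter_mem (inter_mem hU ht) (hdiff.and (hb.and (hb'.and h))))
  let K : ℝ≥0 := max K₁ (max (‖L y₀‖₊ + 1) (‖fderiv ℝ L y₀‖₊ + 1))
  have hK₁K : (K₁ : ℝ) ≤ K := NNReal.coe_le_coe.2 (le_max_left _ _)
  have hK₂ : ‖L y₀‖ + 1 ≤ K :=
    NNReal.coe_le_coe.2 ((le_max_left (‖L y₀‖₊ + 1) _).trans (le_max_right K₁ _))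
  have hK₃ : ‖fderiv ℝ L y₀‖ + 1 ≤ K :=
    NNReal.coe_le_coe.2 ((le_max_right _ (‖fderiv ℝ L y₀‖₊ + 1)).trans (le_max_right K₁ _))
  have hK : 1 ≤ (K : ℝ) := by linarith [norm_nonneg (L y₀)]
  -- With `r = c / (K² + 1)` one has `r ≤ c`, `K² r < c` and `K r ≤ c`, the last because `K ≤ K² +
  -- 1`.
  let c : ℝ := min (R / 4) 1
  have hc : 0 < c := by positivity
  have hKK : (K : ℝ) ≤ K * K + 1 := by nlinarith
  refine ⟨R, c / (K * K + 1), K, ⟨by positivity, ?_, ?_, ?_, ?_, ?_, ?_, ?_, ?_, ?_, ?_⟩,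
    fun y hy ↦ (hRs hy).1.1⟩
  · refine (div_le_self hc.le (by nlinarith)).trans (min_le_left _ _)
  · have h1 : (K : ℝ) * (K * (c / (K * K + 1))) = c * (K * K / (K * K + 1)) := by ring
    rw [h1]
    have h2 : (K : ℝ) * K / (K * K + 1) < 1 := by
      rw [div_lt_one (by positivity)]
      linarith
    calc c * (K * K / (K * K + 1)) < c * 1 := by gcongr
      _ ≤ R / 4 := by rw [mul_one]; exact min_le_left _ _
  · rw [mul_div_assoc', div_le_one (by positivity)]
    have : c ≤ 1 := min_le_right _ _
    nlinarith
  · exact fun y hy ↦ (hRs hy).2.1.hasFDerivAt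
  · exact fun y hy ↦ ((hRs hy).2.2.1.le).trans hK₂
  · exact fun y hy ↦ ((hRs hy).2.2.2.1.le).trans hK₃
  · intro y hy z hz
    exact (hK₁.norm_sub_le (hRs hz).1.2 (hRs hy).1.2).trans (by gcongr)
  · exact fun y hy ↦ (hRs hy).2.2.2.2.1
  · exact fun y hy ↦ (hRs hy).2.2.2.2.2.1
  · exact fun y hy ↦ (hRs hy).2.2.2.2.2.2

/-- Exchanging the arguments of a bilinear form, as a continuous linear map. -/
noncomputable def flipCLM : (E →L[ℝ] E →L[ℝ] ℝ) →L[ℝ] E →L[ℝ] E →L[ℝ] ℝ :=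
  (ContinuousLinearMap.flipₗᵢ ℝ E E ℝ).toContinuousLinearEquiv

/-- The exterior derivative of a one-form on a vector space. -/
noncomputable def formDeriv (b : E → E →L[ℝ] ℝ) (y : E) : E →L[ℝ] E →L[ℝ] ℝ :=
  fderiv ℝ b y - (fderiv ℝ b y).flip

lemma formDeriv_apply (b : E → E →L[ℝ] ℝ) (y u v : E) :
    formDeriv b y u v = fderiv ℝ b y u v - fderiv ℝ b y v u := rfl

lemma formDeriv_self (b : E → E →L[ℝ] ℝ) (y u : E) : formDeriv b y u u = 0 := by
  rw [formDeriv_apply, sub_self]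

lemma formDeriv_swap (b : E → E →L[ℝ] ℝ) (y u v : E) : formDeriv b y u v = -formDeriv b y v u := by
  rw [formDeriv_apply, formDeriv_apply, neg_sub]

lemma contDiffAt_formDeriv {b : E → E →L[ℝ] ℝ} {y : E} (hb : ContDiffAt ℝ ∞ b y) :
    ContDiffAt ℝ ∞ (formDeriv b) y := by
  have h1 : ContDiffAt ℝ ∞ (fderiv ℝ b) y := hb.fderiv_right (by simp)
  have h2 : ContDiffAt ℝ ∞ (fun z ↦ flipCLM (fderiv ℝ b z)) y := by fun_prop
  exact h1.sub h2

/-- The exterior derivative of `formDeriv b` vanishes. -/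
lemma formDeriv_cyclic {b : E → E →L[ℝ] ℝ} {y : E} (hb : ContDiffAt ℝ ∞ b y) (u v w : E) :
    fderiv ℝ (formDeriv b) y u v w + fderiv ℝ (formDeriv b) y v w u +
      fderiv ℝ (formDeriv b) y w u v = 0 := by
  have h1 : ContDiffAt ℝ ∞ (fderiv ℝ b) y := hb.fderiv_right (by simp)
  have hsymm : IsSymmSndFDerivAt ℝ b y := hb.isSymmSndFDerivAt (by
    simpa only [minSmoothness_of_isRCLikeNormedField] using two_le_infty)
  have h2 : HasFDerivAt (fderiv ℝ b) (fderiv ℝ (fderiv ℝ b) y) y :=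
    (h1.differentiableAt (by simp)).hasFDerivAt
  have h3 : ∀ v w, HasFDerivAt (fun z ↦ fderiv ℝ b z v w) _ y := fun v w ↦
    (h2.clm_apply (hasFDerivAt_const v y)).clm_apply (hasFDerivAt_const w y)
  have h4 : ∀ u v w, fderiv ℝ (formDeriv b) y u v w =
      fderiv ℝ (fderiv ℝ b) y u v w - fderiv ℝ (fderiv ℝ b) y u w v := by
    intro u v w
    have h5 := (((contDiffAt_formDeriv hb).differentiableAt (by simp)).hasFDerivAt.clm_apply
      (hasFDerivAt_const v y)).clm_apply (hasFDerivAt_const w y)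
    have h6 := DFunLike.congr_fun (h5.unique ((h3 v w).sub (h3 w v))) u
    simpa using h6
  simp only [h4]
  rw [hsymm.eq u v, hsymm.eq v w, hsymm.eq w u]
  ring

/-- The kernel of `a`, `b` and `d b`, where `a` is closed, is involutive. -/
lemma fderiv_projection_symm {a b : E → E →L[ℝ] ℝ} {L : E → E →L[ℝ] E} {y y₀ : E}
    (ha : ContDiffAt ℝ ∞ a y) (hb : ContDiffAt ℝ ∞ b y) (hda : formDeriv a y = 0)
    (hL : DifferentiableAt ℝ L y)
    (hker : ∀ᶠ z in 𝓝 y, ∀ v, a z (L z v) = 0 ∧ b z (L z v) = 0 ∧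
      ∀ w, formDeriv b z (L z v) w = 0)
    (hproj : ∀ᶠ z in 𝓝 y, ∀ v, L y₀ (L z v) = L y₀ v) (hproj' : ∀ v, L y (L y₀ v) = L y v)
    (hfix : ∀ v, a y v = 0 → b y v = 0 → (∀ w, formDeriv b y v w = 0) → L y v = v) (u v : E) :
    fderiv ℝ L y (L y u) v = fderiv ℝ L y (L y v) u := by
  have hLd : ∀ x, HasFDerivAt (fun z ↦ L z x) ((fderiv ℝ L y).flip x) y := fun x ↦ by
    simpa using hL.hasFDerivAt.clm_apply (hasFDerivAt_const x y)
  have hcov : ∀ {c : E → E →L[ℝ] ℝ}, DifferentiableAt ℝ c y → ∀ x,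
      (∀ᶠ z in 𝓝 y, c z (L z x) = 0) → ∀ w, fderiv ℝ c y w (L y x) + c y (fderiv ℝ L y w x) = 0 := by
    intro c hc x h0 w
    have h1 := hc.hasFDerivAt.clm_apply (hLd x)
    have h2 : HasFDerivAt (fun z ↦ c z (L z x)) (0 : E →L[ℝ] ℝ) y :=
      (hasFDerivAt_const (0 : ℝ) y).congr_of_eventuallyEq h0
    have h3 := DFunLike.congr_fun (h1.unique h2) w
    simp only [_root_.add_apply, ContinuousLinearMap.comp_apply,
      ContinuousLinearMap.flip_apply, _root_.zero_apply] at h3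
    linarith
  have hda' := ha.differentiableAt (by simp)
  have hdb := hb.differentiableAt (by simp)
  have hdω := (contDiffAt_formDeriv hb).differentiableAt (by simp)
  have hω : ∀ x w t, fderiv ℝ (formDeriv b) y t (L y x) w +
      formDeriv b y (fderiv ℝ L y t x) w = 0 := by
    intro x w t
    have h1 : HasFDerivAt (fun z ↦ formDeriv b z (L z x) w) _ y :=
      (hdω.hasFDerivAt.clm_apply (hLd x)).clm_apply (hasFDerivAt_const w y)
    have h2 : HasFDerivAt (fun z ↦ formDeriv b z (L z x) w) (0 : E →L[ℝ] ℝ) y :=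
      (hasFDerivAt_const (0 : ℝ) y).congr_of_eventuallyEq (hker.mono fun z hz ↦ (hz x).2.2 w)
    have h3 := DFunLike.congr_fun (h1.unique h2) t
    simp at h3
    linarith
  have hker' := hker.self_of_nhds
  set X := L y u
  set Y := L y v
  -- The bracket of `z ↦ L z u` and `z ↦ L z v` at `y`. It lies in the common kernel, hence is fixed
  -- by `L y`. It is killed by `L y₀`, because `L y₀ (L z x)` does not depend on `z`. Since `L y = L
  -- y ∘ L y₀`, it is zero.
  set c := fderiv ℝ L y X v - fderiv ℝ L y Y u with hc
  suffices c = 0 from sub_eq_zero.1 this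
  have hac : a y c = 0 := by
    have h1 := hcov hda' v (hker.mono fun z hz ↦ (hz v).1) X
    have h2 := hcov hda' u (hker.mono fun z hz ↦ (hz u).1) Y
    have h3 : formDeriv a y X Y = 0 := by rw [hda]; rfl
    rw [formDeriv_apply] at h3
    rw [hc, map_sub]
    linarith
  have hbc : b y c = 0 := by
    have h1 := hcov hdb v (hker.mono fun z hz ↦ (hz v).2.1) X
    have h2 := hcov hdb u (hker.mono fun z hz ↦ (hz u).2.1) Y
    have h3 : formDeriv b y X Y = 0 := (hker' u).2.2 Y
    rw [formDeriv_apply] at h3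
    rw [hc, map_sub]
    linarith
  -- This combines `d (d b) = 0` on `X, Y, w` with the derivatives of the identities saying that `L
  -- z u` and `L z v` lie in the kernel of `d b`.
  have hωc : ∀ w, formDeriv b y c w = 0 := by
    intro w
    have h1 := hω v w X
    have h2 := hω u w Y
    have h3 := hω u Y w
    have h4 : formDeriv b y (fderiv ℝ L y w u) Y = 0 := by
      rw [formDeriv_swap, (hker' v).2.2, neg_zero]
    have h5 := formDeriv_cyclic hb X Y w
    have h6 : fderiv ℝ (formDeriv b) y Y w X = -fderiv ℝ (formDeriv b) y Y X w := by
      have e1 : HasFDerivAt (fun z ↦ formDeriv b z w X) _ y :=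
        (hdω.hasFDerivAt.clm_apply (hasFDerivAt_const w y)).clm_apply (hasFDerivAt_const X y)
      have e2 : HasFDerivAt (fun z ↦ formDeriv b z X w) _ y :=
        (hdω.hasFDerivAt.clm_apply (hasFDerivAt_const X y)).clm_apply (hasFDerivAt_const w y)
      have e3 : (fun z ↦ formDeriv b z w X) = fun z ↦ -formDeriv b z X w :=
        funext fun z ↦ formDeriv_swap b z w X
      rw [e3] at e1
      have := DFunLike.congr_fun (e1.unique e2.neg) Y
      simpa using this
    rw [hc, map_sub, _root_.sub_apply]
    linarith
  have hPc : L y₀ c = 0 := by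
    have h1 : ∀ x w, L y₀ (fderiv ℝ L y w x) = 0 := by
      intro x w
      have h2 := (L y₀).hasFDerivAt.comp y (hLd x)
      have h3 : HasFDerivAt (L y₀ ∘ fun z ↦ L z x) (0 : E →L[ℝ] E) y :=
        (hasFDerivAt_const (L y₀ x) y).congr_of_eventuallyEq (hproj.mono fun z hz ↦ hz x)
      exact DFunLike.congr_fun (h2.unique h3) w
    rw [hc, map_sub, h1, h1, sub_zero]
  rw [← hfix c hac hbc hωc, ← hproj', hPc, map_zero]

end ConstantRank


/-! ### The local Frobenius theorem. -/

section LocalFrobenius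

open Metric Filter Topology NNReal

variable {E : Type*} [NormedAddCommGroup E] [NormedSpace ℝ E]

/-- The common kernel of the one-forms `a`, `b` and the two-form `d b`. -/
noncomputable def formKer (a b : E → E →L[ℝ] ℝ) (y : E) : Submodule ℝ E :=
  LinearMap.ker (a y : E →ₗ[ℝ] ℝ) ⊓ LinearMap.ker (b y : E →ₗ[ℝ] ℝ) ⊓
    LinearMap.ker (formDeriv b y : E →ₗ[ℝ] E →L[ℝ] ℝ)

lemma mem_formKer {a b : E → E →L[ℝ] ℝ} {y v : E} :
    v ∈ formKer a b y ↔ a y v = 0 ∧ b y v = 0 ∧ ∀ w, formDeriv b y v w = 0 := by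
  simp only [formKer, Submodule.mem_inf, LinearMap.mem_ker, ContinuousLinearMap.coe_coe, and_assoc]
  refine and_congr_right fun _ ↦ and_congr_right fun _ ↦ ?_
  exact ⟨fun h w ↦ by rw [h]; rfl, fun h ↦ ContinuousLinearMap.ext h⟩

/-- A `C¹` curve on `[0, 1]` that is tangent to `D`. -/
def IsTangentCurve (D : E → Submodule ℝ E) (g : ℝ → E) : Prop :=
  ContDiffOn ℝ 1 g (Icc 0 1) ∧ ∀ t ∈ Icc (0 : ℝ) 1, derivWithin g (Icc 0 1) t ∈ D (g t)

lemma IsRadialFlow.isTangentCurve {L : E → E →L[ℝ] E} {x : E} {g : ℝ → E} {D : E → Submodule ℝ E}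
    {s : Set E} (hg : IsRadialFlow L x g) (hs : ∀ t ∈ Icc (0 : ℝ) 1, g t ∈ s) (hL : ContinuousOn L s)
    (hD : ∀ y ∈ s, L y x ∈ D y) : IsTangentCurve D g := by
  have hu : UniqueDiffOn ℝ (Icc (0 : ℝ) 1) := uniqueDiffOn_Icc zero_lt_one
  have hd : ∀ t ∈ Icc (0 : ℝ) 1, derivWithin g (Icc 0 1) t = L (g t) x := fun t ht ↦
    (hg t ht).derivWithin (hu t ht)
  have hgc : ContinuousOn g (Icc 0 1) := fun t ht ↦ (hg t ht).continuousWithinAt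
  refine ⟨?_, fun t ht ↦ by rw [hd t ht]; exact hD _ (hs t ht)⟩
  rw [contDiffOn_one_iff_derivWithin hu]
  refine ⟨fun t ht ↦ (hg t ht).differentiableWithinAt, ContinuousOn.congr ?_ hd⟩
  exact (hL.comp hgc hs).clm_apply continuousOn_const

/-- The local Frobenius theorem for the common kernel of `a`, `b` and `d b`, where `a` is closed: there is
a map `f` near `y₀` whose fibres are the plaques of the distribution. -/
theorem exists_plaqueMap [FiniteDimensional ℝ E] {a b : E → E →L[ℝ] ℝ} {U : Set E} (hU : IsOpen U)
    {y₀ : E} (hy₀ : y₀ ∈ U) (ha : ∀ y ∈ U, ContDiffAt ℝ ∞ a y) (hb : ∀ y ∈ U, ContDiffAt ℝ ∞ b y)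
    (hda : ∀ y ∈ U, formDeriv a y = 0)
    (hrank : ∀ y ∈ U, Module.finrank ℝ (formKer a b y) = Module.finrank ℝ (formKer a b y₀)) :
    ∃ V ⊆ U, IsOpen V ∧ y₀ ∈ V ∧ ∃ f : E → E, (∀ y ∈ V, ContinuousAt f y) ∧
      (∀ (s t : ℝ) (γ γ' : ℝ → E), s ≤ t → (∀ τ ∈ Icc s t, HasDerivWithinAt γ (γ' τ) (Icc s t) τ) →
        (∀ τ ∈ Icc s t, γ τ ∈ V) → (∀ τ ∈ Icc s t, γ' τ ∈ formKer a b (γ τ)) → f (γ t) = f (γ s)) ∧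
      (∀ y ∈ V, ∀ W ∈ 𝓝 y, ∀ᶠ z in 𝓝 y, f z = f y → ∃ g, g 0 = y ∧ g 1 = z ∧
        IsTangentCurve (formKer a b) g ∧ ∀ t ∈ Icc (0 : ℝ) 1, g t ∈ W) ∧
      (∃ f' : E →L[ℝ] E, HasFDerivAt f f' y₀ ∧ ∀ v, f' v = 0 → v ∈ formKer a b y₀) ∧
      (∀ v ∈ formKer a b y₀, ∃ ε : ℝ, 0 < ε ∧ ∃ g, g 0 = y₀ ∧ HasDerivWithinAt g (ε • v) (Icc 0 1) 0 ∧
        IsTangentCurve (formKer a b) g ∧ ∀ t ∈ Icc (0 : ℝ) 1, g t ∈ U) := by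
  have hUn : U ∈ 𝓝 y₀ := hU.mem_nhds hy₀
  -- Like `♭`, this packs three conditions into one linear map: evaluating `B y v` on `v` gives a
  -- sum of two squares. The constant-rank lemma then applies to a single family.
  let B : E → E →L[ℝ] E →L[ℝ] ℝ := fun y ↦
    (a y).smulRight (a y) + formDeriv b y + (b y).smulRight (b y)
  have hBker : ∀ y v, B y v = 0 ↔ v ∈ formKer a b y := by
    intro y v
    rw [mem_formKer]
    have hB : ∀ w, B y v w = a y v * a y w + formDeriv b y v w + b y v * b y w := fun w ↦ by
      simp [B]
    constructor
    · intro h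
      have h1 := hB v
      rw [h, formDeriv_self, _root_.zero_apply] at h1
      have h2 : a y v = 0 := by nlinarith [mul_self_nonneg (a y v), mul_self_nonneg (b y v)]
      have h3 : b y v = 0 := by nlinarith [mul_self_nonneg (a y v), mul_self_nonneg (b y v)]
      refine ⟨h2, h3, fun w ↦ ?_⟩
      have := hB w
      rw [h, h2, h3] at this
      simpa using this.symm
    · rintro ⟨h1, h2, h3⟩
      ext w
      rw [hB, h1, h2, h3]
      simp
  have hBker' : ∀ y, LinearMap.ker (B y : E →ₗ[ℝ] E →L[ℝ] ℝ) = formKer a b y := fun y ↦ by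
    ext v
    exact hBker y v
  have hBs : ContDiffAt ℝ ∞ B y₀ :=
    (((ha y₀ hy₀).smulRight (ha y₀ hy₀)).add (contDiffAt_formDeriv (hb y₀ hy₀))).add
      ((hb y₀ hy₀).smulRight (hb y₀ hy₀))
  obtain ⟨L, hL, hLB⟩ := exists_projections_onto_ker hBs hBs.continuousAt
    (Filter.mem_of_superset hUn fun y hy ↦ by
      change Module.finrank ℝ _ = Module.finrank ℝ _
      rw [hBker', hBker']
      exact hrank y hy)
  have hLd : ∀ᶠ y in 𝓝 y₀, DifferentiableAt ℝ L y :=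
    ((hL.of_le two_le_infty).eventually (by simp)).mono fun y hy ↦ hy.differentiableAt (by simp)
  have hsymm : ∀ᶠ y in 𝓝 y₀, ∀ u v, fderiv ℝ L y (L y u) v = fderiv ℝ L y (L y v) u := by
    filter_upwards [hLB.eventually_nhds, hLd, hUn] with y hy hyd hyU u v
    refine fderiv_projection_symm (ha y hyU) (hb y hyU) (hda y hyU) hyd (y₀ := y₀)
      (hy.mono fun z hz w ↦ mem_formKer.1 ((hBker z _).1 (hz.1 w)))
      (hy.mono fun z hz ↦ hz.2.2.1) hy.self_of_nhds.2.2.2 (fun w h1 h2 h3 ↦ ?_) u v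
    exact hy.self_of_nhds.2.1 w ((hBker y w).2 (mem_formKer.2 ⟨h1, h2, h3⟩))
  obtain ⟨R, r, K, h, hRU⟩ := exists_plaqueField hL (inter_mem hUn hLB)
    (hLB.and hsymm |>.mono fun y hy ↦ ⟨hy.1.2.2.1, hy.1.2.2.2, hy.2⟩)
  obtain ⟨G, hG⟩ := h.exists_plaqueFlow
  have hLmem : ∀ y ∈ closedBall y₀ R, ∀ v, L y v ∈ formKer a b y := fun y hy v ↦
    (hBker y _).1 ((hRU hy).2.1 v)
  have hLfix : ∀ y ∈ closedBall y₀ R, ∀ v ∈ formKer a b y, L y v = v := fun y hy v hv ↦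
    (hRU hy).2.2.1 v ((hBker y v).2 hv)
  have hLc : ContinuousOn L (closedBall y₀ R) := h.lipschitz.continuousOn
  refine ⟨ball y₀ r, fun y hy ↦ (hRU (h.ball_subset hy)).1, isOpen_ball, mem_ball_self h.r_pos,
    fun z ↦ G z 1, fun y hy ↦ h.continuousAt_plaqueMap hG hy, ?_, ?_, ?_, ?_⟩
  · intro s t γ γ' hst hγ hmem htan
    exact h.plaqueMap_eq_of_tangent hG hst hγ hmem fun τ hτ ↦
      hLfix _ (h.ball_subset (hmem τ hτ)) _ (htan τ hτ)
  · intro y hy W hW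
    refine (h.exists_curve_of_plaqueMap_eq hG hy
      (inter_mem hW (isOpen_ball.mem_nhds hy))).mono fun z hz hzy ↦ ?_
    obtain ⟨g, x, hg0, hg1, hg, hgW⟩ := hz hzy
    exact ⟨g, hg0, hg1, hg.isTangentCurve (fun t ht ↦ h.ball_subset (hgW t ht).2) hLc
      (fun y hy ↦ hLmem y hy x), fun t ht ↦ (hgW t ht).1⟩
  · refine ⟨_, h.hasFDerivAt_plaqueMap hG, fun v hv ↦ ?_⟩
    have h1 : v = L y₀ v := by simpa [sub_eq_zero] using hv
    rw [h1]
    exact hLmem y₀ h.center_mem v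
  · intro v hv
    -- The vector is scaled down so that the integral curve survives until time `1`.
    obtain ⟨ε, hε, hεv⟩ : ∃ ε : ℝ, 0 < ε ∧ K * ‖ε • v‖ < R / 4 := by
      have h1 : Tendsto (fun ε : ℝ ↦ (K : ℝ) * ‖ε • v‖) (𝓝[>] 0) (𝓝 0) := by
        have : Continuous fun ε : ℝ ↦ (K : ℝ) * ‖ε • v‖ := by fun_prop
        simpa using (this.tendsto 0).mono_left nhdsWithin_le_nhds
      obtain ⟨ε, h2, h3⟩ := ((h1.eventually_lt_const
        (show (0 : ℝ) < R / 4 by linarith [h.R_pos])).and self_mem_nhdsWithin).exists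
      exact ⟨ε, h3, h2⟩
    obtain ⟨g, hg0, hg, hgR⟩ := h.exists_radialFlow hεv
      (mem_closedBall_self (by linarith [h.R_pos]))
    have hgR' : ∀ t ∈ Icc (0 : ℝ) 1, g t ∈ closedBall y₀ R := fun t ht ↦ by
      rw [mem_closedBall, dist_eq_norm]
      linarith [hgR t ht, h.R_pos]
    refine ⟨ε, hε, g, hg0, ?_, hg.isTangentCurve hgR' hLc (fun y hy ↦ hLmem y hy _),
      fun t ht ↦ (hRU (hgR' t ht)).1⟩
    have := hg 0 (by simp)
    rwa [hg0, hLfix y₀ h.center_mem _ (Submodule.smul_mem _ _ hv)] at this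

end LocalFrobenius

/-! ### One-forms in charts, their pullbacks and exterior derivatives. -/

section Forms

variable {d : ℕ} {M : Type*} [TopologicalSpace M] [ChartedSpace (Model d) M]

/-- The expression of a field of covectors in the preferred chart at `x`. -/
noncomputable def chartRep (α : ∀ x : M, TangentSpace (𝓡 d) x →L[ℝ] ℝ) (x : M) (y : Model d) :
    Model d →L[ℝ] ℝ :=
  (α ((extChartAt (𝓡 d) x).symm y)).comp
    (mfderiv 𝓘(ℝ, Model d) (𝓡 d) (extChartAt (𝓡 d) x).symm y)

variable [IsManifold (𝓡 d) ∞ M]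

lemma inCoordinates_eq_chartRep (α : ∀ x : M, TangentSpace (𝓡 d) x →L[ℝ] ℝ) {x₀ x : M}
    (hx : x ∈ (extChartAt (𝓡 d) x₀).source) :
    ContinuousLinearMap.inCoordinates (Model d) (fun x : M ↦ TangentSpace (𝓡 d) x) ℝ
      (Bundle.Trivial M ℝ) x₀ x x₀ x (α x) = chartRep α x₀ (extChartAt (𝓡 d) x₀ x) := by
  have hx' : x ∈ (chartAt (Model d) x₀).source := by simpa using hx
  rw [ContinuousLinearMap.inCoordinates, TangentBundle.symmL_trivializationAt hx']
  simp only [chartRep]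
  ext v
  simp only [ModelWithCorners.range_eq_univ, mfderivWithin_univ]
  rw [PartialEquiv.left_inv _ hx]
  simp

/-- Turns smoothness of a section of the cotangent bundle into ordinary smoothness in a vector
space. It serves both to use given forms and to construct the reduced ones. -/
theorem contMDiffAt_covectorField_iff (α : ∀ x : M, TangentSpace (𝓡 d) x →L[ℝ] ℝ) (x₀ : M) :
    ContMDiffAt (𝓡 d) ((𝓡 d).prod 𝓘(ℝ, Model d →L[ℝ] ℝ)) ∞
      (fun x ↦ Bundle.TotalSpace.mk' (Model d →L[ℝ] ℝ)
        (E := fun x : M ↦ TangentSpace (𝓡 d) x →L[ℝ] Bundle.Trivial M ℝ x) x (α x)) x₀ ↔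
      ContDiffAt ℝ ∞ (chartRep α x₀) (extChartAt (𝓡 d) x₀ x₀) := by
  rw [contMDiffAt_hom_bundle]
  simp only
  have hid : ContMDiffAt (𝓡 d) (𝓡 d) ∞ (fun x : M ↦ x) x₀ := contMDiffAt_id
  rw [and_iff_right hid, ← contMDiffAt_iff_contDiffAt]
  constructor
  · intro h
    have h1 := ContMDiffAt.comp_of_eq (x := extChartAt (𝓡 d) x₀ x₀) h
      (contMDiffOn_extChartAt_symm (I := 𝓡 d) (n := ∞) x₀ |>.contMDiffAt
        ((isOpen_extChartAt_target x₀).mem_nhds (mem_extChartAt_target x₀))) (extChartAt_to_inv x₀)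
    refine h1.congr_of_eventuallyEq ?_
    filter_upwards [(isOpen_extChartAt_target (I := 𝓡 d) x₀).mem_nhds
      (mem_extChartAt_target x₀)] with y hy
    rw [Function.comp_apply, inCoordinates_eq_chartRep α ((extChartAt (𝓡 d) x₀).map_target hy),
      (extChartAt (𝓡 d) x₀).right_inv hy]
  · intro h
    have h1 := ContMDiffAt.comp x₀ h (contMDiffAt_extChartAt (I := 𝓡 d) (n := ∞))
    refine h1.congr_of_eventuallyEq ?_
    filter_upwards [(isOpen_extChartAt_source (I := 𝓡 d) x₀).mem_nhds
      (mem_extChartAt_source x₀)] with x hx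
    rw [Function.comp_apply, inCoordinates_eq_chartRep α hx]

end Forms
section Forms
variable {E E' : Type*} [NormedAddCommGroup E] [NormedSpace ℝ E] [NormedAddCommGroup E'] [NormedSpace ℝ E']

/-- The term with the second derivative of `G` is symmetric and drops out on antisymmetrizing. -/
theorem formDeriv_pullback {b : E' → E' →L[ℝ] ℝ} {G : E → E'} {y : E}
    (hb : DifferentiableAt ℝ b (G y)) (hG : ContDiffAt ℝ 2 G y) (u v : E) :
    formDeriv (fun y ↦ (b (G y)).comp (fderiv ℝ G y)) y u v =
      formDeriv b (G y) (fderiv ℝ G y u) (fderiv ℝ G y v) := by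
  have hG1 : DifferentiableAt ℝ G y := hG.differentiableAt (by norm_num)
  have hG2 : DifferentiableAt ℝ (fderiv ℝ G) y :=
    (hG.fderiv_right (m := 1) (by norm_num)).differentiableAt (by norm_num)
  have hs := (hG.isSymmSndFDerivAt (by simp)).eq u v
  have key : ∀ u v, fderiv ℝ (fun y ↦ (b (G y)).comp (fderiv ℝ G y)) y u v =
      fderiv ℝ b (G y) (fderiv ℝ G y u) (fderiv ℝ G y v) + b (G y) (fderiv ℝ (fderiv ℝ G) y u v) := by
    intro u v
    have h1 : HasFDerivAt (fun y ↦ b (G y)) ((fderiv ℝ b (G y)).comp (fderiv ℝ G y)) y :=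
      HasFDerivAt.comp y hb.hasFDerivAt hG1.hasFDerivAt
    rw [(h1.clm_comp hG2.hasFDerivAt).fderiv]
    simp [add_comm]
  rw [formDeriv_apply, formDeriv_apply, key, key, hs]
  ring

end Forms
section
variable {E : Type*} [NormedAddCommGroup E] [NormedSpace ℝ E] 
variable {d : ℕ} {M : Type*} [TopologicalSpace M] [ChartedSpace (Model d) M]

/-- The pullback of a field of covectors along a map from a normed space. -/
noncomputable def pullbackForm (α : ∀ x : M, TangentSpace (𝓡 d) x →L[ℝ] ℝ) (F : E → M) (y : E) :
    E →L[ℝ] ℝ :=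
  (α (F y)).comp (mfderiv 𝓘(ℝ, E) (𝓡 d) F y)

lemma mfderiv_eq_fderiv_extChartAt {F : E → M} {y : E} (hF : MDifferentiableAt 𝓘(ℝ, E) (𝓡 d) F y) :
    mfderiv 𝓘(ℝ, E) (𝓡 d) F y = fderiv ℝ (fun z ↦ extChartAt (𝓡 d) (F y) (F z)) y := by
  have h : HasFDerivWithinAt (fun z ↦ extChartAt (𝓡 d) (F y) (F z))
      (show E →L[ℝ] Model d from mfderiv 𝓘(ℝ, E) (𝓡 d) F y) (range 𝓘(ℝ, E)) y := hF.hasMFDerivAt.2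
  rw [ModelWithCorners.range_eq_univ] at h
  exact (h.hasFDerivAt Filter.univ_mem).fderiv.symm

variable [IsManifold (𝓡 d) ∞ M]

/-- The chart stays fixed while the point varies, so the right-hand side can be differentiated
between normed spaces. -/
lemma eventually_pullbackForm_eq (α : ∀ x : M, TangentSpace (𝓡 d) x →L[ℝ] ℝ) {F : E → M} {y : E}
    {x : M} (hF : ContMDiffAt 𝓘(ℝ, E) (𝓡 d) ∞ F y) (hx : F y ∈ (extChartAt (𝓡 d) x).source) :
    pullbackForm α F =ᶠ[nhds y] fun z ↦ (chartRep α x (extChartAt (𝓡 d) x (F z))).comp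
      (fderiv ℝ (fun z ↦ extChartAt (𝓡 d) x (F z)) z) := by
  have h1 := (contMDiffAt_iff_contMDiffAt_nhds (by simp)).mp (hF.of_le (m := 1) (by simp))
  have h2 := hF.continuousAt.preimage_mem_nhds ((isOpen_extChartAt_source (I := 𝓡 d) x).mem_nhds hx)
  filter_upwards [h1, eventually_mem_nhds_iff.mpr h2] with z hz hz'
  have hzs : F z ∈ (extChartAt (𝓡 d) x).source := (mem_of_mem_nhds hz' : z ∈ F ⁻¹' _)
  have hd := hz.mdifferentiableAt (by simp)
  have hφ : MDifferentiableAt (𝓡 d) 𝓘(ℝ, Model d) (extChartAt (𝓡 d) x) (F z) :=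
    mdifferentiableAt_extChartAt (by simpa using hzs)
  have hc := mfderiv_comp z hφ hd
  rw [pullbackForm, chartRep, (extChartAt (𝓡 d) x).left_inv hzs]
  have hi := mfderivWithin_extChartAt_symm_comp_mfderiv_extChartAt' (I := 𝓡 d) hzs
  rw [ModelWithCorners.range_eq_univ, mfderivWithin_univ] at hi
  have hf : fderiv ℝ (fun z ↦ extChartAt (𝓡 d) x (F z)) z =
      mfderiv 𝓘(ℝ, E) 𝓘(ℝ, Model d) (extChartAt (𝓡 d) x ∘ F) z := by
    rw [mfderiv_eq_fderiv]; rfl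
  rw [hf, hc]
  ext v
  exact congrArg (α (F z)) (DFunLike.congr_fun hi (mfderiv 𝓘(ℝ, E) (𝓡 d) F z v)).symm

lemma contDiffAt_extChartAt_comp {F : E → M} {y : E} {x : M}
    (hF : ContMDiffAt 𝓘(ℝ, E) (𝓡 d) ∞ F y) (hx : F y ∈ (extChartAt (𝓡 d) x).source) :
    ContDiffAt ℝ ∞ (fun z ↦ extChartAt (𝓡 d) x (F z)) y := by
  rw [← contMDiffAt_iff_contDiffAt]
  exact (contMDiffAt_extChartAt' (by simpa using hx)).comp y hF

theorem contDiffAt_pullbackForm {α : ∀ x : M, TangentSpace (𝓡 d) x →L[ℝ] ℝ} {F : E → M} {y : E}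
    (hα : ContDiffAt ℝ ∞ (chartRep α (F y)) (extChartAt (𝓡 d) (F y) (F y)))
    (hF : ContMDiffAt 𝓘(ℝ, E) (𝓡 d) ∞ F y) : ContDiffAt ℝ ∞ (pullbackForm α F) y := by
  have hG := contDiffAt_extChartAt_comp hF (mem_extChartAt_source (F y))
  refine ContDiffAt.congr_of_eventuallyEq ?_
    (eventually_pullbackForm_eq α hF (mem_extChartAt_source (F y)))
  exact (hα.comp y hG).clm_comp (hG.fderiv_right (by simp))

theorem formDeriv_pullbackForm {α : ∀ x : M, TangentSpace (𝓡 d) x →L[ℝ] ℝ} {F : E → M} {y : E}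
    (hα : ContDiffAt ℝ ∞ (chartRep α (F y)) (extChartAt (𝓡 d) (F y) (F y)))
    (hF : ContMDiffAt 𝓘(ℝ, E) (𝓡 d) ∞ F y) (u v : E) :
    formDeriv (pullbackForm α F) y u v =
      formDeriv (chartRep α (F y)) (extChartAt (𝓡 d) (F y) (F y))
        (mfderiv 𝓘(ℝ, E) (𝓡 d) F y u) (mfderiv 𝓘(ℝ, E) (𝓡 d) F y v) := by
  have hG := contDiffAt_extChartAt_comp hF (mem_extChartAt_source (F y))
  have h := (eventually_pullbackForm_eq α hF (mem_extChartAt_source (F y))).fderiv_eq (𝕜 := ℝ)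
  have h2 := formDeriv_pullback (G := fun z ↦ extChartAt (𝓡 d) (F y) (F z)) (hα.differentiableAt (by simp)) (hG.of_le two_le_infty) u v
  rw [formDeriv_apply] at h2 ⊢
  rw [h]
  refine h2.trans ?_
  rw [mfderiv_eq_fderiv_extChartAt (hF.mdifferentiableAt (by simp))]
  rfl

lemma OneForm.contDiffAt_chartRep (α : OneForm d M) (x : M) :
    ContDiffAt ℝ ∞ (chartRep α x) (extChartAt (𝓡 d) x x) :=
  (contMDiffAt_covectorField_iff _ x).mp (α.contMDiff x)

lemma OneForm.isAlt_extDeriv (α : OneForm d M) (x : M) : (α.extDeriv x).IsAlt := fun u ↦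
  formDeriv_self (chartRep α x) (extChartAt (𝓡 d) x x) u

theorem OneForm.contDiffAt_pullbackForm (α : OneForm d M) {F : E → M} {y : E}
    (hF : ContMDiffAt 𝓘(ℝ, E) (𝓡 d) ∞ F y) : ContDiffAt ℝ ∞ (pullbackForm α F) y :=
  CocontactGeometry.contDiffAt_pullbackForm (α.contDiffAt_chartRep (F y)) hF

theorem OneForm.formDeriv_pullbackForm (α : OneForm d M) {F : E → M} {y : E}
    (hF : ContMDiffAt 𝓘(ℝ, E) (𝓡 d) ∞ F y) (u v : E) :
    formDeriv (pullbackForm α F) y u v =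
      α.extDeriv (F y) (mfderiv 𝓘(ℝ, E) (𝓡 d) F y u) (mfderiv 𝓘(ℝ, E) (𝓡 d) F y v) :=
  CocontactGeometry.formDeriv_pullbackForm (α.contDiffAt_chartRep (F y)) hF u v

end
-- Normal forms of immersions and submersions.
section NormalForms

variable {d e : ℕ} {M : Type*} [TopologicalSpace M] [ChartedSpace (Model d) M]
  {N : Type*} [TopologicalSpace N] [ChartedSpace (Model e) N]

/-- The normal form provides a map `r` with `r ∘ i` equal to a chart of `N` near `q`, and a chart
has injective differential. -/
theorem mfderiv_injective_of_isImmersion {i : N → M} (hi : IsImmersion (𝓡 e) (𝓡 d) ∞ i) (q : N) :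
    Function.Injective (mfderiv (𝓡 e) (𝓡 d) i q) := by
  have h := hi.isImmersionAt q
  set φ := h.domChart
  set χ := h.codChart
  have hφq : q ∈ φ.source := h.mem_domChart_source
  have hχq : i q ∈ χ.source := h.mem_codChart_source
  have hw : ∀ z ∈ φ.source, χ (i z) = h.equiv (φ z, 0) := by
    intro z hz
    have hm : φ z ∈ (h.domChart.extend (𝓡 e)).target := by
      simpa [φ] using φ.map_source hz
    have := h.writtenInCharts hm
    simpa [φ, φ.left_inv hz] using this
  set r : M → Model e := fun x ↦ (h.equiv.symm (χ x)).1
  have hr : MDifferentiableAt (𝓡 d) 𝓘(ℝ, Model e) r (i q) := by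
    have h1 : ContMDiffAt (𝓡 d) 𝓘(ℝ, Model d) ∞ χ (i q) :=
      contMDiffAt_of_mem_maximalAtlas h.codChart_mem_maximalAtlas hχq
    have h2 : ContDiff ℝ ∞ fun y ↦ (h.equiv.symm y).1 := by fun_prop
    exact ((h2.contMDiff.contMDiffAt (x := χ (i q))).comp (i q) h1).mdifferentiableAt (by simp)
  have hφ : MDifferentiableAt (𝓡 e) 𝓘(ℝ, Model e) φ q :=
    (contMDiffAt_of_mem_maximalAtlas h.domChart_mem_maximalAtlas hφq).mdifferentiableAt (by simp)
  have hφ' : MDifferentiableAt 𝓘(ℝ, Model e) (𝓡 e) φ.symm (φ q) :=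
    (contMDiffAt_symm_of_mem_maximalAtlas h.domChart_mem_maximalAtlas
      (φ.map_source hφq)).mdifferentiableAt (by simp)
  have hri : r ∘ i =ᶠ[nhds q] φ := by
    filter_upwards [φ.open_source.mem_nhds hφq] with z hz
    simp [r, hw z hz]
  have hid : φ.symm ∘ φ =ᶠ[nhds q] id := by
    filter_upwards [φ.open_source.mem_nhds hφq] with z hz
    exact φ.left_inv hz
  have h1 := hri.mfderiv_eq (I := 𝓡 e) (I' := 𝓘(ℝ, Model e))
  have h2 := hid.mfderiv_eq (I := 𝓡 e) (I' := 𝓡 e)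
  rw [mfderiv_comp q hr (hi.contMDiff.contMDiffAt.mdifferentiableAt (by simp))] at h1
  rw [mfderiv_comp q hφ' hφ, mfderiv_id] at h2
  intro u v huv
  have h3 : ∀ u, mfderiv (𝓡 e) 𝓘(ℝ, Model e) φ q u =
      mfderiv (𝓡 d) 𝓘(ℝ, Model e) r (i q) (mfderiv (𝓡 e) (𝓡 d) i q u) :=
    fun u ↦ (DFunLike.congr_fun h1 u).symm
  have h4 : ∀ u, mfderiv 𝓘(ℝ, Model e) (𝓡 e) φ.symm (φ q) (mfderiv (𝓡 e) 𝓘(ℝ, Model e) φ q u) = u :=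
    fun u ↦ DFunLike.congr_fun h2 u
  rw [← h4 u, ← h4 v, h3, h3, huv]

/-- In suitable charts a submersion is a linear projection. -/
theorem exists_charts_of_isSubmersion {π : N → M} (hπ : IsSubmersion (𝓡 e) (𝓡 d) ∞ π) (q : N) :
    ∃ (F : Type) (_ : NormedAddCommGroup F) (_ : NormedSpace ℝ F)
      (χ : OpenPartialHomeomorph N (Model d × F)) (c : OpenPartialHomeomorph M (Model d)),
      q ∈ χ.source ∧ χ.source ⊆ π ⁻¹' c.source ∧
      (∀ z ∈ χ.source, c (π z) = (χ z).1) ∧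
      ContMDiffOn (𝓡 e) 𝓘(ℝ, Model d × F) ∞ χ χ.source ∧
      ContMDiffOn 𝓘(ℝ, Model d × F) (𝓡 e) ∞ χ.symm χ.target ∧
      ContMDiffOn (𝓡 d) 𝓘(ℝ, Model d) ∞ c c.source ∧
      ContMDiffOn 𝓘(ℝ, Model d) (𝓡 d) ∞ c.symm c.target := by
  have h := hπ.isSubmersionAt q
  refine ⟨h.complement, inferInstance, inferInstance,
    h.domChart.trans h.equiv.toHomeomorph.toOpenPartialHomeomorph, h.codChart, ?_, ?_, ?_, ?_, ?_, ?_, ?_⟩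
  · simpa using h.mem_domChart_source
  · simpa using h.source_subset_preimage_source
  · intro z hz
    have hz' : z ∈ h.domChart.source := by simpa using hz
    have hm : h.domChart z ∈ (h.domChart.extend (𝓡 e)).target := by
      simpa using h.domChart.map_source hz'
    have := h.writtenInCharts hm
    simpa [h.domChart.left_inv hz'] using this
  · have h2 : ContDiff ℝ ∞ h.equiv := h.equiv.contDiff
    have h3 := contMDiffOn_of_mem_maximalAtlas h.domChart_mem_maximalAtlas
    simpa using (h2.contMDiff.comp_contMDiffOn h3)
  · have h2 : ContDiff ℝ ∞ h.equiv.symm := h.equiv.symm.contDiff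
    have h3 := contMDiffOn_symm_of_mem_maximalAtlas h.domChart_mem_maximalAtlas
    exact h3.comp h2.contMDiff.contMDiffOn (fun x hx ↦ by simpa using hx)
  · exact contMDiffOn_of_mem_maximalAtlas h.codChart_mem_maximalAtlas
  · exact contMDiffOn_symm_of_mem_maximalAtlas h.codChart_mem_maximalAtlas

end NormalForms
section Submersions

variable {d e : ℕ} {B : Type*} [TopologicalSpace B] [ChartedSpace (Model d) B]
  {N : Type*} [TopologicalSpace N] [ChartedSpace (Model e) N]

/-- In the normal form, the fibre coordinate is frozen at its value at `q`. -/
theorem exists_local_section {π : N → B} (hπ : IsSubmersion (𝓡 e) (𝓡 d) ∞ π) (q : N) :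
    ∃ σ : B → N, σ (π q) = q ∧ (∀ᶠ p in nhds (π q), ContMDiffAt (𝓡 d) (𝓡 e) ∞ σ p) ∧
      ∀ᶠ p in nhds (π q), π (σ p) = p := by
  obtain ⟨F, _, _, χ, c, hq, hχc, hcπ, hχ, hχ', hc, hc'⟩ := exists_charts_of_isSubmersion hπ q
  have hcq : π q ∈ c.source := hχc hq
  have h1 : ContinuousAt (fun p ↦ (c p, (χ q).2)) (π q) :=
    (c.continuousAt hcq).prodMk continuousAt_const
  have h2 : ∀ᶠ p in nhds (π q), (c p, (χ q).2) ∈ χ.target := by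
    refine h1.eventually_mem (χ.open_target.mem_nhds ?_)
    rw [hcπ q hq]
    exact χ.map_source hq
  have h3 := c.open_source.eventually_mem hcq
  refine ⟨fun p ↦ χ.symm (c p, (χ q).2), ?_, ?_, ?_⟩
  · change χ.symm (c (π q), (χ q).2) = q
    rw [hcπ q hq]
    exact χ.left_inv hq
  · filter_upwards [h2, h3] with p hp hp'
    have h4 : ContMDiffAt (𝓡 d) 𝓘(ℝ, Model d × F) ∞ (fun p ↦ (c p, (χ q).2)) p :=
      (hc.contMDiffAt (c.open_source.mem_nhds hp')).prodMk_space contMDiffAt_const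
    exact (hχ'.contMDiffAt (χ.open_target.mem_nhds hp)).comp p h4
  · filter_upwards [h2, h3] with p hp hp'
    refine c.injOn (hχc (χ.map_target hp)) hp' ?_
    rw [hcπ _ (χ.map_target hp), χ.right_inv hp]

/-- The differential of a local section is a right inverse. -/
theorem mfderiv_surjective_of_isSubmersion {π : N → B} (hπ : IsSubmersion (𝓡 e) (𝓡 d) ∞ π)
    (q : N) : Function.Surjective (mfderiv (𝓡 e) (𝓡 d) π q) := by
  obtain ⟨σ, hσq, hσ, hσπ⟩ := exists_local_section hπ q
  have h1 : π ∘ σ =ᶠ[nhds (π q)] id := hσπ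
  have h2 := h1.mfderiv_eq (I := 𝓡 d) (I' := 𝓡 d)
  have hπ' : MDifferentiableAt (𝓡 e) (𝓡 d) π (σ (π q)) :=
    hπ.contMDiff.contMDiffAt.mdifferentiableAt (by simp)
  rw [mfderiv_comp (π q) hπ' (hσ.self_of_nhds.mdifferentiableAt (by simp)), mfderiv_id] at h2
  intro v
  have h3 : ∀ q', q' = q → Function.Surjective (mfderiv (𝓡 e) (𝓡 d) π q') →
      Function.Surjective (mfderiv (𝓡 e) (𝓡 d) π q) := by
    rintro _ rfl h; exact h
  exact h3 _ hσq (fun v ↦ ⟨_, DFunLike.congr_fun h2 v⟩) v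

/-- In the normal form a vertical vector has zero base component, so the straight line in its
direction stays in the fibre. -/
theorem exists_curve_in_fibre {π : N → B} (hπ : IsSubmersion (𝓡 e) (𝓡 d) ∞ π) {q : N}
    {v : TangentSpace (𝓡 e) q} (hv : mfderiv (𝓡 e) (𝓡 d) π q v = 0) :
    ∃ γ : ℝ → N, γ 0 = q ∧ (∀ᶠ s in nhds 0, ContMDiffAt 𝓘(ℝ, ℝ) (𝓡 e) ∞ γ s) ∧
      (∀ᶠ s in nhds 0, π (γ s) = π q) ∧ mfderiv 𝓘(ℝ, ℝ) (𝓡 e) γ 0 (1 : ℝ) = v := by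
  obtain ⟨F, _, _, χ, c, hq, hχc, hcπ, hχ, hχ', hc, hc'⟩ := exists_charts_of_isSubmersion hπ q
  have hcq : π q ∈ c.source := hχc hq
  have hdχ : MDifferentiableAt (𝓡 e) 𝓘(ℝ, Model d × F) χ q :=
    (hχ.contMDiffAt (χ.open_source.mem_nhds hq)).mdifferentiableAt (by simp)
  have hdχ' : MDifferentiableAt 𝓘(ℝ, Model d × F) (𝓡 e) χ.symm (χ q) :=
    (hχ'.contMDiffAt (χ.open_target.mem_nhds (χ.map_source hq))).mdifferentiableAt (by simp)
  have hdc : MDifferentiableAt (𝓡 d) 𝓘(ℝ, Model d) c (π q) :=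
    (hc.contMDiffAt (c.open_source.mem_nhds hcq)).mdifferentiableAt (by simp)
  have hdπ : MDifferentiableAt (𝓡 e) (𝓡 d) π q :=
    hπ.contMDiff.contMDiffAt.mdifferentiableAt (by simp)
  have hfst : MDifferentiableAt 𝓘(ℝ, Model d × F) 𝓘(ℝ, Model d)
      (ContinuousLinearMap.fst ℝ (Model d) F) (χ q) :=
    (ContinuousLinearMap.differentiableAt _).mdifferentiableAt
  have hw : (mfderiv (𝓡 e) 𝓘(ℝ, Model d × F) χ q v : Model d × F).1 = 0 := by
    have h1 : c ∘ π =ᶠ[nhds q] ContinuousLinearMap.fst ℝ (Model d) F ∘ χ := by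
      filter_upwards [χ.open_source.mem_nhds hq] with z hz using hcπ z hz
    have h2 := h1.mfderiv_eq (I := 𝓡 e) (I' := 𝓘(ℝ, Model d))
    rw [mfderiv_comp q hdc hdπ, mfderiv_comp q hfst hdχ, mfderiv_eq_fderiv,
      ContinuousLinearMap.fderiv] at h2
    have h3 := DFunLike.congr_fun h2 v
    have h4 : mfderiv (𝓡 d) 𝓘(ℝ, Model d) c (π q) (mfderiv (𝓡 e) (𝓡 d) π q v) = 0 := by
      rw [hv, map_zero]
    exact h3.symm.trans h4
  set w : Model d × F := mfderiv (𝓡 e) 𝓘(ℝ, Model d × F) χ q v with hwdef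
  have hl : ContDiff ℝ ∞ fun s : ℝ ↦ χ q + s • w := by fun_prop
  have hlt : ∀ᶠ s : ℝ in nhds 0, χ q + s • w ∈ χ.target :=
    hl.continuous.continuousAt.eventually_mem (χ.open_target.mem_nhds (by simpa using χ.map_source hq))
  have hl' : HasMFDerivAt 𝓘(ℝ, ℝ) 𝓘(ℝ, Model d × F) (fun s : ℝ ↦ χ q + s • w) 0
      (ContinuousLinearMap.toSpanSingleton ℝ w) := by
    have : HasDerivAt (fun s : ℝ ↦ χ q + s • w) w 0 := by
      simpa using ((hasDerivAt_id (0 : ℝ)).smul_const w).const_add (χ q)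
    exact this.hasFDerivAt.hasMFDerivAt
  refine ⟨fun s ↦ χ.symm (χ q + s • w), ?_, ?_, ?_, ?_⟩
  · simpa using χ.left_inv hq
  · filter_upwards [hlt] with s hs
    exact (hχ'.contMDiffAt (χ.open_target.mem_nhds hs)).comp s hl.contMDiff.contMDiffAt
  · filter_upwards [hlt] with s hs
    refine c.injOn (hχc (χ.map_target hs)) hcq ?_
    rw [hcπ _ (χ.map_target hs), χ.right_inv hs, hcπ q hq]
    simp [hw]
  · have h0 : χ q + (0 : ℝ) • w = χ q := by simp
    have hd : HasMFDerivAt 𝓘(ℝ, Model d × F) (𝓡 e) χ.symm (χ q + (0 : ℝ) • w)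
        (mfderiv 𝓘(ℝ, Model d × F) (𝓡 e) χ.symm (χ q + (0 : ℝ) • w)) := by
      rw [h0]; exact hdχ'.hasMFDerivAt
    have h1 := (hd.comp (0 : ℝ) hl').mfderiv
    have hid : χ.symm ∘ χ =ᶠ[nhds q] id := by
      filter_upwards [χ.open_source.mem_nhds hq] with z hz using χ.left_inv hz
    have h2 := hid.mfderiv_eq (I := 𝓡 e) (I' := 𝓡 e)
    rw [mfderiv_comp q hdχ' hdχ, mfderiv_id] at h2
    have h3 : mfderiv 𝓘(ℝ, Model d × F) (𝓡 e) χ.symm (χ q) w = v := DFunLike.congr_fun h2 v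
    have h4 := DFunLike.congr_fun h1 (1 : ℝ)
    refine h4.trans ?_
    rw [← h3]
    change mfderiv 𝓘(ℝ, Model d × F) (𝓡 e) χ.symm (χ q + (0 : ℝ) • w) ((1 : ℝ) • w) = _
    rw [one_smul, h0]

end Submersions
-- Descent of basic one-forms along a submersion.
section Basic

/-- A one-form that annihilates the second factor, together with its derivative, does not depend on
the second factor. -/
theorem eq_of_basic {X F : Type*} [NormedAddCommGroup X] [NormedSpace ℝ X] [NormedAddCommGroup F]
    [NormedSpace ℝ F] {a : X × F → X × F →L[ℝ] ℝ} {y₀ : X × F} {r : ℝ}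
    (ha : ∀ y ∈ Metric.ball y₀ r, DifferentiableAt ℝ a y)
    (h0 : ∀ y ∈ Metric.ball y₀ r, ∀ w, a y (0, w) = 0)
    (h1 : ∀ y ∈ Metric.ball y₀ r, ∀ w u, formDeriv a y (0, w) u = 0)
    {y : X × F} (hy : y ∈ Metric.ball y₀ r) (hfst : y.1 = y₀.1) : a y = a y₀ := by
  have hr : 0 < r := Metric.pos_of_mem_ball hy
  have hmem : ∀ z ∈ Metric.ball y₀.2 r, (y₀.1, z) ∈ Metric.ball y₀ r := by
    intro z hz
    rw [← ball_prod_same y₀.1 y₀.2]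
    exact ⟨Metric.mem_ball_self hr, hz⟩
  have hd : ∀ z ∈ Metric.ball y₀.2 r,
      HasFDerivAt (fun z ↦ a (y₀.1, z)) (0 : F →L[ℝ] X × F →L[ℝ] ℝ) z := by
    intro z hz
    have h2 := (ha _ (hmem z hz)).hasFDerivAt.comp z (hasFDerivAt_prodMk_right y₀.1 z)
    suffices hz0 : (fderiv ℝ a (y₀.1, z)).comp (ContinuousLinearMap.inr ℝ X F) = 0 by
      rwa [hz0] at h2
    refine ContinuousLinearMap.ext fun w ↦ ContinuousLinearMap.ext fun u ↦ ?_
    have h3 := h1 _ (hmem z hz) w u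
    -- Differentiating `a (0, w) = 0` kills one half of the exterior derivative. The other half is
    -- the derivative of `a` along the fibre.
    have h4 : fderiv ℝ a (y₀.1, z) u (0, w) = 0 := by
      have h5 : (fun y ↦ a y (0, w)) =ᶠ[nhds (y₀.1, z)] fun _ ↦ 0 := by
        filter_upwards [Metric.isOpen_ball.mem_nhds (hmem z hz)] with y hy using h0 y hy w
      have h6 := h5.fderiv_eq (𝕜 := ℝ)
      rw [fderiv_clm_apply (ha _ (hmem z hz)) (differentiableAt_const _)] at h6
      simpa using DFunLike.congr_fun h6 u
    rw [formDeriv_apply, h4, sub_zero] at h3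
    exact h3
  have hc := (convex_ball y₀.2 r).is_const_of_fderivWithin_eq_zero (𝕜 := ℝ)
    (f := fun z ↦ a (y₀.1, z)) (fun z hz ↦ (hd z hz).differentiableAt.differentiableWithinAt)
    (fun z hz ↦ ?_) (x := y.2) (y := y₀.2) ?_ (Metric.mem_ball_self hr)
  · have h2 : y = (y₀.1, y.2) := by rw [← hfst]
    rw [h2]; exact hc
  · rw [fderivWithin_of_isOpen Metric.isOpen_ball hz]
    exact (hd z hz).fderiv
  · rw [← ball_prod_same y₀.1 y₀.2] at hy
    exact hy.2

variable {m d e : ℕ} {M : Type*} [TopologicalSpace M] [ChartedSpace (Model m) M]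
  [IsManifold (𝓡 m) ∞ M] {B : Type*} [TopologicalSpace B] [ChartedSpace (Model d) B]
  {N : Type*} [TopologicalSpace N] [ChartedSpace (Model e) N]

/-- A form on `N` that is basic for a submersion descends, locally along each fibre. -/
theorem eventually_descends (α : OneForm m M) {i : N → M} (hi : ContMDiff (𝓡 e) (𝓡 m) ∞ i)
    {π : N → B} (hπ : IsSubmersion (𝓡 e) (𝓡 d) ∞ π)
    (h0 : ∀ q v, mfderiv (𝓡 e) (𝓡 d) π q v = 0 → α (i q) (mfderiv (𝓡 e) (𝓡 m) i q v) = (0 : ℝ))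
    (h1 : ∀ q v, mfderiv (𝓡 e) (𝓡 d) π q v = 0 → ∀ w,
      α.extDeriv (i q) (mfderiv (𝓡 e) (𝓡 m) i q v) (mfderiv (𝓡 e) (𝓡 m) i q w) = 0) (q : N) :
    ∃ β : Model d →L[ℝ] ℝ, ∀ᶠ z in nhds q, π z = π q → ∀ v : TangentSpace (𝓡 e) z,
      α.pullback e i z v = β (mfderiv (𝓡 e) (𝓡 d) π z v) := by
  obtain ⟨F, _, _, χ, c, hq, hχc, hcπ, hχ, hχ', hc, hc'⟩ := exists_charts_of_isSubmersion hπ q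
  obtain ⟨r, hr, hball⟩ := Metric.isOpen_iff.mp χ.open_target _ (χ.map_source hq)
  set a : Model d × F → Model d × F →L[ℝ] ℝ := pullbackForm α (i ∘ χ.symm) with hadef
  have hχs : ∀ y ∈ χ.target, ContMDiffAt 𝓘(ℝ, Model d × F) (𝓡 e) ∞ χ.symm y := fun y hy ↦
    hχ'.contMDiffAt (χ.open_target.mem_nhds hy)
  have hiχ : ∀ y ∈ χ.target, ContMDiffAt 𝓘(ℝ, Model d × F) (𝓡 m) ∞ (i ∘ χ.symm) y := fun y hy ↦
    hi.contMDiffAt.comp y (hχs y hy)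
  have hdi : ∀ y ∈ χ.target, ∀ u : Model d × F, mfderiv 𝓘(ℝ, Model d × F) (𝓡 m) (i ∘ χ.symm) y u =
      mfderiv (𝓡 e) (𝓡 m) i (χ.symm y) (mfderiv 𝓘(ℝ, Model d × F) (𝓡 e) χ.symm y u) := by
    intro y hy u
    rw [mfderiv_comp y (hi.contMDiffAt.mdifferentiableAt (by simp))
      ((hχs y hy).mdifferentiableAt (by simp))]
    rfl
  have hdχ : ∀ z ∈ χ.source, MDifferentiableAt (𝓡 e) 𝓘(ℝ, Model d × F) χ z := fun z hz ↦
    (hχ.contMDiffAt (χ.open_source.mem_nhds hz)).mdifferentiableAt (by simp)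
  have hdc : ∀ z ∈ χ.source, ∀ v : TangentSpace (𝓡 e) z,
      (mfderiv (𝓡 d) 𝓘(ℝ, Model d) c (π z) (mfderiv (𝓡 e) (𝓡 d) π z v) : Model d) =
        (mfderiv (𝓡 e) 𝓘(ℝ, Model d × F) χ z v : Model d × F).1 := by
    intro z hz v
    have hcz : π z ∈ c.source := hχc hz
    have h1 : c ∘ π =ᶠ[nhds z] ContinuousLinearMap.fst ℝ (Model d) F ∘ χ := by
      filter_upwards [χ.open_source.mem_nhds hz] with z hz using hcπ z hz
    have h2 := h1.mfderiv_eq (I := 𝓡 e) (I' := 𝓘(ℝ, Model d))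
    rw [mfderiv_comp z ((hc.contMDiffAt (c.open_source.mem_nhds hcz)).mdifferentiableAt (by simp))
      (hπ.contMDiff.contMDiffAt.mdifferentiableAt (by simp)),
      mfderiv_comp z (ContinuousLinearMap.differentiableAt _).mdifferentiableAt (hdχ z hz),
      mfderiv_eq_fderiv, ContinuousLinearMap.fderiv] at h2
    exact DFunLike.congr_fun h2 v
  have hker : ∀ y ∈ χ.target, ∀ w : F, mfderiv (𝓡 e) (𝓡 d) π (χ.symm y)
      (mfderiv 𝓘(ℝ, Model d × F) (𝓡 e) χ.symm y ((0, w) : Model d × F)) = 0 := by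
    intro y hy w
    have hcy : y.1 ∈ c.target := by
      have := c.map_source (hχc (χ.map_target hy))
      rwa [hcπ _ (χ.map_target hy), χ.right_inv hy] at this
    have h1 : π ∘ χ.symm =ᶠ[nhds y] c.symm ∘ ContinuousLinearMap.fst ℝ (Model d) F := by
      filter_upwards [χ.open_target.mem_nhds hy] with z hz
      have h2 := hcπ _ (χ.map_target hz)
      rw [χ.right_inv hz] at h2
      change π (χ.symm z) = c.symm z.1
      rw [← h2, c.left_inv (hχc (χ.map_target hz))]
    have h2 := h1.mfderiv_eq (I := 𝓘(ℝ, Model d × F)) (I' := 𝓡 d)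
    rw [mfderiv_comp y (hπ.contMDiff.contMDiffAt.mdifferentiableAt (by simp))
      ((hχs y hy).mdifferentiableAt (by simp))] at h2
    have hcs : MDifferentiableAt 𝓘(ℝ, Model d) (𝓡 d) c.symm
        (ContinuousLinearMap.fst ℝ (Model d) F y) :=
      (hc'.contMDiffAt (c.open_target.mem_nhds hcy)).mdifferentiableAt (by simp)
    have hfst : HasMFDerivAt 𝓘(ℝ, Model d × F) 𝓘(ℝ, Model d) (ContinuousLinearMap.fst ℝ (Model d) F)
        y (ContinuousLinearMap.fst ℝ (Model d) F) :=
      (ContinuousLinearMap.hasFDerivAt _).hasMFDerivAt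
    have h3 := (hcs.hasMFDerivAt.comp y hfst).mfderiv
    exact ((DFunLike.congr_fun h2 ((0, w) : Model d × F)).trans
      (DFunLike.congr_fun h3 ((0, w) : Model d × F))).trans
      (map_zero (mfderiv 𝓘(ℝ, Model d) (𝓡 d) c.symm (ContinuousLinearMap.fst ℝ (Model d) F y)))
  have ha : ∀ y ∈ χ.target, ∀ w : F, a y (0, w) = 0 := by
    intro y hy w
    have h2 := h0 _ _ (hker y hy w)
    rw [← hdi y hy] at h2
    exact h2
  have ha' : ∀ y ∈ χ.target, ∀ (w : F) (u : Model d × F), formDeriv a y (0, w) u = 0 := by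
    intro y hy w u
    rw [hadef, α.formDeriv_pullbackForm (hiχ y hy), hdi y hy, hdi y hy]
    exact h1 _ _ (hker y hy w) _
  have hpb : ∀ z ∈ χ.source, ∀ v : TangentSpace (𝓡 e) z,
      α.pullback e i z v = a (χ z) (mfderiv (𝓡 e) 𝓘(ℝ, Model d × F) χ z v) := by
    intro z hz v
    have h2 : (i ∘ χ.symm) ∘ χ =ᶠ[nhds z] i := by
      filter_upwards [χ.open_source.mem_nhds hz] with z hz
      simp [χ.left_inv hz]
    have h3 := h2.mfderiv_eq (I := 𝓡 e) (I' := 𝓡 m)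
    rw [mfderiv_comp z ((hiχ _ (χ.map_source hz)).mdifferentiableAt (by simp)) (hdχ z hz)] at h3
    have h4 : ∀ x : M, x = i z → ∀ u : Model m,
        (α x : TangentSpace (𝓡 m) x →L[ℝ] ℝ) u = (α (i z) : TangentSpace (𝓡 m) (i z) →L[ℝ] ℝ) u := by
      rintro _ rfl u; rfl
    have h5 := h4 ((i ∘ χ.symm) (χ z)) (congrArg i (χ.left_inv hz))
      (mfderiv 𝓘(ℝ, Model d × F) (𝓡 m) (i ∘ χ.symm) (χ z) (mfderiv (𝓡 e) 𝓘(ℝ, Model d × F) χ z v))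
    exact ((h5.trans (congrArg (α (i z)) (DFunLike.congr_fun h3 v)))).symm
  let Dc : B → Model d →L[ℝ] Model d := fun p ↦ mfderiv (𝓡 d) 𝓘(ℝ, Model d) c p
  -- The covector is read off at `q` and serves for nearby points of the same fibre. Independence of
  -- `q` on the whole fibre needs connectedness and comes later.
  refine ⟨((a (χ q)).comp (ContinuousLinearMap.inl ℝ (Model d) F)).comp (Dc (π q)), ?_⟩
  filter_upwards [χ.open_source.mem_nhds hq, (χ.continuousAt hq).preimage_mem_nhds
    (Metric.ball_mem_nhds (χ q) hr)] with z hz hzr hzq v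
  have hfst : (χ z).1 = (χ q).1 := by rw [← hcπ z hz, ← hcπ q hq, hzq]
  have h2 : a (χ z) = a (χ q) := eq_of_basic
    (fun y hy ↦ (α.contDiffAt_pullbackForm (hiχ y (hball hy))).differentiableAt (by simp))
    (fun y hy ↦ ha y (hball hy)) (fun y hy ↦ ha' y (hball hy)) hzr hfst
  rw [hpb z hz, h2]
  set w : Model d × F := mfderiv (𝓡 e) 𝓘(ℝ, Model d × F) χ z v with hw
  have h3 : w = ContinuousLinearMap.inl ℝ (Model d) F w.1 + (0, w.2) := by ext <;> simp
  have h4 : a (χ q) w = a (χ q) (ContinuousLinearMap.inl ℝ (Model d) F w.1) := by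
    conv_lhs => rw [h3]
    rw [map_add, ha _ (χ.map_source hq), add_zero]
  refine h4.trans ?_
  rw [← hdc z hz v, ← hzq]
  rfl

end Basic
section Descent

/-- `q` and `q'` are joined by a path inside a fibre of `π`. -/
def JoinedInFibre {N B : Type*} [TopologicalSpace N] (π : N → B) (q q' : N) : Prop :=
  ∃ γ : ℝ → N, γ 0 = q ∧ γ 1 = q' ∧ ContinuousOn γ (Icc 0 1) ∧ ∀ t ∈ Icc (0 : ℝ) 1, π (γ t) = π q

/-- Along a path in a fibre `τ` is locally constant, and `[0, 1]` is connected. -/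
lemma eq_of_eqvGen_joinedInFibre {N B Y : Type*} [TopologicalSpace N] {π : N → B} {τ : N → Y}
    (hτ : ∀ q, ∀ᶠ z in nhds q, π z = π q → τ z = τ q) {q q' : N}
    (h : Relation.EqvGen (JoinedInFibre π) q q') : τ q = τ q' := by
  induction h with
  | refl => rfl
  | symm _ _ _ ih => exact ih.symm
  | trans _ _ _ _ _ ih₁ ih₂ => exact ih₁.trans ih₂
  | rel q q' h =>
    obtain ⟨γ, rfl, rfl, hγ, hπγ⟩ := h
    refine (isPreconnected_Icc (a := (0 : ℝ)) (b := 1)).induction₂'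
      (fun s t ↦ τ (γ s) = τ (γ t)) (fun t ht ↦ ?_) (fun _ _ _ _ _ _ h₁ h₂ ↦ h₁.trans h₂)
      (by simp) (by simp)
    filter_upwards [(hγ t ht).eventually (hτ (γ t)), self_mem_nhdsWithin] with s hs hs'
    have := hs ((hπγ s hs').trans (hπγ t ht).symm)
    exact ⟨this.symm, this⟩

variable {m d e : ℕ} {M : Type*} [TopologicalSpace M] [ChartedSpace (Model m) M]
  [IsManifold (𝓡 m) ∞ M] {B : Type*} [TopologicalSpace B] [ChartedSpace (Model d) B]
  {N : Type*} [TopologicalSpace N] [ChartedSpace (Model e) N]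

variable [IsManifold (𝓡 d) ∞ B]

/-- A basic form descends along a surjective submersion with path connected fibres. -/
theorem exists_oneForm_pullback_eq (α : OneForm m M) {i : N → M}
    (hi : ContMDiff (𝓡 e) (𝓡 m) ∞ i) {π : N → B} (hπ : IsSubmersion (𝓡 e) (𝓡 d) ∞ π)
    (hsurj : Function.Surjective π)
    (hfib : ∀ q q', π q = π q' → Relation.EqvGen (JoinedInFibre π) q q')
    (h0 : ∀ q v, mfderiv (𝓡 e) (𝓡 d) π q v = 0 → α (i q) (mfderiv (𝓡 e) (𝓡 m) i q v) = (0 : ℝ))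
    (h1 : ∀ q v, mfderiv (𝓡 e) (𝓡 d) π q v = 0 → ∀ w,
      α.extDeriv (i q) (mfderiv (𝓡 e) (𝓡 m) i q v) (mfderiv (𝓡 e) (𝓡 m) i q w) = 0) :
    ∃ β : OneForm d B, ∀ q, α.pullback e i q = β.pullback e π q := by
  choose τ hτ using eventually_descends α hi hπ h0 h1
  have hτ0 : ∀ (q : N) (v : TangentSpace (𝓡 e) q), α.pullback e i q v =
      τ q (mfderiv (𝓡 e) (𝓡 d) π q v) := fun q v ↦ (hτ q).self_of_nhds rfl v
  have hloc : ∀ q, ∀ᶠ z in nhds q, π z = π q → τ z = τ q := by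
    intro q
    filter_upwards [hτ q] with z hz hzq
    refine ContinuousLinearMap.ext fun u ↦ ?_
    obtain ⟨v, hv⟩ := mfderiv_surjective_of_isSubmersion hπ z u
    have := (hτ0 z v).symm.trans (hz hzq v)
    rwa [hv] at this
  have heq : ∀ q q', π q = π q' → τ q = τ q' := fun q q' h ↦
    eq_of_eqvGen_joinedInFibre hloc (hfib q q' h)
  -- An arbitrary set-theoretic section suffices, since `τ` is constant on fibres. Smoothness comes
  -- from smooth local sections `σ`, for which the form is locally `(i ∘ σ)^* α`.
  let s := Function.surjInv hsurj
  have hs : ∀ p, π (s p) = p := Function.surjInv_eq hsurj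
  let β : ∀ p : B, TangentSpace (𝓡 d) p →L[ℝ] ℝ := fun p ↦ τ (s p)
  have hβ : ∀ q, ∀ u : Model d, β (π q) u = τ q u := fun q u ↦ by
    change τ (s (π q)) u = τ q u
    rw [heq _ q (hs (π q))]
  have hsmooth : ∀ p₀, ContDiffAt ℝ ∞ (chartRep β p₀) (extChartAt (𝓡 d) p₀ p₀) := by
    intro p₀
    obtain ⟨q₀, rfl⟩ := hsurj p₀
    obtain ⟨σ, hσq, hσ, hσπ⟩ := exists_local_section hπ q₀
    set φ := extChartAt (𝓡 d) (π q₀)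
    have hφ : Filter.Tendsto φ.symm (nhds (φ (π q₀))) (nhds (π q₀)) := by
      have := continuousAt_extChartAt_symm (I := 𝓡 d) (π q₀)
      rwa [ContinuousAt, extChartAt_to_inv] at this
    have hφs : ∀ᶠ y in nhds (φ (π q₀)), ContMDiffAt 𝓘(ℝ, Model d) (𝓡 d) ∞ φ.symm y := by
      filter_upwards [(isOpen_extChartAt_target (I := 𝓡 d) (π q₀)).mem_nhds
        (mem_extChartAt_target (π q₀))] with y hy
      exact (contMDiffOn_extChartAt_symm (π q₀)).contMDiffAt
        ((isOpen_extChartAt_target (π q₀)).mem_nhds hy)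
    have hF : ∀ᶠ y in nhds (φ (π q₀)),
        ContMDiffAt 𝓘(ℝ, Model d) (𝓡 m) ∞ (i ∘ σ ∘ φ.symm) y := by
      filter_upwards [hφs, hφ.eventually hσ] with y hy hy'
      exact hi.contMDiffAt.comp y (hy'.comp y hy)
    refine (α.contDiffAt_pullbackForm hF.self_of_nhds).congr_of_eventuallyEq ?_
    filter_upwards [hφs, hφ.eventually hσ, hφ.eventually hσπ.eventually_nhds] with y hy hy' hy''
    refine ContinuousLinearMap.ext fun u ↦ ?_
    set p := φ.symm y
    set w : TangentSpace (𝓡 d) p := mfderiv 𝓘(ℝ, Model d) (𝓡 d) φ.symm y u with hw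
    have hd1 : MDifferentiableAt (𝓡 d) (𝓡 e) σ p := hy'.mdifferentiableAt (by simp)
    have hd2 : MDifferentiableAt (𝓡 e) (𝓡 m) i (σ p) := hi.contMDiffAt.mdifferentiableAt (by simp)
    have hd3 : MDifferentiableAt 𝓘(ℝ, Model d) (𝓡 d) φ.symm y := hy.mdifferentiableAt (by simp)
    have h3 : mfderiv 𝓘(ℝ, Model d) (𝓡 m) (i ∘ σ ∘ φ.symm) y u =
        mfderiv (𝓡 e) (𝓡 m) i (σ p) (mfderiv (𝓡 d) (𝓡 e) σ p w) :=
      DFunLike.congr_fun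
        (hd2.hasMFDerivAt.comp y (hd1.hasMFDerivAt.comp y hd3.hasMFDerivAt)).mfderiv u
    have h4 : (mfderiv (𝓡 e) (𝓡 d) π (σ p) (mfderiv (𝓡 d) (𝓡 e) σ p w) : Model d) = w := by
      have h5 : π ∘ σ =ᶠ[nhds p] id := hy''
      have h6 := h5.mfderiv_eq (I := 𝓡 d) (I' := 𝓡 d)
      rw [mfderiv_comp p (hπ.contMDiff.contMDiffAt.mdifferentiableAt (by simp)) hd1,
        mfderiv_id] at h6
      exact DFunLike.congr_fun h6 w
    have h7 := hτ0 (σ p) (mfderiv (𝓡 d) (𝓡 e) σ p w)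
    have h8 : π (σ p) = p := hy''.self_of_nhds
    change τ (s p) w = α (i (σ p)) (mfderiv 𝓘(ℝ, Model d) (𝓡 m) (i ∘ σ ∘ φ.symm) y u)
    rw [h3, heq (s p) (σ p) ((hs p).trans h8.symm)]
    refine Eq.trans ?_ h7.symm
    exact congrArg (τ (σ p)) h4.symm
  refine ⟨⟨β, fun p ↦ (contMDiffAt_covectorField_iff β p).mpr (hsmooth p)⟩, fun q ↦ ?_⟩
  ext v
  rw [hτ0]
  exact (hβ q _).symm

theorem oneForm_eq_of_pullback_eq {π : N → B} (hπ : IsSubmersion (𝓡 e) (𝓡 d) ∞ π)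
    (hsurj : Function.Surjective π) {β β' : OneForm d B}
    (h : ∀ q, β.pullback e π q = β'.pullback e π q) : β = β' := by
  ext p u
  obtain ⟨q, rfl⟩ := hsurj p
  obtain ⟨v, rfl⟩ := mfderiv_surjective_of_isSubmersion hπ q u
  exact DFunLike.congr_fun (h q) v

end Descent
-- Leaves as countable unions of plaques.
section Leaves

open scoped Topology

/-- Two points lie in a common plaque belonging to the family `S`. -/
def PlaqueRel {N Y : Type*} [TopologicalSpace N] (V : N → Set N) (f : N → N → Y) (S : Set N) (z z' : N) : Prop :=
  ∃ j ∈ S, z ∈ interior (V j) ∧ z' ∈ interior (V j) ∧ f j z = f j z'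

lemma PlaqueRel.symm {N Y : Type*} [TopologicalSpace N] {V : N → Set N} {f : N → N → Y}
    {S : Set N} {z z' : N} (h : PlaqueRel V f S z z') : PlaqueRel V f S z' z := by
  obtain ⟨j, hj, hz, hz', hf⟩ := h
  exact ⟨j, hj, hz', hz, hf.symm⟩

variable {e : ℕ} {N : Type*} [TopologicalSpace N] [ChartedSpace (Model e) N]

/-- A `C¹` curve in `N`, parametrized by `[0, 1]` and everywhere tangent to `D`. -/
def IsTangentPath (D : ∀ q : N, Submodule ℝ (TangentSpace (𝓡 e) q)) (γ : ℝ → N) : Prop :=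
  ContMDiffOn 𝓘(ℝ, ℝ) (𝓡 e) 1 γ (Icc 0 1) ∧ ∀ t ∈ Icc (0 : ℝ) 1,
    (mfderivWithin 𝓘(ℝ, ℝ) (𝓡 e) γ (Icc 0 1) t : ℝ →L[ℝ] TangentSpace (𝓡 e) (γ t)) 1 ∈ D (γ t)

/-- `f` is, near `q₀`, a map whose level sets in `V` are the plaques of the foliation tangent to
`D`. -/
structure IsPlaqueMap (D : ∀ q : N, Submodule ℝ (TangentSpace (𝓡 e) q)) (q₀ : N) (V : Set N)
    (f : N → Model e) : Prop where
  mem_nhds : V ∈ 𝓝 q₀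
  continuousAt : ∀ q ∈ V, ContinuousAt f q
  eq_of_path : ∀ γ, IsTangentPath D γ → ∀ s ∈ Icc (0 : ℝ) 1, ∀ t ∈ Icc (0 : ℝ) 1, s ≤ t →
    (∀ τ ∈ Icc s t, γ τ ∈ V) → f (γ s) = f (γ t)
  exists_path : ∀ q ∈ V, ∀ W ∈ 𝓝 q, ∀ᶠ z in 𝓝 q, f z = f q → ∃ γ, γ 0 = q ∧ γ 1 = z ∧
    IsTangentPath D γ ∧ ∀ t ∈ Icc (0 : ℝ) 1, γ t ∈ W
  ker_le : ∃ f' : TangentSpace (𝓡 e) q₀ →L[ℝ] Model e,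
    HasMFDerivAt (𝓡 e) 𝓘(ℝ, Model e) f q₀ f' ∧ ∀ v, f' v = 0 → v ∈ D q₀
  exists_path_of_mem : ∀ v ∈ D q₀, ∃ ε : ℝ, 0 < ε ∧ ∃ γ, IsTangentPath D γ ∧ ∃ h : γ 0 = q₀,
    mfderivWithin 𝓘(ℝ, ℝ) (𝓡 e) γ (Icc 0 1) 0 (1 : ℝ) = h ▸ (ε • v)

/-- `eq_of_path` needs the whole parameter segment between the two times to map into `V`; a ball of
parameters guarantees this. -/
lemma IsPlaqueMap.eventually_eq_along {D : ∀ q : N, Submodule ℝ (TangentSpace (𝓡 e) q)} {q₀ : N}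
    {V : Set N} {f : N → Model e} (h : IsPlaqueMap D q₀ V f) {γ : ℝ → N} (hγ : IsTangentPath D γ)
    {t : ℝ} (ht : t ∈ Icc (0 : ℝ) 1) (htV : γ t ∈ interior V) :
    ∀ᶠ s in 𝓝[Icc 0 1] t, γ s ∈ interior V ∧ f (γ t) = f (γ s) := by
  have h1 : ∀ᶠ s in 𝓝[Icc 0 1] t, γ s ∈ interior V :=
    (hγ.1.continuousOn t ht).eventually (isOpen_interior.eventually_mem htV)
  rw [eventually_nhdsWithin_iff, Metric.eventually_nhds_iff_ball] at h1
  obtain ⟨r, hr, hball⟩ := h1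
  filter_upwards [mem_nhdsWithin_of_mem_nhds (Metric.ball_mem_nhds t hr), self_mem_nhdsWithin]
    with s hs hs'
  refine ⟨hball s hs hs', ?_⟩
  rcases le_total s t with hst | hst
  · refine (h.eq_of_path γ hγ s hs' t ht hst fun τ hτ ↦ interior_subset (hball τ ?_ ?_)).symm
    · rw [Real.ball_eq_Ioo] at hs ⊢
      exact ⟨hs.1.trans_le hτ.1, by linarith [hτ.2]⟩
    · exact ⟨hs'.1.trans hτ.1, hτ.2.trans ht.2⟩
  · refine h.eq_of_path γ hγ t ht s hs' hst fun τ hτ ↦ interior_subset (hball τ ?_ ?_)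
    · rw [Real.ball_eq_Ioo] at hs ⊢
      exact ⟨by linarith [hτ.1], hτ.2.trans_lt hs.2⟩
    · exact ⟨ht.1.trans hτ.1, hτ.2.trans hs'.2⟩

variable {D : ∀ q : N, Submodule ℝ (TangentSpace (𝓡 e) q)} {V : N → Set N} {f : N → N → Model e}

/-- The leaf relation only identifies the two ends of a path. Intermediate points are handled
without reparametrizing: nearby points of `γ` have the same plaque value, hence are joined by a
fresh tangent curve. -/
lemma IsTangentPath.eventually_leafProj_eq (h : ∀ q, IsPlaqueMap D q (V q) (f q)) {γ : ℝ → N}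
    (hγ : IsTangentPath D γ) {t : ℝ} (ht : t ∈ Icc (0 : ℝ) 1) :
    ∀ᶠ s in 𝓝[Icc 0 1] t, leafProj D (γ s) = leafProj D (γ t) := by
  have h1 := (h (γ t)).exists_path (γ t) (mem_of_mem_nhds (h (γ t)).mem_nhds) univ Filter.univ_mem
  filter_upwards [(hγ.1.continuousOn t ht).eventually h1,
    (h (γ t)).eventually_eq_along hγ ht (mem_interior_iff_mem_nhds.mpr (h (γ t)).mem_nhds)]
    with s hs hs'
  obtain ⟨g, hg0, hg1, hg, -⟩ := hs hs'.2.symm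
  exact (Quotient.sound (Relation.EqvGen.rel _ _ ⟨g, hg0, hg1, hg.1, hg.2⟩)).symm

/-- A tangent path stays in one leaf. -/
lemma IsTangentPath.leafProj_eq (h : ∀ q, IsPlaqueMap D q (V q) (f q)) {γ : ℝ → N}
    (hγ : IsTangentPath D γ) {s t : ℝ} (hs : s ∈ Icc (0 : ℝ) 1) (ht : t ∈ Icc (0 : ℝ) 1) :
    leafProj D (γ s) = leafProj D (γ t) := by
  refine (isPreconnected_Icc (a := (0 : ℝ)) (b := 1)).induction₂'
    (fun s t ↦ leafProj D (γ s) = leafProj D (γ t)) (fun t ht ↦ ?_)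
    (fun _ _ _ _ _ _ h₁ h₂ ↦ h₁.trans h₂) hs ht
  filter_upwards [hγ.eventually_leafProj_eq h ht] with s hs using ⟨hs.symm, hs⟩

/-- Points of the same leaf are joined by paths inside the leaf. -/
lemma eqvGen_joinedInFibre_leafProj (h : ∀ q, IsPlaqueMap D q (V q) (f q)) {q q' : N}
    (hq : leafProj D q = leafProj D q') : Relation.EqvGen (JoinedInFibre (leafProj D)) q q' := by
  have hq' : Relation.EqvGen (JoinedByTangentCurve D) q q' := Quotient.exact hq
  refine hq'.mono fun q q' hqq ↦ ?_
  obtain ⟨γ, rfl, h1, hγ, hD⟩ := hqq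
  exact ⟨γ, rfl, h1, hγ.continuousOn, fun t ht ↦
    IsTangentPath.leafProj_eq h ⟨hγ, hD⟩ ht (by simp)⟩

/-- A plaque map takes countably many values on a plaque of another one. -/
lemma countable_image_plaque [SecondCountableTopology N]
    (h : ∀ q, IsPlaqueMap D q (V q) (f q)) (j l : N) (c : Model e) :
    (f l '' {z | z ∈ V j ∧ z ∈ interior (V l) ∧ f j z = c}).Countable := by
  set T := {z | z ∈ V j ∧ z ∈ interior (V l) ∧ f j z = c}
  -- Within `T` the map `f l` is locally constant, because nearby points of a plaque are joined by
  -- tangent curves inside `V l`. The Lindelöf property leaves countably many values.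
  obtain ⟨t, -, ht, hT⟩ := TopologicalSpace.countable_cover_nhdsWithin (s := T)
    (f := fun z ↦ {z' | f l z' = f l z}) (fun z hz ↦ by
      have h1 := (h j).exists_path z hz.1 (V l) (mem_interior_iff_mem_nhds.mp hz.2.1)
      filter_upwards [mem_nhdsWithin_of_mem_nhds h1, self_mem_nhdsWithin] with z' hz' hz'T
      obtain ⟨γ, h0, h1, hγ, hγV⟩ := hz' (hz'T.2.2.trans hz.2.2.symm)
      have := (h l).eq_of_path γ hγ 0 (by simp) 1 (by simp) zero_le_one hγV
      rw [h0, h1] at this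
      exact this.symm)
  refine (ht.image (f l)).mono ?_
  rintro _ ⟨z, hz, rfl⟩
  obtain ⟨x, hx, hzx⟩ := mem_iUnion₂.mp (hT hz)
  exact ⟨x, hx, hzx.symm⟩

/-- Replaces tangent curves by finite chains of plaques from a covering family `S`, which can be
counted when `S` is countable. -/
lemma reflTransGen_plaqueRel (h : ∀ q, IsPlaqueMap D q (V q) (f q)) {S : Set N}
    (hS : ∀ z, ∃ j ∈ S, z ∈ interior (V j)) {q q' : N} (hq : leafProj D q = leafProj D q') :
    Relation.ReflTransGen (PlaqueRel V f S) q q' := by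
  have hsymm : ∀ {x y}, Relation.ReflTransGen (PlaqueRel V f S) x y →
      Relation.ReflTransGen (PlaqueRel V f S) y x := by
    intro x y hxy
    induction hxy with
    | refl => exact .refl
    | tail _ hbc ih => exact .head hbc.symm ih
  have hq' : Relation.EqvGen (JoinedByTangentCurve D) q q' := Quotient.exact hq
  induction hq' with
  | refl => exact .refl
  | symm _ _ _ ih => exact hsymm (ih (Quotient.sound (by assumption)))
  | trans _ _ _ h₁ h₂ ih₁ ih₂ => exact (ih₁ (Quotient.sound h₁)).trans (ih₂ (Quotient.sound h₂))
  | rel q q' hjoin =>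
    obtain ⟨γ, rfl, rfl, hγ, hD⟩ := hjoin
    have hpath : IsTangentPath D γ := ⟨hγ, hD⟩
    refine (isPreconnected_Icc (a := (0 : ℝ)) (b := 1)).induction₂'
      (fun s t ↦ Relation.ReflTransGen (PlaqueRel V f S) (γ s) (γ t)) (fun t ht ↦ ?_)
      (fun _ _ _ _ _ _ h₁ h₂ ↦ h₁.trans h₂) (by simp) (by simp)
    obtain ⟨j, hj, htj⟩ := hS (γ t)
    filter_upwards [(h j).eventually_eq_along hpath ht htj] with s hs
    have hrel : PlaqueRel V f S (γ t) (γ s) := ⟨j, hj, htj, hs⟩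
    exact ⟨.single hrel, .single hrel.symm⟩

/-- A plaque map takes countably many values on a leaf. -/
theorem countable_image_leaf [SecondCountableTopology N]
    (h : ∀ q, IsPlaqueMap D q (V q) (f q)) (q₀ l : N) :
    (f l '' {z | leafProj D z = leafProj D q₀ ∧ z ∈ interior (V l)}).Countable := by
  obtain ⟨S, hSc, hS⟩ := TopologicalSpace.countable_cover_nhds (f := fun q ↦ interior (V q))
    (fun q ↦ interior_mem_nhds.mpr (h q).mem_nhds)
  have hS' : ∀ z, ∃ j ∈ S, z ∈ interior (V j) := fun z ↦ by
    obtain ⟨j, hj, hz⟩ := mem_iUnion₂.mp (hS.symm ▸ mem_univ z : z ∈ ⋃ x ∈ S, interior (V x))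
    exact ⟨j, hj, hz⟩
  -- The points reached from `q₀` by a chain of `n` plaques. Inductively these occupy countably many
  -- plaques of each chart, and each such plaque adds countably many values of any other plaque map.
  let A : ℕ → Set N := fun n ↦ Nat.rec {q₀} (fun _ A ↦ {z | ∃ y ∈ A, PlaqueRel V f S y z}) n
  have hA : ∀ n l, (f l '' (A n ∩ interior (V l))).Countable := by
    intro n
    induction n with
    | zero => exact fun l ↦ ((countable_singleton q₀).mono inter_subset_left).image _
    | succ n ih =>
      intro l
      have hsub : f l '' (A (n + 1) ∩ interior (V l)) ⊆ ⋃ j ∈ S,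
          ⋃ c ∈ f j '' (A n ∩ interior (V j)),
            f l '' {z | z ∈ V j ∧ z ∈ interior (V l) ∧ f j z = c} := by
        rintro _ ⟨z, ⟨⟨y, hy, j, hj, hyj, hzj, hf⟩, hzl⟩, rfl⟩
        exact mem_iUnion₂.mpr ⟨j, hj, mem_iUnion₂.mpr ⟨f j y, ⟨y, ⟨hy, hyj⟩, rfl⟩,
          z, ⟨interior_subset hzj, hzl, hf.symm⟩, rfl⟩⟩
      exact (hSc.biUnion fun j _ ↦ (ih j).biUnion fun c _ ↦ countable_image_plaque h j l c).mono hsub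
  refine (countable_iUnion fun n ↦ hA n l).mono ?_
  rintro _ ⟨z, ⟨hz, hzl⟩, rfl⟩
  have hz' := reflTransGen_plaqueRel h hS' hz.symm
  obtain ⟨n, hn⟩ : ∃ n, z ∈ A n := by
    clear hz hzl
    induction hz' with
    | refl => exact ⟨0, rfl⟩
    | tail _ hbc ih =>
      obtain ⟨n, hn⟩ := ih
      exact ⟨n + 1, _, hn, hbc⟩
  exact mem_iUnion.mpr ⟨n, z, ⟨hn, hzl⟩, rfl⟩

end Leaves
-- The kernel of the differential of the leaf projection.
section KernelOfProjection

open scoped Topology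

variable {e d : ℕ} {N : Type*} [TopologicalSpace N] [ChartedSpace (Model e) N]
  {D : ∀ q : N, Submodule ℝ (TangentSpace (𝓡 e) q)} {V : N → Set N} {f : N → N → Model e}
  [TopologicalSpace (LeafSpace D)] [ChartedSpace (Model d) (LeafSpace D)]

/-- The distribution is contained in the kernel of the differential of the leaf projection. -/
theorem mfderiv_leafProj_eq_zero (h : ∀ q, IsPlaqueMap D q (V q) (f q))
    (hπ : IsSubmersion (𝓡 e) (𝓡 d) ∞ (leafProj D)) {q : N} {v : TangentSpace (𝓡 e) q}
    (hv : v ∈ D q) : mfderiv (𝓡 e) (𝓡 d) (leafProj D) q v = 0 := by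
  obtain ⟨ε, hε, γ, hγ, rfl, hd⟩ := (h q).exists_path_of_mem v hv
  have h0 : (0 : ℝ) ∈ Icc (0 : ℝ) 1 := by simp
  have hu : UniqueMDiffWithinAt 𝓘(ℝ, ℝ) (Icc (0 : ℝ) 1) 0 :=
    (uniqueDiffOn_Icc zero_lt_one 0 h0).uniqueMDiffWithinAt
  have hdγ : MDifferentiableWithinAt 𝓘(ℝ, ℝ) (𝓡 e) γ (Icc 0 1) 0 :=
    (hγ.1 0 h0).mdifferentiableWithinAt (by simp)
  have hdπ : MDifferentiableAt (𝓡 e) (𝓡 d) (leafProj D) (γ 0) :=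
    hπ.contMDiff.contMDiffAt.mdifferentiableAt (by simp)
  -- The projection is constant along a curve with initial velocity `ε • v`, so its one-sided
  -- derivative at `0` vanishes.
  have hconst := hγ.eventually_leafProj_eq h h0
  have h3 := hdπ.hasMFDerivAt.comp_hasMFDerivWithinAt (0 : ℝ) hdγ.hasMFDerivWithinAt
  have h4 : HasMFDerivWithinAt 𝓘(ℝ, ℝ) (𝓡 d) (leafProj D ∘ γ) (Icc 0 1) (0 : ℝ) 0 :=
    (hasMFDerivWithinAt_const (leafProj D (γ 0)) (Icc (0 : ℝ) 1) 0).congr_of_eventuallyEq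
      hconst rfl
  have h5 := DFunLike.congr_fun (hu.eq h3 h4) (1 : ℝ)
  have h6 : mfderiv (𝓡 e) (𝓡 d) (leafProj D) (γ 0)
      (mfderivWithin 𝓘(ℝ, ℝ) (𝓡 e) γ (Icc 0 1) 0 (1 : ℝ)) = 0 := h5
  rw [hd, map_smul] at h6
  exact (smul_eq_zero.mp h6).resolve_left hε.ne'

/-- The kernel of the differential of the leaf projection is contained in the distribution, since
a leaf meets every plaque map in a countable set of values. -/
theorem mem_of_mfderiv_leafProj_eq_zero [SecondCountableTopology N]
    (h : ∀ q, IsPlaqueMap D q (V q) (f q))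
    (hπ : IsSubmersion (𝓡 e) (𝓡 d) ∞ (leafProj D)) {q : N} {v : TangentSpace (𝓡 e) q}
    (hv : mfderiv (𝓡 e) (𝓡 d) (leafProj D) q v = 0) : v ∈ D q := by
  obtain ⟨γ, rfl, hγ, hπγ, rfl⟩ := exists_curve_in_fibre hπ hv
  obtain ⟨f', hf', hker⟩ := (h (γ 0)).ker_le
  refine hker _ ?_
  have hV : ∀ᶠ s in 𝓝 (0 : ℝ), γ s ∈ interior (V (γ 0)) :=
    hγ.self_of_nhds.continuousAt.eventually (interior_mem_nhds.mpr (h (γ 0)).mem_nhds)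
  obtain ⟨r, hr, hball⟩ := Metric.eventually_nhds_iff_ball.mp (hγ.and (hπγ.and hV))
  have hcount : (f (γ 0) ∘ γ '' Metric.ball 0 r).Countable := by
    refine (countable_image_leaf h (γ 0) (γ 0)).mono ?_
    rintro _ ⟨s, hs, rfl⟩
    exact ⟨γ s, (hball s hs).2, rfl⟩
  have hcont : ContinuousOn (f (γ 0) ∘ γ) (Metric.ball 0 r) := fun s hs ↦
    (((h (γ 0)).continuousAt _ (interior_subset (hball s hs).2.2)).comp
      (hball s hs).1.continuousAt).continuousWithinAt
  -- The image of an interval under a continuous map is connected. Being countable as well, it is a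
  -- single point.
  have hsub := hcount.isTotallyDisconnected _ subset_rfl
    ((convex_ball (0 : ℝ) r).isPreconnected.image _ hcont)
  have hconst : f (γ 0) ∘ γ =ᶠ[𝓝 0] fun _ ↦ f (γ 0) (γ 0) := by
    filter_upwards [Metric.ball_mem_nhds (0 : ℝ) hr] with s hs
    exact hsub ⟨s, hs, rfl⟩ ⟨0, Metric.mem_ball_self hr, rfl⟩
  have h1 := (hf'.comp (0 : ℝ) (hγ.self_of_nhds.mdifferentiableAt (by simp)).hasMFDerivAt).mfderiv
  have h2 := hconst.mfderiv_eq (I := 𝓘(ℝ, ℝ)) (I' := 𝓘(ℝ, Model e))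
  rw [mfderiv_const] at h2
  exact DFunLike.congr_fun (h1.symm.trans h2) (1 : ℝ)

end KernelOfProjection
-- Transfer of the local Frobenius theorem to manifolds.
section PlaqueMaps

open scoped Topology

variable {e : ℕ} {N : Type*} [TopologicalSpace N] [ChartedSpace (Model e) N]
  [IsManifold (𝓡 e) ∞ N] {D : ∀ q : N, Submodule ℝ (TangentSpace (𝓡 e) q)}

lemma mfderiv_extChartAt_symm_mfderiv_extChartAt {q₀ q : N}
    (hq : q ∈ (extChartAt (𝓡 e) q₀).source) (w : TangentSpace (𝓡 e) q) :
    (mfderiv 𝓘(ℝ, Model e) (𝓡 e) (extChartAt (𝓡 e) q₀).symm (extChartAt (𝓡 e) q₀ q)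
      (mfderiv (𝓡 e) 𝓘(ℝ, Model e) (extChartAt (𝓡 e) q₀) q w) : Model e) = w := by
  have hi := mfderivWithin_extChartAt_symm_comp_mfderiv_extChartAt' (I := 𝓡 e) hq
  rw [ModelWithCorners.range_eq_univ, mfderivWithin_univ] at hi
  exact DFunLike.congr_fun hi w

lemma mdifferentiableAt_extChartAt_symm {q₀ : N} {y : Model e}
    (hy : y ∈ (extChartAt (𝓡 e) q₀).target) :
    MDifferentiableAt 𝓘(ℝ, Model e) (𝓡 e) (extChartAt (𝓡 e) q₀).symm y :=
  ((contMDiffOn_extChartAt_symm (n := ∞) q₀).contMDiffAt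
    ((isOpen_extChartAt_target q₀).mem_nhds hy)).mdifferentiableAt (by simp)

lemma mfderivWithin_extChartAt_symm_comp {q₀ : N} {g : ℝ → Model e} {t : ℝ} {g' : Model e}
    (hg : HasDerivWithinAt g g' (Icc 0 1) t) (ht : t ∈ Icc (0 : ℝ) 1)
    (hgt : g t ∈ (extChartAt (𝓡 e) q₀).target) :
    mfderivWithin 𝓘(ℝ, ℝ) (𝓡 e) ((extChartAt (𝓡 e) q₀).symm ∘ g) (Icc 0 1) t (1 : ℝ) =
      mfderiv 𝓘(ℝ, Model e) (𝓡 e) (extChartAt (𝓡 e) q₀).symm (g t) g' := by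
  have hu : UniqueMDiffWithinAt 𝓘(ℝ, ℝ) (Icc (0 : ℝ) 1) t :=
    (uniqueDiffOn_Icc zero_lt_one t ht).uniqueMDiffWithinAt
  have h1 := ((mdifferentiableAt_extChartAt_symm hgt).hasMFDerivAt.comp_hasMFDerivWithinAt t
    hg.hasFDerivWithinAt.hasMFDerivWithinAt).mfderivWithin hu
  refine (DFunLike.congr_fun h1 (1 : ℝ)).trans ?_
  change mfderiv 𝓘(ℝ, Model e) (𝓡 e) (extChartAt (𝓡 e) q₀).symm (g t) ((1 : ℝ) • g') = _
  rw [one_smul]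

lemma IsTangentCurve.isTangentPath {q₀ : N} {K : Model e → Submodule ℝ (Model e)}
    (hK : ∀ y ∈ (extChartAt (𝓡 e) q₀).target, ∀ u ∈ K y,
      mfderiv 𝓘(ℝ, Model e) (𝓡 e) (extChartAt (𝓡 e) q₀).symm y u ∈
        D ((extChartAt (𝓡 e) q₀).symm y)) {g : ℝ → Model e} (hg : IsTangentCurve K g)
    (hgt : ∀ t ∈ Icc (0 : ℝ) 1, g t ∈ (extChartAt (𝓡 e) q₀).target) :
    IsTangentPath D ((extChartAt (𝓡 e) q₀).symm ∘ g) := by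
  refine ⟨((contMDiffOn_extChartAt_symm (n := ∞) q₀).of_le (by simp)).comp hg.1.contMDiffOn hgt,
    fun t ht ↦ ?_⟩
  have h1 := ((hg.1.differentiableOn (by simp)) t ht).hasDerivWithinAt
  have h2 := hK _ (hgt t ht) _ (hg.2 t ht)
  rwa [← mfderivWithin_extChartAt_symm_comp h1 ht (hgt t ht)] at h2

/-- A distribution of constant rank that is locally the common kernel of a closed one-form, a
one-form and its exterior derivative has plaque maps. -/
theorem exists_isPlaqueMap {q₀ : N} {a b : Model e → Model e →L[ℝ] ℝ}
    (ha : ∀ y ∈ (extChartAt (𝓡 e) q₀).target, ContDiffAt ℝ ∞ a y)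
    (hb : ∀ y ∈ (extChartAt (𝓡 e) q₀).target, ContDiffAt ℝ ∞ b y)
    (hda : ∀ y ∈ (extChartAt (𝓡 e) q₀).target, formDeriv a y = 0)
    (hrank : ∀ y ∈ (extChartAt (𝓡 e) q₀).target, Module.finrank ℝ (formKer a b y) =
      Module.finrank ℝ (formKer a b (extChartAt (𝓡 e) q₀ q₀)))
    (hD : ∀ y ∈ (extChartAt (𝓡 e) q₀).target, ∀ u : Model e, u ∈ formKer a b y ↔
      mfderiv 𝓘(ℝ, Model e) (𝓡 e) (extChartAt (𝓡 e) q₀).symm y u ∈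
        D ((extChartAt (𝓡 e) q₀).symm y)) :
    ∃ V f, IsPlaqueMap D q₀ V f := by
  set φ := extChartAt (𝓡 e) q₀ with hφdef
  -- The points `φ.symm (φ q)` and `q` agree only propositionally, so membership in `D` has to be
  -- transported between their tangent spaces.
  have hcast : ∀ q', ∀ q, q' = q → ∀ w : Model e,
      ((show TangentSpace (𝓡 e) q' from w) ∈ D q' ↔ (show TangentSpace (𝓡 e) q from w) ∈ D q) := by
    rintro _ _ rfl w; rfl
  have hD' : ∀ q ∈ φ.source, ∀ w : TangentSpace (𝓡 e) q,
      w ∈ D q ↔ (mfderiv (𝓡 e) 𝓘(ℝ, Model e) φ q w : Model e) ∈ formKer a b (φ q) := by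
    intro q hq w
    refine Iff.trans ?_ (hD _ (φ.map_source hq) _).symm
    have h1 := mfderiv_extChartAt_symm_mfderiv_extChartAt hq w
    refine (hcast q (φ.symm (φ q)) (φ.left_inv hq).symm w).trans ?_
    exact iff_of_eq (congrArg (fun u : Model e ↦
      (show TangentSpace (𝓡 e) (φ.symm (φ q)) from u) ∈ D (φ.symm (φ q))) h1.symm)
  have hK : ∀ y ∈ φ.target, ∀ u ∈ formKer a b y,
      mfderiv 𝓘(ℝ, Model e) (𝓡 e) φ.symm y u ∈ D (φ.symm y) := fun y hy u hu ↦ (hD y hy u).mp hu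
  have hφd : ∀ q ∈ φ.source, MDifferentiableAt (𝓡 e) 𝓘(ℝ, Model e) φ q := fun q hq ↦
    mdifferentiableAt_extChartAt (by simpa [φ] using hq)
  obtain ⟨V', hV'U, hV'o, hV'0, f0, hfc, hf1, hf2, ⟨f', hf', hker⟩, hf3⟩ :=
    exists_plaqueMap (isOpen_extChartAt_target (I := 𝓡 e) q₀) (mem_extChartAt_target q₀) ha hb hda
      hrank
  have hVo : IsOpen (φ.source ∩ φ ⁻¹' V') :=
    (continuousOn_extChartAt q₀).isOpen_inter_preimage (isOpen_extChartAt_source q₀) hV'o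
  have hq₀ : q₀ ∈ φ.source := mem_extChartAt_source q₀
  refine ⟨φ.source ∩ φ ⁻¹' V', f0 ∘ φ, hVo.mem_nhds ⟨hq₀, hV'0⟩, ?_, ?_, ?_, ?_, ?_⟩
  · exact fun q hq ↦ (hfc _ hq.2).comp (hφd q hq.1).continuousAt
  · intro γ hγ s hs t ht hst hγV
    refine (hf1 s t (φ ∘ γ) (fun τ ↦ mfderiv (𝓡 e) 𝓘(ℝ, Model e) φ (γ τ)
      (mfderivWithin 𝓘(ℝ, ℝ) (𝓡 e) γ (Icc 0 1) τ (1 : ℝ))) hst ?_ (fun τ hτ ↦ (hγV τ hτ).2) ?_).symm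
    · intro τ hτ
      have hsub : Icc s t ⊆ Icc (0 : ℝ) 1 := Icc_subset_Icc hs.1 ht.2
      have h1 := (hφd _ (hγV τ hτ).1).hasMFDerivAt.comp_hasMFDerivWithinAt τ
        ((hγ.1 τ (hsub hτ)).mdifferentiableWithinAt (by simp)).hasMFDerivWithinAt
      have h2 : HasFDerivWithinAt (φ ∘ γ) (show ℝ →L[ℝ] Model e from
          (mfderiv (𝓡 e) 𝓘(ℝ, Model e) φ (γ τ)).comp (mfderivWithin 𝓘(ℝ, ℝ) (𝓡 e) γ (Icc 0 1) τ))
          (Icc 0 1) τ := hasMFDerivWithinAt_iff_hasFDerivWithinAt.mp h1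
      exact (h2.mono hsub).hasDerivWithinAt
    · intro τ hτ
      exact (hD' _ (hγV τ hτ).1 _).mp (hγ.2 τ ⟨hs.1.trans hτ.1, hτ.2.trans ht.2⟩)
  · intro q hq W hW
    have hφsymm : Filter.Tendsto φ.symm (𝓝 (φ q)) (𝓝 q) := by
      have h1 := continuousAt_extChartAt_symm' (I := 𝓡 e) hq.1
      rwa [ContinuousAt, φ.left_inv hq.1] at h1
    have h1 := hf2 (φ q) hq.2 (φ.symm ⁻¹' W ∩ V')
      (Filter.inter_mem (hφsymm hW) (hV'o.mem_nhds hq.2))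
    filter_upwards [(hφd q hq.1).continuousAt.eventually h1,
      (isOpen_extChartAt_source (I := 𝓡 e) q₀).mem_nhds hq.1] with z hz hzs hfz
    obtain ⟨g, hg0, hg1, hg, hgW⟩ := hz hfz
    refine ⟨φ.symm ∘ g, ?_, ?_, hg.isTangentPath hK fun t ht ↦ hV'U (hgW t ht).2,
      fun t ht ↦ (hgW t ht).1⟩
    · rw [Function.comp_apply, hg0, φ.left_inv hq.1]
    · rw [Function.comp_apply, hg1, φ.left_inv hzs]
  · refine ⟨_, hf'.hasMFDerivAt.comp q₀ (hφd q₀ hq₀).hasMFDerivAt, fun v hv ↦ ?_⟩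
    exact (hD' q₀ hq₀ v).mpr (hker _ hv)
  · intro v hv
    obtain ⟨ε, hε, g, hg0, hgd, hg, hgU⟩ := hf3 _ ((hD' q₀ hq₀ v).mp hv)
    have h0 : φ.symm (g 0) = q₀ := by rw [hg0, φ.left_inv hq₀]
    refine ⟨ε, hε, φ.symm ∘ g, hg.isTangentPath hK hgU, h0, ?_⟩
    have hc : ∀ q' (h : q' = q₀) (w : Model e), w = ε • (v : Model e) →
        (show TangentSpace (𝓡 e) q' from w) = h ▸ (ε • v) := by
      rintro _ rfl w hw; exact hw
    refine (mfderivWithin_extChartAt_symm_comp hgd (by simp) (hgU 0 (by simp))).trans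
      (hc _ h0 _ ?_)
    rw [hg0]
    refine (map_smul (mfderiv 𝓘(ℝ, Model e) (𝓡 e) φ.symm (φ q₀)) ε _).trans ?_
    exact congrArg (fun u : Model e ↦ ε • u) (mfderiv_extChartAt_symm_mfderiv_extChartAt hq₀ v)

end PlaqueMaps

/-! ### The characteristic distribution of a coisotropic submanifold. -/

lemma finrank_comap_of_le_range {V W : Type*} [AddCommGroup V] [Module ℝ V] [AddCommGroup W]
    [Module ℝ W] {f : V →ₗ[ℝ] W} (hf : Function.Injective f) {p : Submodule ℝ W}
    (hp : p ≤ LinearMap.range f) : Module.finrank ℝ (p.comap f) = Module.finrank ℝ p := by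
  have h1 := (Submodule.equivMapOfInjective f hf (p.comap f)).finrank_eq
  rwa [Submodule.map_comap_eq_of_le hp] at h1

section CharacteristicDistribution

variable {d e : ℕ} {M : Type*} [TopologicalSpace M] [ChartedSpace (Model d) M]
  [IsManifold (𝓡 d) ∞ M] {N : Type*} [TopologicalSpace N] [ChartedSpace (Model e) N]
  {θ η : OneForm d M} {i : N → M}

lemma finrank_tangentSpace {d : ℕ} {M : Type*} [TopologicalSpace M] [ChartedSpace (Model d) M]
    (x : M) : Module.finrank ℝ (TangentSpace (𝓡 d) x) = d :=
  finrank_euclideanSpace_fin (𝕜 := ℝ) (n := d)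

lemma IsCocontact.coNondegenerate {n : ℕ} (hM : IsCocontact n θ η) (x : M) :
    CoNondegenerate (θ.covec x) (η.covec x) (η.extDeriv x) :=
  (exists_wedgePow_ne_zero_iff_coNondegenerate ((finrank_tangentSpace x).trans hM.dim_eq)
    (η.isAlt_extDeriv x)).mp (hM.volume x)

/-- Because the Reeb vectors are tangent to `N`, the distribution is the common kernel of `i^*θ`,
`i^*η` and `i^*dη`. This is the form that the Frobenius and descent arguments require. -/
lemma mem_characteristicDistribution
    (hM : ∀ x, CoNondegenerate (θ.covec x) (η.covec x) (η.extDeriv x))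
    (htz : IsTZVertical e θ η i) (q : N) (v : TangentSpace (𝓡 e) q) :
    v ∈ characteristicDistribution e θ η i q ↔
      θ (i q) (mfderiv (𝓡 e) (𝓡 d) i q v) = (0 : ℝ) ∧
      η (i q) (mfderiv (𝓡 e) (𝓡 d) i q v) = (0 : ℝ) ∧
      ∀ w, η.extDeriv (i q) (mfderiv (𝓡 e) (𝓡 d) i q v) (mfderiv (𝓡 e) (𝓡 d) i q w) = 0 := by
  have h := (hM (i q)).mem_lambdaOrthogonal_iff (η.isAlt_extDeriv (i q)) (htz q).1 (htz q).2
    (mfderiv (𝓡 e) (𝓡 d) i q v)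
  refine h.trans (and_congr Iff.rfl (and_congr Iff.rfl ⟨fun h w ↦ h _ ⟨w, rfl⟩, ?_⟩))
  rintro h _ ⟨w, rfl⟩
  exact h w

/-- Coisotropy places the `Λ`-orthogonal inside the range of the injective differential of `i`, so
pulling it back to `N` loses no dimension. In particular the rank is constant. -/
lemma finrank_characteristicDistribution
    (hM : ∀ x, CoNondegenerate (θ.covec x) (η.covec x) (η.extDeriv x))
    (hi : IsImmersion (𝓡 e) (𝓡 d) ∞ i)
    (hco : IsCoisotropic e θ η i) (htz : IsTZVertical e θ η i) (q : N) :
    e + Module.finrank ℝ (characteristicDistribution e θ η i q) = d := by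
  have hinj := mfderiv_injective_of_isImmersion hi q
  have h1 := (hM (i q)).finrank_lambdaOrthogonal (η.isAlt_extDeriv (i q)) (htz q).1 (htz q).2
  have h2 : Module.finrank ℝ (tangentRange e i q) = e :=
    (LinearMap.finrank_range_of_inj hinj).trans (finrank_tangentSpace q)
  have h3 : Module.finrank ℝ (characteristicDistribution e θ η i q) =
      Module.finrank ℝ (tangentOrthogonal e θ η i q) := finrank_comap_of_le_range hinj (hco q)
  rw [h2, finrank_tangentSpace] at h1
  rw [h3]
  exact h1

variable [IsManifold (𝓡 e) ∞ N]

lemma mfderiv_extChartAt_symm_bijective {q₀ : N} {y : Model e}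
    (hy : y ∈ (extChartAt (𝓡 e) q₀).target) :
    Function.Bijective (mfderiv 𝓘(ℝ, Model e) (𝓡 e) (extChartAt (𝓡 e) q₀).symm y) := by
  have h := isInvertible_mfderivWithin_extChartAt_symm (I := 𝓡 e) hy
  rw [ModelWithCorners.range_eq_univ, mfderivWithin_univ] at h
  exact h.bijective

/-- In a chart of `N` the distribution is `formKer` of the pulled-back forms. The first is closed
because `dθ = 0`, and the rank is constant. -/
theorem exists_isPlaqueMap_characteristicDistribution
    (hM : ∀ x, CoNondegenerate (θ.covec x) (η.covec x) (η.extDeriv x))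
    (hθ : ∀ x, θ.extDeriv x = 0) (hi : IsImmersion (𝓡 e) (𝓡 d) ∞ i)
    (hco : IsCoisotropic e θ η i) (htz : IsTZVertical e θ η i) (q₀ : N) :
    ∃ V f, IsPlaqueMap (characteristicDistribution e θ η i) q₀ V f := by
  set ψ := (extChartAt (𝓡 e) q₀).symm
  have hψ : ∀ y ∈ (extChartAt (𝓡 e) q₀).target, ContMDiffAt 𝓘(ℝ, Model e) (𝓡 e) ∞ ψ y :=
    fun y hy ↦ (contMDiffOn_extChartAt_symm q₀).contMDiffAt
      ((isOpen_extChartAt_target q₀).mem_nhds hy)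
  have hiψ : ∀ y ∈ (extChartAt (𝓡 e) q₀).target, ContMDiffAt 𝓘(ℝ, Model e) (𝓡 d) ∞ (i ∘ ψ) y :=
    fun y hy ↦ hi.contMDiff.contMDiffAt.comp y (hψ y hy)
  have hdi : ∀ y ∈ (extChartAt (𝓡 e) q₀).target, ∀ u : Model e,
      mfderiv 𝓘(ℝ, Model e) (𝓡 d) (i ∘ ψ) y u =
        mfderiv (𝓡 e) (𝓡 d) i (ψ y) (mfderiv 𝓘(ℝ, Model e) (𝓡 e) ψ y u) := fun y hy u ↦
    DFunLike.congr_fun ((hi.contMDiff.contMDiffAt.mdifferentiableAt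
      (by simp)).hasMFDerivAt.comp y ((hψ y hy).mdifferentiableAt (by simp)).hasMFDerivAt).mfderiv u
  have hD : ∀ y ∈ (extChartAt (𝓡 e) q₀).target, ∀ u : Model e,
      u ∈ formKer (pullbackForm θ (i ∘ ψ)) (pullbackForm η (i ∘ ψ)) y ↔
        mfderiv 𝓘(ℝ, Model e) (𝓡 e) ψ y u ∈ characteristicDistribution e θ η i (ψ y) := by
    intro y hy u
    rw [mem_characteristicDistribution hM htz, mem_formKer]
    simp only [η.formDeriv_pullbackForm (hiψ y hy), ← hdi y hy]
    refine and_congr Iff.rfl (and_congr Iff.rfl ⟨fun h w ↦ ?_, fun h w ↦ ?_⟩)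
    · obtain ⟨w, rfl⟩ := (mfderiv_extChartAt_symm_bijective hy).2 w
      have := h w
      rwa [hdi y hy w] at this
    · rw [hdi y hy w]
      exact h _
  have hrank : ∀ y ∈ (extChartAt (𝓡 e) q₀).target,
      e + Module.finrank ℝ (formKer (pullbackForm θ (i ∘ ψ)) (pullbackForm η (i ∘ ψ)) y) = d := by
    intro y hy
    obtain ⟨hinj, hsurj⟩ := mfderiv_extChartAt_symm_bijective hy
    let L : Model e →ₗ[ℝ] TangentSpace (𝓡 e) (ψ y) :=
      (mfderiv 𝓘(ℝ, Model e) (𝓡 e) ψ y).toLinearMap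
    have h1 : formKer (pullbackForm θ (i ∘ ψ)) (pullbackForm η (i ∘ ψ)) y =
        (characteristicDistribution e θ η i (ψ y)).comap L := by
      ext u; exact hD y hy u
    have hL : LinearMap.range L = ⊤ := LinearMap.range_eq_top.mpr hsurj
    rw [h1, finrank_comap_of_le_range (f := L) hinj (hL ▸ le_top)]
    exact finrank_characteristicDistribution hM hi hco htz (ψ y)
  refine exists_isPlaqueMap (fun y hy ↦ θ.contDiffAt_pullbackForm (hiψ y hy))
    (fun y hy ↦ η.contDiffAt_pullbackForm (hiψ y hy)) (fun y hy ↦ ?_) (fun y hy ↦ ?_) hD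
  · refine ContinuousLinearMap.ext fun u ↦ ContinuousLinearMap.ext fun v ↦ ?_
    rw [θ.formDeriv_pullbackForm (hiψ y hy), hθ]
    rfl
  · exact Nat.add_left_cancel ((hrank y hy).trans (hrank _ (mem_extChartAt_target q₀)).symm)

end CharacteristicDistribution
-- Naturality of the exterior derivative.
section Reduction

variable {m d e : ℕ} {M : Type*} [TopologicalSpace M] [ChartedSpace (Model m) M]
  [IsManifold (𝓡 m) ∞ M] {B : Type*} [TopologicalSpace B] [ChartedSpace (Model d) B]
  [IsManifold (𝓡 d) ∞ B] {N : Type*} [TopologicalSpace N] [ChartedSpace (Model e) N]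
  [IsManifold (𝓡 e) ∞ N]

/-- The exterior derivative of a one-form, read in a chart of `N`. -/
lemma OneForm.formDeriv_pullbackForm_extChartAt_symm (α : OneForm m M) {i : N → M}
    (hi : ContMDiff (𝓡 e) (𝓡 m) ∞ i) (q : N) (u v : TangentSpace (𝓡 e) q) :
    formDeriv (pullbackForm α (i ∘ (extChartAt (𝓡 e) q).symm)) (extChartAt (𝓡 e) q q)
        (mfderiv (𝓡 e) 𝓘(ℝ, Model e) (extChartAt (𝓡 e) q) q u)
        (mfderiv (𝓡 e) 𝓘(ℝ, Model e) (extChartAt (𝓡 e) q) q v) =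
      α.extDeriv (i q) (mfderiv (𝓡 e) (𝓡 m) i q u) (mfderiv (𝓡 e) (𝓡 m) i q v) := by
  set φ := extChartAt (𝓡 e) q
  have hq : q ∈ φ.source := mem_extChartAt_source q
  have hψ : ContMDiffAt 𝓘(ℝ, Model e) (𝓡 e) ∞ φ.symm (φ q) :=
    (contMDiffOn_extChartAt_symm q).contMDiffAt
      ((isOpen_extChartAt_target q).mem_nhds (mem_extChartAt_target q))
  have hiψ : ContMDiffAt 𝓘(ℝ, Model e) (𝓡 m) ∞ (i ∘ φ.symm) (φ q) := hi.contMDiffAt.comp _ hψ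
  have hφ : MDifferentiableAt (𝓡 e) 𝓘(ℝ, Model e) φ q := mdifferentiableAt_extChartAt (by simp)
  have hd : ∀ u : TangentSpace (𝓡 e) q, (mfderiv 𝓘(ℝ, Model e) (𝓡 m) (i ∘ φ.symm) (φ q)
      (mfderiv (𝓡 e) 𝓘(ℝ, Model e) φ q u) : Model m) = mfderiv (𝓡 e) (𝓡 m) i q u := by
    intro u
    have h1 : (i ∘ φ.symm) ∘ φ =ᶠ[nhds q] i := by
      filter_upwards [(isOpen_extChartAt_source (I := 𝓡 e) q).mem_nhds hq] with z hz
      exact congrArg i (φ.left_inv hz)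
    have h2 := ((hiψ.mdifferentiableAt (by simp)).hasMFDerivAt.comp q hφ.hasMFDerivAt).mfderiv
    exact DFunLike.congr_fun (h2.symm.trans h1.mfderiv_eq) u
  have hcast : ∀ x y, x = y → ∀ u v u' v' : Model m, u = u' → v = v' →
      α.extDeriv x u v = α.extDeriv y u' v' := by
    rintro _ _ rfl _ _ _ _ rfl rfl; rfl
  exact (α.formDeriv_pullbackForm hiψ _ _).trans
    (hcast _ _ (congrArg i (φ.left_inv hq)) _ _ _ _ (hd u) (hd v))

/-- Naturality of the exterior derivative. -/
theorem extDeriv_eq_of_pullback_eq {α : OneForm m M} {β : OneForm d B} {i : N → M} {π : N → B}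
    (hi : ContMDiff (𝓡 e) (𝓡 m) ∞ i) (hπ : ContMDiff (𝓡 e) (𝓡 d) ∞ π)
    (h : ∀ q, α.pullback e i q = β.pullback e π q) (q : N) (u v : TangentSpace (𝓡 e) q) :
    β.extDeriv (π q) (mfderiv (𝓡 e) (𝓡 d) π q u) (mfderiv (𝓡 e) (𝓡 d) π q v) =
      α.extDeriv (i q) (mfderiv (𝓡 e) (𝓡 m) i q u) (mfderiv (𝓡 e) (𝓡 m) i q v) := by
  rw [← α.formDeriv_pullbackForm_extChartAt_symm hi q u v,
    ← β.formDeriv_pullbackForm_extChartAt_symm hπ q u v]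
  set φ := extChartAt (𝓡 e) q
  have heq : pullbackForm β (π ∘ φ.symm) =ᶠ[nhds (φ q)] pullbackForm α (i ∘ φ.symm) := by
    filter_upwards [(isOpen_extChartAt_target (I := 𝓡 e) q).mem_nhds
      (mem_extChartAt_target q)] with y hy
    have hψ := (mdifferentiableAt_extChartAt_symm hy).hasMFDerivAt
    have h1 := ((hi.contMDiffAt.mdifferentiableAt (by simp)).hasMFDerivAt.comp y hψ).mfderiv
    have h2 := ((hπ.contMDiffAt.mdifferentiableAt (by simp)).hasMFDerivAt.comp y hψ).mfderiv
    refine ContinuousLinearMap.ext fun w ↦ ?_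
    have h3 := DFunLike.congr_fun (h (φ.symm y)) (mfderiv 𝓘(ℝ, Model e) (𝓡 e) φ.symm y w)
    exact ((congrArg (β (π (φ.symm y))) (DFunLike.congr_fun h2 w)).trans h3.symm).trans
      (congrArg (α (i (φ.symm y))) (DFunLike.congr_fun h1 w)).symm
  have h1 := heq.fderiv_eq (𝕜 := ℝ)
  rw [formDeriv, formDeriv, h1]

end Reduction
end CocontactGeometry

/-! ### The reduction theorem. -/

open CocontactGeometry in
theorem mainTheorem5 (n k d : ℕ)
    {M : Type*} [TopologicalSpace M] [T2Space M] [SecondCountableTopology M]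
    [ChartedSpace (Model (2 * n + 2)) M] [IsManifold (𝓡 (2 * n + 2)) ∞ M]
    (θ η : OneForm (2 * n + 2) M) (hM : IsCocontact n θ η)
    {N : Type*} [TopologicalSpace N] [T2Space N] [SecondCountableTopology N] [Nonempty N]
    [ChartedSpace (Model (k + 2)) N] [IsManifold (𝓡 (k + 2)) ∞ N]
    (i : N → M) (hi : IsImmersion (𝓡 (k + 2)) (𝓡 (2 * n + 2)) ∞ i) (hinj : Function.Injective i)
    (hco : IsCoisotropic (k + 2) θ η i) (htz : IsTZVertical (k + 2) θ η i)
    [TopologicalSpace (ReducedSpace (k + 2) θ η i)]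
    [ChartedSpace (Model d) (ReducedSpace (k + 2) θ η i)]
    [IsManifold (𝓡 d) ∞ (ReducedSpace (k + 2) θ η i)]
    (hπ : IsSubmersion (𝓡 (k + 2)) (𝓡 d) ∞ (reducedProj (k + 2) θ η i)) :
    ∃ θN ηN : OneForm d (ReducedSpace (k + 2) θ η i),
      (∀ q : N, θ.pullback (k + 2) i q = θN.pullback (k + 2) (reducedProj (k + 2) θ η i) q) ∧
      (∀ q : N, η.pullback (k + 2) i q = ηN.pullback (k + 2) (reducedProj (k + 2) θ η i) q) ∧
      (∀ θN' : OneForm d (ReducedSpace (k + 2) θ η i),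
        (∀ q : N, θ.pullback (k + 2) i q =
          θN'.pullback (k + 2) (reducedProj (k + 2) θ η i) q) → θN' = θN) ∧
      (∀ ηN' : OneForm d (ReducedSpace (k + 2) θ η i),
        (∀ q : N, η.pullback (k + 2) i q =
          ηN'.pullback (k + 2) (reducedProj (k + 2) θ η i) q) → ηN' = ηN) ∧
      n ≤ k ∧ d = 2 * (k - n) + 2 ∧ IsCocontact (k - n) θN ηN := by
  have hnd := hM.coNondegenerate
  choose V f hVf using exists_isPlaqueMap_characteristicDistribution hnd hM.closed hi hco htz
  set D := characteristicDistribution (k + 2) θ η i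
  have hsurj : Function.Surjective (reducedProj (k + 2) θ η i) := Quotient.mk_surjective
  have hker : ∀ q v, mfderiv (𝓡 (k + 2)) (𝓡 d) (reducedProj (k + 2) θ η i) q v = 0 ↔ v ∈ D q :=
    fun q v ↦ ⟨mem_of_mfderiv_leafProj_eq_zero hVf hπ, mfderiv_leafProj_eq_zero hVf hπ⟩
  have hmem := mem_characteristicDistribution hnd htz
  have hfib : ∀ q q', reducedProj (k + 2) θ η i q = reducedProj (k + 2) θ η i q' →
      Relation.EqvGen (JoinedInFibre (reducedProj (k + 2) θ η i)) q q' :=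
    fun q q' h ↦ eqvGen_joinedInFibre_leafProj hVf h
  have hismooth := hi.contMDiff
  obtain ⟨θN, hθN⟩ := exists_oneForm_pullback_eq θ hismooth hπ hsurj hfib
    (fun q v hv ↦ ((hmem q v).mp ((hker q v).mp hv)).1)
    (fun q v _ w ↦ by rw [hM.closed]; rfl)
  obtain ⟨ηN, hηN⟩ := exists_oneForm_pullback_eq η hismooth hπ hsurj hfib
    (fun q v hv ↦ ((hmem q v).mp ((hker q v).mp hv)).2.1)
    (fun q v hv ↦ ((hmem q v).mp ((hker q v).mp hv)).2.2)
  have hdθ := extDeriv_eq_of_pullback_eq hismooth hπ.contMDiff hθN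
  have hdη := extDeriv_eq_of_pullback_eq hismooth hπ.contMDiff hηN
  have hdπ := mfderiv_surjective_of_isSubmersion hπ
  have hndN : ∀ p, CoNondegenerate (θN.covec p) (ηN.covec p) (ηN.extDeriv p) := by
    intro p
    obtain ⟨q, rfl⟩ := hsurj p
    exact (hnd (i q)).reduction (η.isAlt_extDeriv (i q)) (hdπ q) (htz q).1 (htz q).2
      (fun v hv ↦ (hker q v).mpr hv) (fun t ↦ (DFunLike.congr_fun (hθN q) t).symm)
      (fun t ↦ (DFunLike.congr_fun (hηN q) t).symm) (hdη q)
  obtain ⟨q₀⟩ := ‹Nonempty N›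
  -- The reduced forms are independent at a point, and this is what yields `n ≤ k` below.
  have hd2 : 2 ≤ d := by
    have h1 := (hndN (reducedProj (k + 2) θ η i q₀)).two_le_finrank
    rwa [finrank_tangentSpace] at h1
  have hdim : d + Module.finrank ℝ (D q₀) = k + 2 := by
    have h1 := LinearMap.finrank_range_add_finrank_ker
      (mfderiv (𝓡 (k + 2)) (𝓡 d) (reducedProj (k + 2) θ η i) q₀).toLinearMap
    have h2 : LinearMap.ker (mfderiv (𝓡 (k + 2)) (𝓡 d) (reducedProj (k + 2) θ η i) q₀).toLinearMap =
        D q₀ := by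
      ext v; exact hker q₀ v
    rw [LinearMap.range_eq_top.mpr (hdπ q₀), finrank_top, h2, finrank_tangentSpace,
      finrank_tangentSpace] at h1
    exact h1
  have hrank : k + 2 + Module.finrank ℝ (D q₀) = 2 * n + 2 :=
    finrank_characteristicDistribution hnd hi hco htz q₀
  -- Eliminating the rank of `D` gives `d + 2 n = 2 k + 2`. With `d ≥ 2` this makes the natural
  -- subtraction `k - n` a genuine one.
  have hnk : n ≤ k := by omega
  have hdk : d = 2 * (k - n) + 2 := by omega
  refine ⟨θN, ηN, hθN, hηN, fun θN' h ↦ ?_, fun ηN' h ↦ ?_, hnk, hdk, hdk, fun p ↦ ?_, fun p ↦ ?_⟩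
  · exact oneForm_eq_of_pullback_eq hπ hsurj fun q ↦ (h q).symm.trans (hθN q)
  · exact oneForm_eq_of_pullback_eq hπ hsurj fun q ↦ (h q).symm.trans (hηN q)
  · obtain ⟨q, rfl⟩ := hsurj p
    ext u v
    obtain ⟨u, rfl⟩ := hdπ q u
    obtain ⟨v, rfl⟩ := hdπ q v
    rw [hdθ, hM.closed]
    rfl
  · exact (exists_wedgePow_ne_zero_iff_coNondegenerate ((finrank_tangentSpace p).trans hdk)
      (ηN.isAlt_extDeriv p)).mpr (hndN p)
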